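/- Let $N\ge 1$, let $\Omega$ be a finite set and $f:\Omega\to\mathbb{N}=\{0,1,2,\dots\}$. For every $\varepsilon\in(0,1)$ and every pair $(i,j)\in\{1,\dots,N\}^2$ let $P^{(\varepsilon)}_{ij}$ be a transition matrix on $\Omega$, and let $\mathbf X^{(\varepsilon)}=(X^{(\varepsilon)}_{ij})_{i,j}$ be the Markov chain on $\Omega^{N^2}$ whose components are independent Markov chains with transition matrices $P^{(\varepsilon)}_{ij}$; assume that $\mathbf X^{(\varepsilon)}$ is irreducible and aperiodic, and let $\nu^{(\varepsilon)}_{ij}$ be the stationary distribution of $P^{(\varepsilon)}_{ij}$. Consider the $N\times N$ input-queued switch with arrivals $A^t_{ij}=f(X^t_{ij})$ under MaxWeight: given the queue lengths $\mathbf Q^t\in\mathbb{N}^{N\times N}$, the schedule $\mathbf S^t$ is chosen uniformly at random, independently of everything else given $\mathbf Q^t$, among the perfect matchings ($0$-$1$ matrices with all row and column sums equal to $1$) that maximize $\langle\mathbf Q^t,\mathbf s\rangle=\sum_{ij}Q^t_{ij}s_{ij}$ over all feasible schedules $\mathbf s$ ($0$-$1$ matrices with all row and column sums at most $1$), and $Q^{t+1}_{ij}=\max(Q^t_{ij}+A^t_{ij}-S^t_{ij},0)$.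 Assume that for every $\varepsilon\in(0,1)$ the Markov chain $(\mathbf Q^{t},\mathbf X^{t})^{(\varepsilon)}$ is irreducible and aperiodic on its state space $\mathcal S^{(\varepsilon)}$, a non-empty subset of $\mathbb{N}^{N\times N}\times\Omega^{N^2}$ that the chain does not leave. Assume moreover: 1. (Rates) $\lambda^{(\varepsilon)}_{ij}:=E_{\nu^{(\varepsilon)}_{ij}}[f(X)]=(1-\varepsilon)v_{ij}$ for all $\varepsilon\in(0,1)$, where $\sum_i v_{ij}=\sum_j v_{ij}=1$ and $v_{\min}=\min_{ij}v_{ij}>0$. 2. (Uniform geometric mixing) There are constants $\alpha\in(0,1)$ and $C$ such that, for all $\varepsilon\in(0,1)$, all $i,j$, all $m\ge 1$ and all $x\in\Omega$, $\bigl|E[f(X^m_{ij})\mid X^0_{ij}=x]-\lambda^{(\varepsilon)}_{ij}\bigr|\le 2LC\alpha^m$, where $L=\max_{\Omega} f$. 3. (Autocorrelations) With $\gamma^{(\varepsilon)}_{ij}(t)=E\bigl[(A^t_{ij}-\lambda^{(\varepsilon)}_{ij})(A^0_{ij}-\lambda^{(\varepsilon)}_{ij})\mid X^0_{ij}\sim\nu^{(\varepsilon)}_{ij}\bigr]$,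 the limit $\gamma_{ij}(t)=\lim_{\varepsilon\downarrow 0}\gamma^{(\varepsilon)}_{ij}(t)$ exists for all $i,j$ and all $t\ge 0$. Then the limits $\sigma_{ij}^2=\gamma_{ij}(0)+2\lim_{m\to\infty}\sum_{t=1}^m\gamma_{ij}(t)$ exist and are nonnegative; for every $\varepsilon\in(0,1)$ the chain $(\mathbf Q^t,\mathbf X^t)^{(\varepsilon)}$ has an invariant distribution on $\mathcal S^{(\varepsilon)}$ to which it converges in distribution from every initial state in $\mathcal S^{(\varepsilon)}$, and the mean sum of the queue lengths $E\bigl[\sum_{ij}\overline Q^{(\varepsilon)}_{ij}\bigr]$ under this distribution is finite; and $$\lim_{\varepsilon\downarrow 0}\varepsilon\,E\Bigl[\sum_{ij}\overline Q^{(\varepsilon)}_{ij}\Bigr]=\Bigl(1-\frac{1}{2N}\Bigr)\|\boldsymbol\sigma\|^2,\qquad \|\boldsymbol\sigma\|^2=\sum_{ij}\sigma_{ij}^2 .$$ -/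

import Mathlib

open Filter Topology
open scoped ENNReal

noncomputable section

/-! ### Markov chains with a given transition kernel -/

/-- The law after `n` steps of the Markov chain with transition kernel `K`, started from the
initial distribution `μ`. -/
def lawAfter {α : Type*} (K : α → PMF α) (μ : PMF α) : ℕ → PMF α
  | 0 => μ
  | n + 1 => (lawAfter K μ n).bind K

/-- `S` is a state space of the chain (it is never left) on which the chain is irreducible:
any state of `S` is reached from any other one with positive probability. -/
def IrreducibleOn {α : Type*} (K : α → PMF α) (S : Set α) : Prop :=
  S.Nonempty ∧ (∀ a ∈ S, ∀ b, K a b ≠ 0 → b ∈ S) ∧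
    ∀ a ∈ S, ∀ b ∈ S, ∃ n : ℕ, lawAfter K (PMF.pure a) n b ≠ 0

/-- Every state of `S` has period `1`: the only common divisor of its possible return times
is `1`. -/
def AperiodicOn {α : Type*} (K : α → PMF α) (S : Set α) : Prop :=
  ∀ a ∈ S, ∀ d : ℕ, (∀ n : ℕ, 1 ≤ n → lawAfter K (PMF.pure a) n a ≠ 0 → d ∣ n) → d = 1

/-- `π` is an invariant distribution of the chain. -/
def IsInvariantLaw {α : Type*} (K : α → PMF α) (π : PMF α) : Prop :=
  π.bind K = π

/-- `π` is the steady-state distribution of the chain on the state space `S`: it is carried by `S`,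
it is invariant, and from every initial state in `S` the chain converges in distribution to `π`
(on a countable discrete state space, this is convergence of the point probabilities). -/
def IsSteadyState {α : Type*} (K : α → PMF α) (S : Set α) (π : PMF α) : Prop :=
  π.support ⊆ S ∧ IsInvariantLaw K π ∧
    ∀ a ∈ S, ∀ b, Tendsto (fun n : ℕ => lawAfter K (PMF.pure a) n b) atTop (𝓝 (π b))

/-! ### Functions of a finite-state Markov chain -/

/-- The mean `E[f(X)]` for `X ∼ π`. -/
def meanOf {Ω : Type*} [Fintype Ω] (π : PMF Ω) (f : Ω → ℕ) : ℝ :=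
  ∑ x, (π x).toReal * (f x : ℝ)

/-- The autocorrelation `E[(f(Xᵗ) - λ)(f(X⁰) - λ)]` for the chain with kernel `K` started from
`X⁰ ∼ π`, where `λ = E[f(X⁰)]`. -/
def autoCorr {Ω : Type*} [Fintype Ω] (K : Ω → PMF Ω) (π : PMF Ω) (f : Ω → ℕ) (t : ℕ) : ℝ :=
  ∑ x, (π x).toReal * (((f x : ℝ) - meanOf π f) *
    ∑ y, (lawAfter K (PMF.pure x) t y).toReal * ((f y : ℝ) - meanOf π f))

/-- The transition kernel of a vector of independent Markov chains, the `p`-th of which has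
kernel `P p`. -/
def vectorKernel {ι Ω : Type*} [Fintype ι] [DecidableEq ι] [Fintype Ω]
    (P : ι → Ω → PMF Ω) (x : ι → Ω) : PMF (ι → Ω) :=
  PMF.ofFintype (fun y => ∏ p, P p (x p) (y p)) (by
    have h : ∀ p, ∑ z, P p (x p) z = 1 := fun p => by
      rw [← tsum_fintype (L := SummationFilter.unconditional _)]; exact (P p (x p)).tsum_coe
    rw [← Fintype.piFinset_univ, ← Finset.prod_univ_sum (fun _ => Finset.univ)
      (fun p z => P p (x p) z)]
    simp [h])

/-! ### The `N × N` switch -/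

/-- Feasible schedules: `0`-`1` matrices with all row sums and column sums at most `1`. -/
def feasibleSchedules (N : ℕ) : Finset (Fin N × Fin N → Fin 2) :=
  {s | (∀ i, ∑ j, (s (i, j) : ℕ) ≤ 1) ∧ ∀ j, ∑ i, (s (i, j) : ℕ) ≤ 1}

/-- Perfect matchings: `0`-`1` matrices with all row sums and column sums equal to `1`. -/
def perfectMatchings (N : ℕ) : Finset (Fin N × Fin N → Fin 2) :=
  {s | (∀ i, ∑ j, (s (i, j) : ℕ) = 1) ∧ ∀ j, ∑ i, (s (i, j) : ℕ) = 1}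

/-- The weight `⟨q, s⟩` of a schedule. -/
def weight {N : ℕ} (q : Fin N × Fin N → ℕ) (s : Fin N × Fin N → Fin 2) : ℕ :=
  ∑ p, q p * (s p : ℕ)

/-- The schedules that MaxWeight may choose: the perfect matchings whose weight is maximal among
all feasible schedules. -/
def maxWeightSchedules {N : ℕ} (q : Fin N × Fin N → ℕ) : Finset (Fin N × Fin N → Fin 2) :=
  {s ∈ perfectMatchings N | ∀ s' ∈ feasibleSchedules N, weight q s' ≤ weight q s}

theorem maxWeightSchedules_nonempty {N : ℕ} (q : Fin N × Fin N → ℕ) :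
    (maxWeightSchedules q).Nonempty := by
  classical
  have h0 : (feasibleSchedules N).Nonempty := ⟨fun _ => 0, by simp [feasibleSchedules]⟩
  obtain ⟨s, hs, hmax⟩ := (feasibleSchedules N).exists_max_image
    (fun s => toLex (weight q s, ∑ p, (s p : ℕ))) h0
  have hs' := hs
  simp only [feasibleSchedules, Finset.mem_filter, Finset.mem_univ, true_and] at hs'
  obtain ⟨hr, hc⟩ := hs'
  have hw : ∀ s' ∈ feasibleSchedules N, weight q s' ≤ weight q s := fun s' h' => by
    have := hmax s' h'
    rw [Prod.Lex.toLex_le_toLex] at this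
    rcases this with h | h
    · exact h.le
    · exact h.1.le
  have key : ¬ ((∃ i, ∑ j, (s (i, j) : ℕ) = 0) ∧ ∃ j, ∑ i, (s (i, j) : ℕ) = 0) := by
    rintro ⟨⟨i, hi⟩, j, hj⟩
    have hi0 : ∀ j', (s (i, j') : ℕ) = 0 := fun j' =>
      (Finset.sum_eq_zero_iff.1 hi) j' (Finset.mem_univ _)
    have hj0 : ∀ i', (s (i', j) : ℕ) = 0 := fun i' =>
      (Finset.sum_eq_zero_iff.1 hj) i' (Finset.mem_univ _)
    set s' : Fin N × Fin N → Fin 2 := Function.update s (i, j) 1 with hs'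
    have hval : ∀ p, (s' p : ℕ) = (s p : ℕ) + if p = (i, j) then 1 else 0 := by
      intro p
      by_cases hp : p = (i, j)
      · subst hp; simp [hs', hi0]
      · simp [hs', hp]
    have hfeas : s' ∈ feasibleSchedules N := by
      simp only [feasibleSchedules, Finset.mem_filter, Finset.mem_univ, true_and, hval,
        Finset.sum_add_distrib, Prod.mk.injEq]
      refine ⟨fun i' => ?_, fun j' => ?_⟩
      · by_cases h : i' = i
        · subst h; simp [hi0]
        · simpa [h] using hr i'
      · by_cases h : j' = j
        · subst h; simp [hj0]
        · simpa [h] using hc j'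
    have h1 : weight q s ≤ weight q s' := by
      refine Finset.sum_le_sum fun p _ => Nat.mul_le_mul_left _ ?_
      rw [hval]; exact Nat.le_add_right _ _
    have h2 : ∑ p, (s' p : ℕ) = ∑ p, (s p : ℕ) + 1 := by
      simp [hval, Finset.sum_add_distrib]
    have := hmax s' hfeas
    rw [Prod.Lex.toLex_le_toLex] at this
    rcases this with h | h
    · exact absurd h (not_lt.2 h1)
    · have := h.2
      simp only [h2] at this
      omega
  have e1 : ∑ p, (s p : ℕ) = ∑ i, ∑ j, (s (i, j) : ℕ) := Fintype.sum_prod_type _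
  have e2 : ∑ p, (s p : ℕ) = ∑ j, ∑ i, (s (i, j) : ℕ) := Fintype.sum_prod_type_right _
  have hfull : ∀ g : Fin N → ℕ, (∀ i, g i ≤ 1) → ∑ i, g i = N → ∀ i, g i = 1 := by
    intro g hg hsum i
    have : ∑ i, g i = ∑ _i : Fin N, 1 := by simpa using hsum
    exact (Finset.sum_eq_sum_iff_of_le (fun i _ => hg i)).1 this i (Finset.mem_univ _)
  have hN : ∑ p, (s p : ℕ) = N := by
    by_contra hne
    apply key
    constructor
    · by_contra hcon
      push Not at hcon
      apply hne
      rw [e1, Finset.sum_congr rfl (g := fun _ => 1)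
        (fun i _ => le_antisymm (hr i) (Nat.one_le_iff_ne_zero.2 (hcon i)))]
      simp
    · by_contra hcon
      push Not at hcon
      apply hne
      rw [e2, Finset.sum_congr rfl (g := fun _ => 1)
        (fun i _ => le_antisymm (hc i) (Nat.one_le_iff_ne_zero.2 (hcon i)))]
      simp
  refine ⟨s, ?_⟩
  simp only [maxWeightSchedules, perfectMatchings, Finset.mem_filter, Finset.mem_univ, true_and]
  exact ⟨⟨hfull _ hr (e1 ▸ hN), hfull _ hc (e2 ▸ hN)⟩, hw⟩

/-- A state `(q, x)` of the switch: the matrix of queue lengths and the states of the chains that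
modulate the arrivals. -/
abbrev SwitchState (N : ℕ) (Ω : Type*) := (Fin N × Fin N → ℕ) × (Fin N × Fin N → Ω)

/-- One time slot of the switch under MaxWeight, from the state `(q, x)`. The schedule `s` is
uniformly distributed on the MaxWeight schedules for `q`, the arrivals are `f (x p)`, the new queue
lengths are `[q p + f (x p) - s p]⁺` (the subtraction of natural numbers is truncated at `0`), and,
independently of `s`, the modulating chains make one step. -/
def switchKernel {N : ℕ} {Ω : Type*} [Fintype Ω] (f : Ω → ℕ)
    (P : Fin N × Fin N → Ω → PMF Ω) (z : SwitchState N Ω) : PMF (SwitchState N Ω) :=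
  (PMF.uniformOfFinset (maxWeightSchedules z.1) (maxWeightSchedules_nonempty z.1)).bind fun s =>
    (vectorKernel P z.2).map fun x' => (fun p => z.1 p + f (z.2 p) - (s p : ℕ), x')

/-- The mean sum of the queue lengths `E[∑ᵢⱼ Qᵢⱼ]`, as an element of `[0, ∞]`, when the state of the
switch has distribution `π`. -/
def meanTotalQueue {N : ℕ} {Ω : Type*} (π : PMF (SwitchState N Ω)) : ℝ≥0∞ :=
  ∑' z, π z * ((∑ p, z.1 p : ℕ) : ℝ≥0∞)

/-- The face of the capacity region on which all input and output ports are saturated. -/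
def saturatedFace (N : ℕ) : Set (Fin N × Fin N → ℝ) :=
  {v | (∀ p, 0 ≤ v p) ∧ (∀ i, ∑ j, v (i, j) = 1) ∧ ∀ j, ∑ i, v (i, j) = 1}

end

/-!
The theorem is proved by the drift method.

Time correlations of the arrivals are removed by correctors. The function
`h p x = ∑ₜ (E[f(Xᵗ) | X⁰ = x] - λ p)` solves the Poisson equation `h - P h = f - λ` and is bounded
uniformly in `ε`. The corrected queue lengths `w = q + h(x)` therefore satisfy
`w⁺ = w + λ - s + u + ξ`, where `u` is the unused service and `ξ` is martingale noise that is
uncorrelated between different queues. The modulating chain at `p` has only one invariant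
distribution, and under it the variance of `ξ p` is `γ(0) + 2 ∑ γ(t)` (`sum_stepVar_corrector`).

Steady states exist by Foster's criterion (`exists_invariantLaw_of_drift`): the drift of `∑ w²` is
at most a constant minus a multiple of `ε ∑ q` (`IsCorrector.drift_sq`). Invariant distributions are
limits of time averages along an ultrafilter, and convergence to them (`tendsto_lawAfter`) follows
from the equality case of Jensen's inequality for such limits.

Let `K` be the cone of nonnegative matrices `aᵢ + bⱼ`, and let `y` be the component of `w` in the
polar cone. Because `v + (vmin / ‖y‖) y` is substochastic, MaxWeight gives the increment of `w` a
component of at least about `vmin` against the direction of `y`, while the unused service adds at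
most a constant to `‖y‖²`, the members of `K` being nonnegative. The drift of `‖y‖⁴` then shows that `E[‖y‖²]` is bounded uniformly
in `ε` (`IsCorrector.tsum_coneDistSq_le`).

Finally, let `V(w) = ∑ᵢ Rᵢ² + ∑ⱼ Cⱼ² - T² / N`, where `Rᵢ`, `Cⱼ` and `T` are the row sums, the
column sums and the total of `w`. The row and column sums of `λ - s` all equal `-ε`, so that setting
the stationary drift of `V` to zero gives
`2 ε E[T(w)] = N ε² + (2 - 1/N) ∑ σ² + E[2 N ⟨Π w⁺, u⟩ - V(u)]`, where `Π` is the orthogonal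
projection onto the span of `K` (`IsCorrector.drift_portForm`). Unused service occurs only at
empty queues, so the last term is at most of the order of `E[(1 + ‖y⁺‖) ∑ u]`. It tends to `0`,
since `E[∑ u] = N ε` and `E[‖y‖²]` is bounded.
-/

/-! ### Means of real functions under a discrete distribution -/

/-- The mean `E[F(X)]` for `X ∼ μ`; it takes the junk value `0` when the sum does not converge
absolutely. -/
noncomputable def pmfMean {α : Type*} (μ : PMF α) (F : α → ℝ) : ℝ := ∑' x, (μ x).toReal * F x

section Mean

variable {α β : Type*}

theorem PMF.summable_toReal (μ : PMF α) : Summable fun x => (μ x).toReal :=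
  ENNReal.summable_toReal μ.tsum_coe_ne_top

theorem PMF.tsum_toReal (μ : PMF α) : ∑' x, (μ x).toReal = 1 := by
  rw [← ENNReal.tsum_toReal_eq μ.apply_ne_top, μ.tsum_coe, ENNReal.toReal_one]

theorem PMF.toReal_le_one (μ : PMF α) (x : α) : (μ x).toReal ≤ 1 :=
  ENNReal.toReal_le_of_le_ofReal zero_le_one (by simpa using μ.coe_le_one x)

theorem PMF.toReal_pos {μ : PMF α} {x : α} (h : μ x ≠ 0) : 0 < (μ x).toReal :=
  ENNReal.toReal_pos h (μ.apply_ne_top x)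

theorem PMF.summable_mul_of_bounded (μ : PMF α) {F : α → ℝ} {B : ℝ} (hF : ∀ x, |F x| ≤ B) :
    Summable fun x => (μ x).toReal * F x := by
  refine Summable.of_norm_bounded (μ.summable_toReal.mul_right B) fun x => ?_
  rw [Real.norm_eq_abs, abs_mul, abs_of_nonneg ENNReal.toReal_nonneg]
  exact mul_le_mul_of_nonneg_left (hF x) ENNReal.toReal_nonneg

theorem pmfMean_const (μ : PMF α) (c : ℝ) : pmfMean μ (fun _ => c) = c := by
  rw [pmfMean, tsum_mul_right, μ.tsum_toReal, one_mul]

theorem pmfMean_pure (a : α) (F : α → ℝ) : pmfMean (PMF.pure a) F = F a := by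
  classical
  rw [pmfMean, tsum_eq_single a]
  · simp
  · intro b hb; simp [PMF.pure_apply, hb]

theorem pmfMean_nonneg (μ : PMF α) {F : α → ℝ} (hF : ∀ x, 0 ≤ F x) : 0 ≤ pmfMean μ F :=
  tsum_nonneg fun x => mul_nonneg ENNReal.toReal_nonneg (hF x)

theorem pmfMean_le (μ : PMF α) {F : α → ℝ} {B : ℝ} (hF : ∀ x, |F x| ≤ B) : pmfMean μ F ≤ B := by
  rw [← pmfMean_const μ B]
  refine Summable.tsum_le_tsum (fun x => ?_) (μ.summable_mul_of_bounded hF)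
    (μ.summable_toReal.mul_right B)
  exact mul_le_mul_of_nonneg_left ((le_abs_self _).trans (hF x)) ENNReal.toReal_nonneg

theorem abs_pmfMean_le (μ : PMF α) {F : α → ℝ} {B : ℝ} (hF : ∀ x, |F x| ≤ B) :
    |pmfMean μ F| ≤ B := by
  refine abs_le.2 ⟨?_, pmfMean_le μ hF⟩
  have := pmfMean_le μ (F := fun x => - F x) (B := B) (by simpa using hF)
  simp only [pmfMean, mul_neg, tsum_neg] at this ⊢
  linarith

theorem toReal_bind_apply (μ : PMF α) (κ : α → PMF β) (y : β) :
    ((μ.bind κ) y).toReal = ∑' x, (μ x).toReal * (κ x y).toReal := by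
  rw [PMF.bind_apply, ENNReal.tsum_toReal_eq]
  · simp
  · intro a
    exact ENNReal.mul_ne_top (μ.apply_ne_top a) ((κ a).apply_ne_top y)

theorem PMF.summable_uncurry_bind (μ : PMF α) (κ : α → PMF β) :
    Summable fun p : α × β => (μ p.1).toReal * (κ p.1 p.2).toReal := by
  refine (summable_prod_of_nonneg (f := fun p : α × β => (μ p.1).toReal * (κ p.1 p.2).toReal)
    fun p => mul_nonneg ENNReal.toReal_nonneg ENNReal.toReal_nonneg).2
    ⟨fun x => (κ x).summable_toReal.mul_left (μ x).toReal, ?_⟩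
  simp only [tsum_mul_left, PMF.tsum_toReal, mul_one]
  exact μ.summable_toReal

theorem pmfMean_bind (μ : PMF α) (κ : α → PMF β) {F : β → ℝ} {B : ℝ} (hF : ∀ x, |F x| ≤ B) :
    pmfMean (μ.bind κ) F = pmfMean μ fun x => pmfMean (κ x) F := by
  have hs : Summable (Function.uncurry fun (x : α) (y : β) =>
      (μ x).toReal * ((κ x y).toReal * F y)) := by
    refine Summable.of_norm_bounded ((μ.summable_uncurry_bind κ).mul_right B) fun p => ?_
    rw [Function.uncurry_apply_pair (f := fun x y => (μ x).toReal * ((κ x y).toReal * F y)) p.1 p.2,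
      ← mul_assoc, norm_mul, Real.norm_of_nonneg (by positivity)]
    exact mul_le_mul_of_nonneg_left (hF _) (by positivity)
  simp only [pmfMean, toReal_bind_apply, ← tsum_mul_left, ← tsum_mul_right, mul_assoc]
  exact hs.tsum_comm

theorem tsum_bind_mul (μ : PMF α) (κ : α → PMF β) (F : β → ℝ≥0∞) :
    ∑' y, (μ.bind κ) y * F y = ∑' x, μ x * ∑' y, κ x y * F y := by
  simp only [PMF.bind_apply, ← ENNReal.tsum_mul_left, ← ENNReal.tsum_mul_right, mul_assoc]
  exact ENNReal.tsum_comm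

/-- The variance decomposition `E[F²] = m² + E[(F - m)²]` for `m = E[F]`. -/
theorem pmfMean_sq_eq (μ : PMF α) {F : α → ℝ} {B : ℝ} (hF : ∀ x, |F x| ≤ B) :
    pmfMean μ (fun x => F x ^ 2) =
      pmfMean μ F ^ 2 + pmfMean μ (fun x => (F x - pmfMean μ F) ^ 2) := by
  set m := pmfMean μ F with hm
  have h1 := μ.summable_mul_of_bounded hF
  have h2 : Summable fun x => (μ x).toReal * F x ^ 2 :=
    μ.summable_mul_of_bounded (B := B ^ 2) fun x => by
      rw [abs_pow]; exact pow_le_pow_left₀ (abs_nonneg _) (hF x) 2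
  have h3 : pmfMean μ (fun x => (F x - m) ^ 2) =
      pmfMean μ (fun x => F x ^ 2) - 2 * m * m + m ^ 2 := by
    have e : ∀ x, (μ x).toReal * (F x - m) ^ 2 =
        (μ x).toReal * F x ^ 2 - 2 * m * ((μ x).toReal * F x) + (μ x).toReal * m ^ 2 :=
      fun x => by ring
    rw [pmfMean, tsum_congr e, Summable.tsum_add (h2.sub (h1.mul_left _))
      (μ.summable_toReal.mul_right _), Summable.tsum_sub h2 (h1.mul_left _), tsum_mul_left,
      tsum_mul_right, μ.tsum_toReal, one_mul]
    rfl
  rw [h3]; ring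

end Mean

section MeanLinear

variable {α β : Type*} {μ : PMF α} {F G : α → ℝ}

theorem pmfMean_add (hF : Summable fun z => (μ z).toReal * F z)
    (hG : Summable fun z => (μ z).toReal * G z) :
    pmfMean μ (fun z => F z + G z) = pmfMean μ F + pmfMean μ G := by
  simp only [pmfMean, mul_add]; exact hF.tsum_add hG

theorem pmfMean_const_mul (c : ℝ) : pmfMean μ (fun z => c * F z) = c * pmfMean μ F := by
  simp only [pmfMean, ← tsum_mul_left]
  exact tsum_congr fun z => by ring

theorem pmfMean_finset_sum {ι : Type*} (t : Finset ι) {F : ι → α → ℝ}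
    (hF : ∀ i ∈ t, Summable fun z => (μ z).toReal * F i z) :
    pmfMean μ (fun z => ∑ i ∈ t, F i z) = ∑ i ∈ t, pmfMean μ (F i) := by
  simp only [pmfMean, Finset.mul_sum]
  exact Summable.tsum_finsetSum hF

theorem pmfMean_mono (hF : Summable fun z => (μ z).toReal * F z)
    (hG : Summable fun z => (μ z).toReal * G z) (h : ∀ z, F z ≤ G z) :
    pmfMean μ F ≤ pmfMean μ G :=
  hF.tsum_le_tsum (fun z => mul_le_mul_of_nonneg_left (h z) ENNReal.toReal_nonneg) hG

theorem summable_mul_of_abs_le (hG : Summable fun z => (μ z).toReal * G z)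
    (h : ∀ z, |F z| ≤ G z) : Summable fun z => (μ z).toReal * F z := by
  refine Summable.of_norm_bounded hG fun z => ?_
  rw [norm_mul, Real.norm_of_nonneg ENNReal.toReal_nonneg]
  exact mul_le_mul_of_nonneg_left (h z) ENNReal.toReal_nonneg

theorem abs_pmfMean_le_pmfMean (hG : Summable fun z => (μ z).toReal * G z)
    (h : ∀ z, |F z| ≤ G z) : |pmfMean μ F| ≤ pmfMean μ G := by
  have hF := summable_mul_of_abs_le hG h
  refine abs_le.2 ⟨?_, pmfMean_mono hF hG fun z => (abs_le.1 (h z)).2⟩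
  have h1 := pmfMean_mono (μ := μ) (F := fun z => (-1) * G z) (G := F)
    (by simpa using hG.neg) hF fun z => by linarith [(abs_le.1 (h z)).1]
  rw [pmfMean_const_mul] at h1
  linarith

theorem pmfMean_map (φ : α → β) {F : β → ℝ} {B : ℝ} (hF : ∀ y, |F y| ≤ B) :
    pmfMean (μ.map φ) F = pmfMean μ fun z => F (φ z) := by
  rw [PMF.map, pmfMean_bind μ _ hF]
  exact tsum_congr fun z => congrArg _ (pmfMean_pure (φ z) F)

theorem summable_of_tsum_ofReal_le (hF : ∀ z, 0 ≤ F z) {M : ℝ} (hM : 0 ≤ M)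
    (h : ∑' z, μ z * ENNReal.ofReal (F z) ≤ ENNReal.ofReal M) :
    (Summable fun z => (μ z).toReal * F z) ∧ pmfMean μ F ≤ M := by
  have h1 : ∀ z, (μ z * ENNReal.ofReal (F z)).toReal = (μ z).toReal * F z := fun z => by
    rw [ENNReal.toReal_mul, ENNReal.toReal_ofReal (hF z)]
  have hne : ∑' z, μ z * ENNReal.ofReal (F z) ≠ ⊤ := ne_top_of_le_ne_top ENNReal.ofReal_ne_top h
  refine ⟨?_, ?_⟩
  · have := ENNReal.summable_toReal hne
    simpa only [h1] using this
  · have h2 := ENNReal.toReal_mono ENNReal.ofReal_ne_top h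
    rw [ENNReal.toReal_ofReal hM, ENNReal.tsum_toReal_eq fun z =>
      ENNReal.mul_ne_top (μ.apply_ne_top z) ENNReal.ofReal_ne_top] at h2
    rw [pmfMean]
    simpa only [h1] using h2

end MeanLinear

/-! ### Convergence to an invariant distribution -/

section Convergence

variable {α β : Type*}

theorem lawAfter_add (K : α → PMF α) (μ : PMF α) (m n : ℕ) :
    lawAfter K μ (m + n) = lawAfter K (lawAfter K μ m) n := by
  induction n with
  | zero => rfl
  | succ n ih => rw [← add_assoc]; simp only [lawAfter, ih]

theorem lawAfter_eq_bind (K : α → PMF α) (μ : PMF α) (n : ℕ) :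
    lawAfter K μ n = μ.bind fun x => lawAfter K (PMF.pure x) n := by
  induction n with
  | zero => simp [lawAfter]
  | succ n ih => simp only [lawAfter]; rw [ih, PMF.bind_bind]

theorem lawAfter_pure_add (K : α → PMF α) (x : α) (m n : ℕ) :
    lawAfter K (PMF.pure x) (m + n) =
      (lawAfter K (PMF.pure x) m).bind fun y => lawAfter K (PMF.pure y) n := by
  rw [lawAfter_add, lawAfter_eq_bind]

theorem lawAfter_pure_one (K : α → PMF α) (x : α) : lawAfter K (PMF.pure x) 1 = K x := by
  simp [lawAfter]

theorem lawAfter_pure_succ (K : α → PMF α) (x : α) (n : ℕ) :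
    lawAfter K (PMF.pure x) (n + 1) = (K x).bind fun y => lawAfter K (PMF.pure y) n := by
  rw [add_comm, lawAfter_pure_add, lawAfter_pure_one]

theorem lawAfter_pure_add_ne_zero {K : α → PMF α} {x y z : α} {m n : ℕ}
    (h1 : lawAfter K (PMF.pure x) m y ≠ 0) (h2 : lawAfter K (PMF.pure y) n z ≠ 0) :
    lawAfter K (PMF.pure x) (m + n) z ≠ 0 := by
  rw [lawAfter_pure_add, ← PMF.mem_support_iff, PMF.mem_support_bind_iff]
  exact ⟨y, h1, h2⟩

theorem IsInvariantLaw.lawAfter_eq {K : α → PMF α} {π : PMF α} (h : IsInvariantLaw K π) (n : ℕ) :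
    lawAfter K π n = π := by
  induction n with
  | zero => rfl
  | succ n ih => simp only [lawAfter]; rw [ih]; exact h

/-- A set that the chain does not leave in one step is never left. -/
theorem mem_of_lawAfter_ne_zero {K : α → PMF α} {S : Set α}
    (hS : ∀ a ∈ S, ∀ b, K a b ≠ 0 → b ∈ S) {a : α} (ha : a ∈ S) :
    ∀ (n : ℕ) {b : α}, lawAfter K (PMF.pure a) n b ≠ 0 → b ∈ S := by
  intro n
  induction n with
  | zero =>
    intro b hb
    have : b ∈ (PMF.pure a).support := hb
    rw [PMF.support_pure, Set.mem_singleton_iff] at this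
    exact this ▸ ha
  | succ n ih =>
    intro b hb
    have : b ∈ ((lawAfter K (PMF.pure a) n).bind K).support := hb
    rw [PMF.mem_support_bind_iff] at this
    obtain ⟨c, hc, hcb⟩ := this
    exact hS c (ih hc) b hcb

/-- The return times to a state form an additive monoid, so that aperiodicity makes every large
time a return time. -/
theorem AperiodicOn.eventually_return {K : α → PMF α} {S : Set α} (h : AperiodicOn K S)
    {a : α} (ha : a ∈ S) : ∃ n₀, ∀ n ≥ n₀, lawAfter K (PMF.pure a) n a ≠ 0 := by
  set s : Set ℕ := {n | lawAfter K (PMF.pure a) n a ≠ 0} with hs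
  have hcl : ∀ n ∈ AddSubmonoid.closure s, lawAfter K (PMF.pure a) n a ≠ 0 := by
    intro n hn
    induction hn using AddSubmonoid.closure_induction with
    | mem x hx => exact hx
    | zero => simp [lawAfter]
    | add x y _ _ hx hy => exact lawAfter_pure_add_ne_zero hx hy
  have hgcd : Nat.setGcd s = 1 :=
    h a ha _ fun n _ hn => Nat.setGcd_dvd_of_mem (show n ∈ s from hn)
  obtain ⟨n₀, hn₀⟩ := Nat.exists_mem_closure_of_ge s
  exact ⟨n₀, fun n hn => hcl n (hn₀ n hn (by rw [hgcd]; exact one_dvd n))⟩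

/-- Any two states of an irreducible aperiodic chain are reached at a common time. -/
theorem exists_common_time {K : α → PMF α} {S : Set α} (hirr : IrreducibleOn K S)
    (hap : AperiodicOn K S) {y z : α} (hy : y ∈ S) (hz : z ∈ S) :
    ∃ m, lawAfter K (PMF.pure y) m y ≠ 0 ∧ lawAfter K (PMF.pure y) m z ≠ 0 := by
  obtain ⟨n₀, hn₀⟩ := hap.eventually_return hy
  obtain ⟨k, hk⟩ := hirr.2.2 y hy z hz
  exact ⟨n₀ + k, hn₀ _ (Nat.le_add_right _ _), lawAfter_pure_add_ne_zero (hn₀ _ le_rfl) hk⟩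

theorem invariantLaw_pos {K : α → PMF α} {S : Set α} (hirr : IrreducibleOn K S) {π : PMF α}
    (hπ : IsInvariantLaw K π) (hsupp : π.support ⊆ S) {y : α} (hy : y ∈ S) : π y ≠ 0 := by
  obtain ⟨x, hx⟩ := π.support_nonempty
  obtain ⟨n, hn⟩ := hirr.2.2 x (hsupp hx) y hy
  rw [← hπ.lawAfter_eq n, lawAfter_eq_bind, ← PMF.mem_support_iff, PMF.mem_support_bind_iff]
  exact ⟨x, hx, hn⟩

/-- An irreducible aperiodic chain with an invariant distribution converges to it.

Let `g n x` be the probability of being in `b` at time `n`, started from `x`. The second moments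
`∑ π(x) g n x ^ 2` decrease to a limit, so along an ultrafilter the shifted limits
`G m = lim g (n + m)` all have the same second moment, although `G m = Kᵐ G 0`. By the equality case
of Jensen's inequality `G 0` is constant on the states that are reached in `m` steps from one state,
hence constant on `S`. -/
theorem tendsto_lawAfter {K : α → PMF α} {S : Set α} (hirr : IrreducibleOn K S)
    (hap : AperiodicOn K S) {π : PMF α} (hπ : IsInvariantLaw K π) (hsupp : π.support ⊆ S)
    {a : α} (ha : a ∈ S) (b : α) :
    Tendsto (fun n => lawAfter K (PMF.pure a) n b) atTop (𝓝 (π b)) := by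
  classical
  set g : ℕ → α → ℝ := fun n x => (lawAfter K (PMF.pure x) n b).toReal with hg
  have hg0 : ∀ n x, 0 ≤ g n x := fun n x => ENNReal.toReal_nonneg
  have hg1 : ∀ n x, g n x ≤ 1 := fun n x => PMF.toReal_le_one _ _
  have habs : ∀ n x, |g n x| ≤ 1 := fun n x => by rw [abs_of_nonneg (hg0 n x)]; exact hg1 n x
  suffices h : Tendsto (fun n => g n a) atTop (𝓝 (π b).toReal) by
    rwa [ENNReal.tendsto_toReal_iff (fun n => PMF.apply_ne_top _ _) (PMF.apply_ne_top _ _)] at h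
  have hstep : ∀ m n x, g (m + n) x = pmfMean (lawAfter K (PMF.pure x) m) (g n) := by
    intro m n x
    simp only [hg, lawAfter_pure_add, toReal_bind_apply, pmfMean]
  have hπmean : ∀ n, pmfMean π (g n) = (π b).toReal := by
    intro n
    simp only [hg, pmfMean]
    rw [← toReal_bind_apply, ← lawAfter_eq_bind, hπ.lawAfter_eq]
  have hinv : ∀ (m : ℕ) {F : α → ℝ} {B : ℝ}, (∀ x, |F x| ≤ B) →
      pmfMean π (fun x => pmfMean (lawAfter K (PMF.pure x) m) F) = pmfMean π F := by
    intro m F B hF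
    rw [← pmfMean_bind π _ hF, ← lawAfter_eq_bind, hπ.lawAfter_eq]
  have hsqb : ∀ {F : α → ℝ}, (∀ x, |F x| ≤ 1) → ∀ x, |F x ^ 2| ≤ 1 := by
    intro F hF x
    rw [abs_pow]; exact pow_le_one₀ (abs_nonneg _) (hF x)
  -- the loss of second moment in `m` steps is the mean conditional variance
  have hloss : ∀ (m : ℕ) {F : α → ℝ}, (∀ x, |F x| ≤ 1) →
      pmfMean π (fun x => F x ^ 2) =
        pmfMean π (fun x => pmfMean (lawAfter K (PMF.pure x) m) F ^ 2) +
        pmfMean π (fun x => pmfMean (lawAfter K (PMF.pure x) m)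
          (fun y => (F y - pmfMean (lawAfter K (PMF.pure x) m) F) ^ 2)) := by
    intro m F hF
    rw [← hinv m (hsqb hF)]
    have hm1 : ∀ x, |pmfMean (lawAfter K (PMF.pure x) m) F| ≤ 1 := fun x => abs_pmfMean_le _ hF
    have hv : ∀ x, |pmfMean (lawAfter K (PMF.pure x) m)
        (fun y => (F y - pmfMean (lawAfter K (PMF.pure x) m) F) ^ 2)| ≤ 4 := by
      intro x
      refine abs_pmfMean_le _ fun y => ?_
      rw [abs_pow]
      have := (abs_sub (F y) (pmfMean (lawAfter K (PMF.pure x) m) F)).trans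
        (add_le_add (hF y) (hm1 x))
      nlinarith [abs_nonneg (F y - pmfMean (lawAfter K (PMF.pure x) m) F)]
    rw [pmfMean, pmfMean, pmfMean, ← Summable.tsum_add
      (π.summable_mul_of_bounded (hsqb hm1)) (π.summable_mul_of_bounded hv)]
    refine tsum_congr fun x => ?_
    rw [pmfMean_sq_eq _ hF, mul_add]
  set c : ℕ → ℝ := fun n => pmfMean π fun x => g n x ^ 2 with hc
  have hanti : Antitone c := by
    refine antitone_nat_of_succ_le fun n => ?_
    have h1 := hloss 1 (habs n)
    have h2 : (fun x => pmfMean (lawAfter K (PMF.pure x) 1) (g n) ^ 2) =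
        fun x => g (n + 1) x ^ 2 := by
      funext x; rw [add_comm n 1, hstep]
    rw [h2] at h1
    have h3 := pmfMean_nonneg π (fun x => pmfMean_nonneg (lawAfter K (PMF.pure x) 1)
      (fun y => sq_nonneg (g n y - pmfMean (lawAfter K (PMF.pure x) 1) (g n))))
    simp only [hc]
    linarith
  have hclim : Tendsto c atTop (𝓝 (⨅ n, c n)) :=
    tendsto_atTop_ciInf hanti ⟨0, by
      rintro _ ⟨n, rfl⟩
      exact pmfMean_nonneg π fun x => sq_nonneg _⟩
  rw [tendsto_iff_ultrafilter]
  intro U hU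
  have hex : ∀ m x, ∃ l : ℝ, Tendsto (fun n => g (m + n) x) U (𝓝 l) := by
    intro m x
    obtain ⟨l, -, hl⟩ := (isCompact_Icc (a := (0 : ℝ)) (b := 1)).ultrafilter_le_nhds
      (U.map fun n => g (m + n) x) (by
        rw [Ultrafilter.coe_map, le_principal_iff, mem_map]
        exact univ_mem' fun n => ⟨hg0 _ _, hg1 _ _⟩)
    exact ⟨l, hl⟩
  choose G hG using hex
  have hGabs : ∀ m x, |G m x| ≤ 1 := fun m x =>
    le_of_tendsto (hG m x).abs (Eventually.of_forall fun n => habs _ _)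
  have hdom : ∀ (μ : PMF α) (F : ℕ → α → ℝ) (F' : α → ℝ), (∀ n x, |F n x| ≤ 1) →
      (∀ x, Tendsto (fun n => F n x) U (𝓝 (F' x))) →
      Tendsto (fun n => pmfMean μ (F n)) U (𝓝 (pmfMean μ F')) := by
    intro μ F F' hF hlim
    refine tendsto_tsum_of_dominated_convergence μ.summable_toReal
      (fun x => (hlim x).const_mul _) (Eventually.of_forall fun n x => ?_)
    rw [norm_mul, Real.norm_of_nonneg ENNReal.toReal_nonneg]
    exact mul_le_of_le_one_right ENNReal.toReal_nonneg (hF n x)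
  have hGstep : ∀ m x, G m x = pmfMean (lawAfter K (PMF.pure x) m) (G 0) := by
    intro m x
    refine tendsto_nhds_unique (hG m x) ?_
    simp only [hstep]
    refine hdom _ (fun n => g n) _ habs fun y => ?_
    simpa using hG 0 y
  have hGsq : ∀ m, pmfMean π (fun x => G m x ^ 2) = ⨅ n, c n := by
    intro m
    refine tendsto_nhds_unique (hdom π (fun n x => g (m + n) x ^ 2) _
      (fun n => hsqb (habs _)) fun x => (hG m x).pow 2) ?_
    have : Tendsto (fun n => c (m + n)) atTop (𝓝 (⨅ n, c n)) := by
      simpa [add_comm] using (tendsto_add_atTop_iff_nat m).2 hclim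
    exact this.mono_left hU
  have hconst : ∀ m, ∀ x ∈ S, ∀ y, lawAfter K (PMF.pure x) m y ≠ 0 → G 0 y = G m x := by
    intro m x hx y hy
    have h1 := hloss m (hGabs 0)
    simp only [← hGstep] at h1
    rw [hGsq, hGsq] at h1
    have hVb : ∀ x z, |(G 0 z - G m x) ^ 2| ≤ 4 := by
      intro x z
      rw [abs_pow]
      have := (abs_sub (G 0 z) (G m x)).trans (add_le_add (hGabs 0 z) (hGabs m x))
      nlinarith [abs_nonneg (G 0 z - G m x)]
    have hV0 : ∀ x, 0 ≤ pmfMean (lawAfter K (PMF.pure x) m) fun z => (G 0 z - G m x) ^ 2 :=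
      fun x => pmfMean_nonneg _ fun z => sq_nonneg _
    have hsum := π.summable_mul_of_bounded fun x =>
      abs_pmfMean_le (lawAfter K (PMF.pure x) m) (hVb x)
    have h2 : HasSum (fun x => (π x).toReal *
        pmfMean (lawAfter K (PMF.pure x) m) fun z => (G 0 z - G m x) ^ 2) 0 := by
      rw [hsum.hasSum_iff]
      simp only [pmfMean] at h1 ⊢
      linarith
    rw [hasSum_zero_iff_of_nonneg fun x => mul_nonneg ENNReal.toReal_nonneg (hV0 x)] at h2
    have h3 := congrFun h2 x
    have h4 : pmfMean (lawAfter K (PMF.pure x) m) (fun z => (G 0 z - G m x) ^ 2) = 0 := by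
      refine (mul_eq_zero.1 h3).resolve_left ?_
      exact (PMF.toReal_pos (invariantLaw_pos hirr hπ hsupp hx)).ne'
    have hsum' := (lawAfter K (PMF.pure x) m).summable_mul_of_bounded (hVb x)
    have h5 : HasSum (fun z => (lawAfter K (PMF.pure x) m z).toReal * (G 0 z - G m x) ^ 2) 0 := by
      rw [hsum'.hasSum_iff]; exact h4
    rw [hasSum_zero_iff_of_nonneg fun z => mul_nonneg ENNReal.toReal_nonneg (sq_nonneg _)] at h5
    have h6 := (mul_eq_zero.1 (congrFun h5 y)).resolve_left (PMF.toReal_pos hy).ne'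
    linarith [pow_eq_zero_iff (two_ne_zero) |>.1 h6]
  have hS : ∀ y ∈ S, G 0 y = G 0 a := by
    intro y hy
    obtain ⟨m, hm1, hm2⟩ := exists_common_time hirr hap ha hy
    rw [hconst m a ha y hm2, hconst m a ha a hm1]
  have hval : G 0 a = (π b).toReal := by
    have h1 : Tendsto (fun n => pmfMean π (g n)) U (𝓝 (pmfMean π (G 0))) :=
      hdom π _ _ habs fun x => by simpa using hG 0 x
    simp only [hπmean] at h1
    rw [tendsto_nhds_unique tendsto_const_nhds h1, ← pmfMean_const π (G 0 a)]
    refine tsum_congr fun x => ?_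
    by_cases hx : π x = 0
    · simp [hx]
    · rw [hS x (hsupp hx)]
  rw [← hval]
  simpa using hG 0 a

theorem invariantLaw_unique {K : α → PMF α} {S : Set α} (hirr : IrreducibleOn K S)
    (hap : AperiodicOn K S) {μ ν : PMF α} (hμ : IsInvariantLaw K μ) (hν : IsInvariantLaw K ν)
    (hμS : μ.support ⊆ S) (hνS : ν.support ⊆ S) : μ = ν := by
  obtain ⟨a, ha⟩ := hirr.1
  exact PMF.ext fun b => tendsto_nhds_unique (tendsto_lawAfter hirr hap hμ hμS ha b)
    (tendsto_lawAfter hirr hap hν hνS ha b)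

end Convergence

/-! ### Drift conditions -/

section Drift

variable {α : Type*}

/-- Summing a drift condition `K V + g ≤ V + b` along the trajectory of the chain. -/
theorem lawAfter_drift {K : α → PMF α} {V g : α → ℝ≥0∞} {b : ℝ≥0∞}
    (h : ∀ z, ∑' y, K z y * V y + g z ≤ V z + b) (a : α) (n : ℕ) :
    ∑' y, lawAfter K (PMF.pure a) n y * V y +
      ∑ k ∈ Finset.range n, ∑' y, lawAfter K (PMF.pure a) k y * g y ≤ V a + n * b := by
  classical
  induction n with
  | zero =>
    simp only [lawAfter, PMF.pure_apply, ite_mul, one_mul, zero_mul, tsum_ite_eq]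
    simp
  | succ n ih =>
    rw [Finset.sum_range_succ]
    simp only [lawAfter]
    rw [tsum_bind_mul]
    set p := lawAfter K (PMF.pure a) n
    have h1 : ∑' x, p x * ∑' y, K x y * V y + ∑' x, p x * g x ≤ ∑' x, p x * V x + b := by
      rw [← ENNReal.tsum_add]
      have : ∑' x, p x * V x + b = ∑' x, (p x * V x + p x * b) := by
        rw [ENNReal.tsum_add, ENNReal.tsum_mul_right, p.tsum_coe, one_mul]
      rw [this]
      refine ENNReal.tsum_le_tsum fun x => ?_
      rw [← mul_add, ← mul_add]
      exact mul_le_mul_right (h x) _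
    calc _ = (∑' x, p x * ∑' y, K x y * V y + ∑' x, p x * g x) +
          ∑ k ∈ Finset.range n, ∑' y, lawAfter K (PMF.pure a) k y * g y := by ring
      _ ≤ (∑' x, p x * V x + b) +
          ∑ k ∈ Finset.range n, ∑' y, lawAfter K (PMF.pure a) k y * g y := by gcongr
      _ = (∑' x, p x * V x +
          ∑ k ∈ Finset.range n, ∑' y, lawAfter K (PMF.pure a) k y * g y) + b := by ring
      _ ≤ (V a + n * b) + b := by gcongr
      _ = V a + (n + 1 : ℕ) * b := by push_cast; ring

/-- A drift condition bounds the mean of `g` under the limiting distribution; the mean of `V` may be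
infinite. -/
theorem tsum_mul_le_of_drift {K : α → PMF α} {V g : α → ℝ≥0∞} {b : ℝ≥0∞}
    (h : ∀ z, ∑' y, K z y * V y + g z ≤ V z + b) (hb : b ≠ ⊤) (hg : ∀ z, g z ≠ ⊤) {a : α}
    (hV : V a ≠ ⊤) {π : PMF α}
    (hlim : ∀ y, Tendsto (fun n => lawAfter K (PMF.pure a) n y) atTop (𝓝 (π y))) :
    ∑' z, π z * g z ≤ b := by
  rw [ENNReal.tsum_eq_iSup_sum]
  refine iSup_le fun T => ?_
  have hfin : ∀ (p : PMF α), ∑ y ∈ T, p y * g y ≠ ⊤ := fun p =>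
    ENNReal.sum_ne_top.2 fun y _ => ENNReal.mul_ne_top (p.apply_ne_top y) (hg y)
  set u : ℕ → ℝ := fun n => (∑ y ∈ T, lawAfter K (PMF.pure a) n y * g y).toReal with hu
  have h1 : Tendsto u atTop (𝓝 (∑ y ∈ T, π y * g y).toReal) := by
    refine (ENNReal.tendsto_toReal (hfin π)).comp ?_
    exact tendsto_finsetSum _ fun y _ => ENNReal.Tendsto.mul_const (hlim y) (Or.inr (hg y))
  have h2 : ∀ n : ℕ, ∑ k ∈ Finset.range n, u k ≤ (V a).toReal + n * b.toReal := by
    intro n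
    have h3 : ∑ k ∈ Finset.range n, ∑ y ∈ T, lawAfter K (PMF.pure a) k y * g y ≤ V a + n * b := by
      refine le_trans ?_ (lawAfter_drift h a n)
      refine le_trans ?_ le_add_self
      exact Finset.sum_le_sum fun k _ => ENNReal.sum_le_tsum T
    have h4 : V a + n * b ≠ ⊤ := by finiteness
    have h5 := ENNReal.toReal_mono h4 h3
    rw [ENNReal.toReal_sum fun k _ => hfin _, ENNReal.toReal_add hV (by finiteness),
      ENNReal.toReal_mul, ENNReal.toReal_natCast] at h5
    exact h5
  have h3 := h1.cesaro
  have h4 : Tendsto (fun n : ℕ => (n : ℝ)⁻¹ * (V a).toReal + b.toReal) atTop (𝓝 b.toReal) := by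
    simpa using (tendsto_inv_atTop_nhds_zero_nat (𝕜 := ℝ)).mul_const ((V a).toReal) |>.add_const
      b.toReal
  have h5 : (∑ y ∈ T, π y * g y).toReal ≤ b.toReal := by
    refine le_of_tendsto_of_tendsto h3 h4 ?_
    filter_upwards [eventually_gt_atTop 0] with n hn
    have hn' : (0 : ℝ) < n := by exact_mod_cast hn
    calc (n : ℝ)⁻¹ * ∑ k ∈ Finset.range n, u k ≤ (n : ℝ)⁻¹ * ((V a).toReal + n * b.toReal) :=
          mul_le_mul_of_nonneg_left (h2 n) (by positivity)
      _ = (n : ℝ)⁻¹ * (V a).toReal + b.toReal := by field_simp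
  exact (ENNReal.toReal_le_toReal (hfin π) hb).1 h5

theorem PMF.eq_of_toReal_le {μ ν : PMF α} (h : ∀ x, (μ x).toReal ≤ (ν x).toReal) : μ = ν := by
  have hs : HasSum (fun x => (ν x).toReal - (μ x).toReal) 0 := by
    rw [(ν.summable_toReal.sub μ.summable_toReal).hasSum_iff,
      ν.summable_toReal.tsum_sub μ.summable_toReal, ν.tsum_toReal, μ.tsum_toReal, sub_self]
  rw [hasSum_zero_iff_of_nonneg fun x => sub_nonneg.2 (h x)] at hs
  refine PMF.ext fun x => (ENNReal.toReal_eq_toReal_iff' (μ.apply_ne_top x) (ν.apply_ne_top x)).1 ?_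
  have : (ν x).toReal - (μ x).toReal = 0 := congrFun hs x
  linarith

/-- Foster's criterion. A drift condition `K V + W ≤ V + b`, with `W` of finite sublevel sets, makes
the time averages of the chain tight, and each of their limit points along an ultrafilter is an
invariant distribution. -/
theorem exists_invariantLaw_of_drift {K : α → PMF α} {S : Set α}
    (hS : ∀ a ∈ S, ∀ b, K a b ≠ 0 → b ∈ S) {a : α} (ha : a ∈ S) {V : α → ℝ≥0∞} {W : α → ℕ}
    {b : ℝ≥0∞} (h : ∀ z, ∑' y, K z y * V y + (W z : ℝ≥0∞) ≤ V z + b) (hb : b ≠ ⊤)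
    (hV : V a ≠ ⊤) (hW : ∀ M : ℕ, {z | W z ≤ M}.Finite) :
    ∃ π : PMF α, π.support ⊆ S ∧ IsInvariantLaw K π := by
  classical
  set p : ℕ → PMF α := fun n => lawAfter K (PMF.pure a) n with hp
  set μ : ℕ → α → ℝ := fun n y => ((n : ℝ) + 1)⁻¹ * ∑ k ∈ Finset.range (n + 1), (p k y).toReal
    with hμ
  have hμ0 : ∀ n y, 0 ≤ μ n y := fun n y => by positivity
  have hsumT : ∀ n (T : Finset α), ∑ y ∈ T, μ n y ≤ 1 := by
    intro n T
    simp only [hμ]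
    rw [← Finset.mul_sum, Finset.sum_comm]
    have h1 : ∑ k ∈ Finset.range (n + 1), ∑ y ∈ T, (p k y).toReal ≤ (n : ℝ) + 1 := by
      calc _ ≤ ∑ k ∈ Finset.range (n + 1), (1 : ℝ) := Finset.sum_le_sum fun k _ => by
            rw [← (p k).tsum_toReal]
            exact (p k).summable_toReal.sum_le_tsum T fun _ _ => ENNReal.toReal_nonneg
        _ = (n : ℝ) + 1 := by simp
    rw [inv_mul_le_iff₀ (by positivity), mul_one]
    exact h1
  have hμ1 : ∀ n y, μ n y ≤ 1 := fun n y => by simpa using hsumT n {y}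
  set U : Ultrafilter ℕ := hyperfilter ℕ
  have hU : (U : Filter ℕ) ≤ atTop := Nat.hyperfilter_le_atTop
  have hex : ∀ y, ∃ l : ℝ, Tendsto (fun n => μ n y) U (𝓝 l) := by
    intro y
    obtain ⟨l, -, hl⟩ := (isCompact_Icc (a := (0 : ℝ)) (b := 1)).ultrafilter_le_nhds
      (U.map fun n => μ n y) (by
        rw [Ultrafilter.coe_map, le_principal_iff, mem_map]
        exact univ_mem' fun n => ⟨hμ0 _ _, hμ1 _ _⟩)
    exact ⟨l, hl⟩
  choose L hL using hex
  have hL0 : ∀ y, 0 ≤ L y := fun y => ge_of_tendsto' (hL y) fun n => hμ0 n y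
  have hLT : ∀ T : Finset α, Tendsto (fun n => ∑ y ∈ T, μ n y) U (𝓝 (∑ y ∈ T, L y)) :=
    fun T => tendsto_finsetSum _ fun y _ => hL y
  have hLle : ∀ T : Finset α, ∑ y ∈ T, L y ≤ 1 := fun T => le_of_tendsto' (hLT T) fun n => hsumT n T
  have hLs : Summable L := summable_of_sum_le hL0 hLle
  -- tightness: the mass of the time averages outside a sublevel set of `W` is small
  have htight : ∀ M : ℕ, 0 < M → 1 - ((V a).toReal + b.toReal) / M ≤ ∑' y, L y := by
    intro M hM
    have hM' : (0 : ℝ) < M := by exact_mod_cast hM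
    set T := (hW M).toFinset with hT
    have hmark : ∀ k, (M : ℝ≥0∞) ≤ M * ∑ y ∈ T, p k y + ∑' y, p k y * (W y : ℝ≥0∞) := by
      intro k
      calc (M : ℝ≥0∞) = ∑' y, p k y * M := by rw [ENNReal.tsum_mul_right, (p k).tsum_coe, one_mul]
        _ ≤ ∑' y, ((if y ∈ T then M * p k y else 0) + p k y * (W y : ℝ≥0∞)) := by
            refine ENNReal.tsum_le_tsum fun y => ?_
            by_cases hy : y ∈ T
            · rw [if_pos hy, mul_comm]; exact le_self_add
            · rw [if_neg hy, zero_add]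
              have : M ≤ W y := by
                by_contra hcon
                exact hy (by simpa [hT] using (not_le.1 hcon).le)
              gcongr
        _ = _ := by
            rw [ENNReal.tsum_add, tsum_eq_sum (s := T) fun y hy => if_neg hy,
              Finset.sum_congr rfl fun y hy => if_pos hy, Finset.mul_sum]
    have hn : ∀ n, 1 - ((V a).toReal + b.toReal) / M ≤ ∑ y ∈ T, μ n y := by
      intro n
      have h1 : ((n + 1 : ℕ) : ℝ≥0∞) * M ≤
          M * ∑ k ∈ Finset.range (n + 1), ∑ y ∈ T, p k y + (V a + (n + 1 : ℕ) * b) := by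
        calc ((n + 1 : ℕ) : ℝ≥0∞) * M = ∑ k ∈ Finset.range (n + 1), (M : ℝ≥0∞) := by simp
          _ ≤ ∑ k ∈ Finset.range (n + 1),
              (M * ∑ y ∈ T, p k y + ∑' y, p k y * (W y : ℝ≥0∞)) :=
            Finset.sum_le_sum fun k _ => hmark k
          _ ≤ _ := by
            rw [Finset.sum_add_distrib, ← Finset.mul_sum]
            gcongr
            exact le_add_self.trans (lawAfter_drift h a (n + 1))
      have hfin : ∀ k ∈ Finset.range (n + 1), ∑ y ∈ T, p k y ≠ ⊤ := fun k _ =>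
        ENNReal.sum_ne_top.2 fun y _ => (p k).apply_ne_top y
      have hfin' : (M : ℝ≥0∞) * ∑ k ∈ Finset.range (n + 1), ∑ y ∈ T, p k y ≠ ⊤ :=
        ENNReal.mul_ne_top (by finiteness) (ENNReal.sum_ne_top.2 hfin)
      have hfin'' : V a + (n + 1 : ℕ) * b ≠ ⊤ := by finiteness
      have h2 := ENNReal.toReal_mono (ENNReal.add_ne_top.2 ⟨hfin', hfin''⟩) h1
      rw [ENNReal.toReal_add hfin' hfin'', ENNReal.toReal_add hV (by finiteness),
        ENNReal.toReal_mul, ENNReal.toReal_mul, ENNReal.toReal_mul, ENNReal.toReal_sum hfin,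
        Finset.sum_congr rfl fun k _ => ENNReal.toReal_sum fun y _ => (p k).apply_ne_top y,
        ENNReal.toReal_natCast, ENNReal.toReal_natCast, Finset.sum_comm] at h2
      push_cast at h2
      simp only [hμ]
      rw [← Finset.mul_sum]
      set A := ∑ y ∈ T, ∑ k ∈ Finset.range (n + 1), (p k y).toReal
      have hn1 : (0 : ℝ) < n + 1 := by positivity
      have hVa : 0 ≤ (V a).toReal := ENNReal.toReal_nonneg
      have h3 : (V a).toReal ≤ (n + 1) * (V a).toReal := by
        nlinarith [(Nat.cast_nonneg n : (0 : ℝ) ≤ n)]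
      rw [← div_eq_inv_mul, le_div_iff₀ hn1, ← sub_nonneg]
      have h4 : 0 ≤ M * (A - (1 - ((V a).toReal + b.toReal) / M) * (n + 1)) := by
        have : M * (A - (1 - ((V a).toReal + b.toReal) / M) * (n + 1)) =
            M * A - M * (n + 1) + ((V a).toReal + b.toReal) * (n + 1) := by
          field_simp
          ring
        rw [this]; nlinarith
      exact nonneg_of_mul_nonneg_right h4 hM'
    exact (ge_of_tendsto' (hLT T) hn).trans (hLs.sum_le_tsum T fun y _ => hL0 y)
  have hL1 : ∑' y, L y = 1 := by
    refine le_antisymm (hLs.tsum_le_of_sum_le hLle) ?_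
    have h1 : Tendsto (fun M : ℕ => 1 - ((V a).toReal + b.toReal) / (M : ℝ)) atTop (𝓝 (1 - 0)) :=
      tendsto_const_nhds.sub (tendsto_const_div_atTop_nhds_zero_nat _)
    rw [sub_zero] at h1
    refine le_of_tendsto h1 ?_
    filter_upwards [eventually_gt_atTop 0] with M hM using htight M hM
  have hsum : HasSum (fun y => ENNReal.ofReal (L y)) 1 := by
    rw [ENNReal.summable.hasSum_iff, ← ENNReal.ofReal_tsum_of_nonneg hL0 hLs, hL1,
      ENNReal.ofReal_one]
  set π : PMF α := ⟨fun y => ENNReal.ofReal (L y), hsum⟩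
  have hπ : ∀ y, (π y).toReal = L y := fun y => ENNReal.toReal_ofReal (hL0 y)
  refine ⟨π, fun y hy => ?_, PMF.eq_of_toReal_le fun y => ?_⟩
  · by_contra hyS
    refine hy ?_
    have h1 : ∀ n, μ n y = 0 := fun n => by
      simp only [hμ]
      rw [Finset.sum_eq_zero, mul_zero]
      intro k _
      by_contra hne
      exact hyS (mem_of_lawAfter_ne_zero hS ha k fun h0 => hne (by simp [hp, h0]))
    have h2 := hL y
    simp only [h1] at h2
    show ENNReal.ofReal (L y) = 0
    rw [← tendsto_nhds_unique tendsto_const_nhds h2, ENNReal.ofReal_zero]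
  · rw [toReal_bind_apply]
    simp only [hπ]
    refine Real.tsum_le_of_sum_le (fun x => mul_nonneg (hL0 x) ENNReal.toReal_nonneg) fun T => ?_
    have h1 : Tendsto (fun n => ∑ x ∈ T, μ n x * (K x y).toReal) U
        (𝓝 (∑ x ∈ T, L x * (K x y).toReal)) :=
      tendsto_finsetSum _ fun x _ => (hL x).mul_const _
    have h2 : Tendsto (fun n : ℕ => μ n y + ((n : ℝ) + 1)⁻¹) U (𝓝 (L y)) := by
      have : Tendsto (fun n : ℕ => ((n : ℝ) + 1)⁻¹) U (𝓝 0) := by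
        simpa using (tendsto_one_div_add_atTop_nhds_zero_nat (𝕜 := ℝ)).mono_left hU
      simpa using (hL y).add this
    refine le_of_tendsto_of_tendsto' h1 h2 fun n => ?_
    have h3 : ∀ k, ∑ x ∈ T, (p k x).toReal * (K x y).toReal ≤ (p (k + 1) y).toReal := by
      intro k
      have : p (k + 1) = (p k).bind K := rfl
      rw [this, toReal_bind_apply]
      exact ((p k).summable_mul_of_bounded fun x => by
        rw [abs_of_nonneg ENNReal.toReal_nonneg]; exact PMF.toReal_le_one _ _).sum_le_tsum T
          fun x _ => mul_nonneg ENNReal.toReal_nonneg ENNReal.toReal_nonneg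
    calc ∑ x ∈ T, μ n x * (K x y).toReal
        = ((n : ℝ) + 1)⁻¹ * ∑ k ∈ Finset.range (n + 1), ∑ x ∈ T,
            (p k x).toReal * (K x y).toReal := by
          simp only [hμ, mul_assoc, Finset.sum_mul]
          rw [← Finset.mul_sum, Finset.sum_comm]
      _ ≤ ((n : ℝ) + 1)⁻¹ * ∑ k ∈ Finset.range (n + 1), (p (k + 1) y).toReal := by
          gcongr with k _; exact h3 k
      _ ≤ ((n : ℝ) + 1)⁻¹ * (∑ k ∈ Finset.range (n + 1), (p k y).toReal + 1) := by
          have h4 := Finset.sum_range_succ (fun k => (p k y).toReal) (n + 1)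
          rw [Finset.sum_range_succ'] at h4
          have h5 := PMF.toReal_le_one (p (n + 1)) y
          have h6 : 0 ≤ (p 0 y).toReal := ENNReal.toReal_nonneg
          gcongr
          linarith
      _ = μ n y + ((n : ℝ) + 1)⁻¹ := by simp only [hμ]; ring

/-- Under a drift condition, an irreducible aperiodic chain has a steady state. -/
theorem exists_steadyState_of_drift {K : α → PMF α} {S : Set α} (hirr : IrreducibleOn K S)
    (hap : AperiodicOn K S) {V : α → ℝ≥0∞} {W : α → ℕ}
    {b : ℝ≥0∞} (h : ∀ z, ∑' y, K z y * V y + (W z : ℝ≥0∞) ≤ V z + b) (hb : b ≠ ⊤)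
    (hV : ∀ a, V a ≠ ⊤) (hW : ∀ M : ℕ, {z | W z ≤ M}.Finite) :
    ∃ π : PMF α, IsSteadyState K S π := by
  obtain ⟨a, ha⟩ := hirr.1
  obtain ⟨π, h1, h2⟩ := exists_invariantLaw_of_drift hirr.2.1 ha h hb (hV a) hW
  exact ⟨π, h1, h2, fun a ha b => tendsto_lawAfter hirr hap h2 h1 ha b⟩

theorem abs_pmfMean_le_of_support (μ : PMF α) {F : α → ℝ} {B : ℝ}
    (hF : ∀ x, μ x ≠ 0 → |F x| ≤ B) : |pmfMean μ F| ≤ B := by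
  classical
  obtain ⟨x₀, hx₀⟩ := μ.support_nonempty
  have hB : 0 ≤ B := (abs_nonneg _).trans (hF x₀ hx₀)
  have h1 : pmfMean μ F = pmfMean μ fun x => if μ x = 0 then 0 else F x := by
    refine tsum_congr fun x => ?_
    by_cases hx : μ x = 0 <;> simp [hx]
  rw [h1]
  refine abs_pmfMean_le μ fun x => ?_
  split_ifs with hx
  · simpa using hB
  · exact hF x hx

/-- In steady state the mean drift of `F` vanishes as soon as its increments are integrable; `F`
itself need not be. -/
theorem pmfMean_drift_eq_zero {K : α → PMF α} {π : PMF α} (hπ : IsInvariantLaw K π) {F D : α → ℝ}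
    (hD : ∀ z y, K z y ≠ 0 → |F y - F z| ≤ D z) (hs : Summable fun z => (π z).toReal * D z) :
    pmfMean π (fun z => pmfMean (K z) fun y => F y - F z) = 0 := by
  set G : ℕ → α → ℝ := fun M x => max (min (F x) M) (-M) with hG
  have hGb : ∀ M x, |G M x| ≤ M := fun M x =>
    abs_le.2 ⟨le_max_right _ _, max_le (min_le_right _ _) (by
      linarith [(Nat.cast_nonneg M : (0 : ℝ) ≤ M)])⟩
  have hGd : ∀ M x y, |G M y - G M x| ≤ |F y - F x| := fun M x y =>
    (abs_max_sub_max_le_abs _ _ _).trans (abs_min_sub_min_le_max _ _ _ _ |>.trans (by simp))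
  have hGlim : ∀ x, Tendsto (fun M => G M x) atTop (𝓝 (F x)) := by
    intro x
    refine tendsto_const_nhds.congr' ?_
    filter_upwards [eventually_ge_atTop ⌈|F x|⌉₊] with M hM
    have h1 : |F x| ≤ M := (Nat.le_ceil _).trans (by exact_mod_cast hM)
    rw [abs_le] at h1
    simp only [hG]
    rw [min_eq_left h1.2, max_eq_left h1.1]
  have hzero : ∀ M, pmfMean π (fun z => pmfMean (K z) fun y => G M y - G M z) = 0 := by
    intro M
    have h1 : ∀ z, pmfMean (K z) (fun y => G M y - G M z) = pmfMean (K z) (G M) - G M z := by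
      intro z
      have h := Summable.tsum_sub ((K z).summable_mul_of_bounded (hGb M))
        ((K z).summable_toReal.mul_right (G M z))
      rw [tsum_mul_right, (K z).tsum_toReal, one_mul] at h
      simp only [pmfMean, mul_sub]
      exact h
    have h2 := pmfMean_bind π K (hGb M)
    rw [hπ] at h2
    have h := Summable.tsum_sub (π.summable_mul_of_bounded fun z => abs_pmfMean_le (K z) (hGb M))
        (π.summable_mul_of_bounded (hGb M))
    simp only [h1]
    simp only [pmfMean, mul_sub] at h h2 ⊢
    rw [h, ← h2, sub_self]
  have hinner : ∀ z, Tendsto (fun M => pmfMean (K z) fun y => G M y - G M z) atTop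
      (𝓝 (pmfMean (K z) fun y => F y - F z)) := by
    intro z
    refine tendsto_tsum_of_dominated_convergence ((K z).summable_toReal.mul_right (D z))
      (fun y => ((hGlim y).sub (hGlim z)).const_mul _) (Eventually.of_forall fun M y => ?_)
    rw [norm_mul, Real.norm_of_nonneg ENNReal.toReal_nonneg]
    by_cases hy : K z y = 0
    · simp [hy]
    · exact mul_le_mul_of_nonneg_left ((hGd M z y).trans (hD z y hy)) ENNReal.toReal_nonneg
  have houter : Tendsto (fun M => pmfMean π fun z => pmfMean (K z) fun y => G M y - G M z) atTop
      (𝓝 (pmfMean π fun z => pmfMean (K z) fun y => F y - F z)) := by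
    refine tendsto_tsum_of_dominated_convergence hs
      (fun z => (hinner z).const_mul _) (Eventually.of_forall fun M z => ?_)
    rw [norm_mul, Real.norm_of_nonneg ENNReal.toReal_nonneg]
    exact mul_le_mul_of_nonneg_left (abs_pmfMean_le_of_support _ fun y hy =>
      (hGd M z y).trans (hD z y hy)) ENNReal.toReal_nonneg
  simp only [hzero] at houter
  exact tendsto_nhds_unique houter tendsto_const_nhds

end Drift

/-! ### The corrector of a function of a finite-state chain -/

section Corrector

variable {Ω : Type*} [Fintype Ω]

/-- The mean `E[F(X¹) | X⁰ = x]` of a real function after one step of a finite-state chain. -/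
noncomputable def stepMean (K : Ω → PMF Ω) (F : Ω → ℝ) (x : Ω) : ℝ := ∑ y, (K x y).toReal * F y

/-- The corrector `h(x) = ∑ₜ (E[f(Xᵗ) | X⁰ = x] - l)`, which solves the Poisson equation
`h - K h = f - l`. -/
noncomputable def corrector (K : Ω → PMF Ω) (f : Ω → ℕ) (l : ℝ) (x : Ω) : ℝ :=
  ∑' t : ℕ, (meanOf (lawAfter K (PMF.pure x) t) f - l)

/-- The conditional variance of `F(X¹)` given `X⁰ = x`. -/
noncomputable def stepVar (K : Ω → PMF Ω) (F : Ω → ℝ) (x : Ω) : ℝ :=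
  stepMean K (fun y => F y ^ 2) x - stepMean K F x ^ 2

theorem PMF.sum_toReal (μ : PMF Ω) : ∑ x, (μ x).toReal = 1 := by
  rw [← tsum_fintype (L := SummationFilter.unconditional _), μ.tsum_toReal]

theorem toReal_bind_apply_fintype {β : Type*} (μ : PMF Ω) (κ : Ω → PMF β) (y : β) :
    ((μ.bind κ) y).toReal = ∑ x, (μ x).toReal * (κ x y).toReal := by
  rw [toReal_bind_apply, tsum_fintype]

theorem sum_bind_mul (μ : PMF Ω) (κ : Ω → PMF Ω) (F : Ω → ℝ) :
    ∑ y, ((μ.bind κ) y).toReal * F y = ∑ x, (μ x).toReal * ∑ y, (κ x y).toReal * F y := by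
  simp only [toReal_bind_apply_fintype, Finset.sum_mul, Finset.mul_sum, mul_assoc]
  exact Finset.sum_comm

theorem IsInvariantLaw.sum_stepMean {K : Ω → PMF Ω} {ν : PMF Ω} (hν : IsInvariantLaw K ν)
    (F : Ω → ℝ) : ∑ x, (ν x).toReal * stepMean K F x = ∑ x, (ν x).toReal * F x := by
  simp only [stepMean]
  rw [← sum_bind_mul, hν]

theorem abs_stepMean_le (K : Ω → PMF Ω) {F : Ω → ℝ} {B : ℝ} (hF : ∀ x, |F x| ≤ B) (x : Ω) :
    |stepMean K F x| ≤ B := by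
  rw [stepMean, ← tsum_fintype (L := SummationFilter.unconditional _)]
  exact abs_pmfMean_le (K x) hF

theorem stepMean_eq_pmfMean (K : Ω → PMF Ω) (F : Ω → ℝ) (x : Ω) :
    stepMean K F x = pmfMean (K x) F := by
  rw [stepMean, pmfMean, tsum_fintype]

theorem stepVar_nonneg (K : Ω → PMF Ω) (F : Ω → ℝ) (x : Ω) : 0 ≤ stepVar K F x := by
  have hB : ∀ y, |F y| ≤ ∑ y, |F y| := fun y =>
    Finset.single_le_sum (f := fun y => |F y|) (fun _ _ => abs_nonneg _) (Finset.mem_univ y)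
  rw [stepVar, stepMean_eq_pmfMean, stepMean_eq_pmfMean, pmfMean_sq_eq _ hB]
  have := pmfMean_nonneg (K x) (fun y => sq_nonneg (F y - pmfMean (K x) F))
  linarith

theorem meanOf_lawAfter_succ (K : Ω → PMF Ω) (f : Ω → ℕ) (x : Ω) (t : ℕ) :
    meanOf (lawAfter K (PMF.pure x) (t + 1)) f =
      stepMean K (fun y => meanOf (lawAfter K (PMF.pure y) t) f) x := by
  rw [lawAfter_pure_succ]
  exact sum_bind_mul _ _ _

theorem meanOf_lawAfter_zero (K : Ω → PMF Ω) (f : Ω → ℕ) (x : Ω) :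
    meanOf (lawAfter K (PMF.pure x) 0) f = f x := by
  classical
  simp [meanOf, lawAfter, PMF.pure_apply, apply_ite ENNReal.toReal]

theorem autoCorr_eq (K : Ω → PMF Ω) (ν : PMF Ω) (f : Ω → ℕ) (t : ℕ) :
    autoCorr K ν f t = ∑ x, (ν x).toReal * (((f x : ℝ) - meanOf ν f) *
      (meanOf (lawAfter K (PMF.pure x) t) f - meanOf ν f)) := by
  refine Finset.sum_congr rfl fun x _ => ?_
  congr 2
  simp only [mul_sub, Finset.sum_sub_distrib, ← Finset.sum_mul, PMF.sum_toReal, one_mul]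
  rfl

variable {K : Ω → PMF Ω} {f : Ω → ℕ} {l c α : ℝ}

theorem summable_corrector (hα : α ∈ Set.Ioo (0 : ℝ) 1)
    (hmix : ∀ t x, |meanOf (lawAfter K (PMF.pure x) t) f - l| ≤ c * α ^ t) (x : Ω) :
    Summable fun t : ℕ => meanOf (lawAfter K (PMF.pure x) t) f - l :=
  Summable.of_norm_bounded ((summable_geometric_of_lt_one hα.1.le hα.2).mul_left c)
    fun t => hmix t x

theorem abs_corrector_le (hα : α ∈ Set.Ioo (0 : ℝ) 1)
    (hmix : ∀ t x, |meanOf (lawAfter K (PMF.pure x) t) f - l| ≤ c * α ^ t) (x : Ω) :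
    |corrector K f l x| ≤ c / (1 - α) := by
  have h := tsum_of_norm_bounded
    (f := fun t : ℕ => meanOf (lawAfter K (PMF.pure x) t) f - l)
    ((hasSum_geometric_of_lt_one hα.1.le hα.2).mul_left c)
    fun t => hmix t x
  rwa [← div_eq_mul_inv] at h

theorem corrector_sub_stepMean (hα : α ∈ Set.Ioo (0 : ℝ) 1)
    (hmix : ∀ t x, |meanOf (lawAfter K (PMF.pure x) t) f - l| ≤ c * α ^ t) (x : Ω) :
    corrector K f l x - stepMean K (corrector K f l) x = f x - l := by
  have h1 : stepMean K (corrector K f l) x =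
      ∑' t : ℕ, (meanOf (lawAfter K (PMF.pure x) (t + 1)) f - l) := by
    simp only [stepMean, corrector, ← tsum_mul_left]
    rw [← Summable.tsum_finsetSum fun y _ => (summable_corrector hα hmix y).mul_left _]
    refine tsum_congr fun t => ?_
    rw [meanOf_lawAfter_succ, stepMean]
    simp only [mul_sub, Finset.sum_sub_distrib, ← Finset.sum_mul, PMF.sum_toReal, one_mul]
  rw [h1, corrector, (summable_corrector hα hmix x).tsum_eq_zero_add, meanOf_lawAfter_zero]
  ring

theorem abs_autoCorr_le {ν : PMF Ω}
    (hmix : ∀ t x, |meanOf (lawAfter K (PMF.pure x) t) f - meanOf ν f| ≤ c * α ^ t) (t : ℕ) :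
    |autoCorr K ν f t| ≤ c * (c * α ^ t) := by
  rw [autoCorr_eq, ← tsum_fintype (L := SummationFilter.unconditional _)]
  refine abs_pmfMean_le ν fun x => ?_
  have h0 := hmix 0 x
  rw [meanOf_lawAfter_zero, pow_zero, mul_one] at h0
  rw [abs_mul]
  exact mul_le_mul h0 (hmix t x) (abs_nonneg _) ((abs_nonneg _).trans h0)

/-- The stationary variance of the martingale increments of the corrector is the asymptotic variance
`γ(0) + 2 ∑ γ(t)`. -/
theorem sum_stepVar_corrector (hα : α ∈ Set.Ioo (0 : ℝ) 1) {ν : PMF Ω} (hν : IsInvariantLaw K ν)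
    (hmix : ∀ t x, |meanOf (lawAfter K (PMF.pure x) t) f - meanOf ν f| ≤ c * α ^ t) :
    ∑ x, (ν x).toReal * stepVar K (corrector K f (meanOf ν f)) x =
      autoCorr K ν f 0 + 2 * ∑' t : ℕ, autoCorr K ν f (t + 1) := by
  set h := corrector K f (meanOf ν f) with hh
  set g : Ω → ℝ := fun x => f x - meanOf ν f with hg
  have h1 : ∀ x, stepMean K h x = h x - g x := fun x => by
    have := corrector_sub_stepMean hα hmix x
    simp only [hh, hg]; linarith
  have hs : Summable fun t => autoCorr K ν f t :=
    Summable.of_norm_bounded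
      (((summable_geometric_of_lt_one hα.1.le hα.2).mul_left c).mul_left c) fun t =>
        abs_autoCorr_le hmix t
  have h2 : ∑ x, (ν x).toReal * (g x * h x) = ∑' t, autoCorr K ν f t := by
    simp only [autoCorr_eq]
    rw [Summable.tsum_finsetSum fun x _ =>
      ((summable_corrector hα hmix x).mul_left _).mul_left _]
    refine Finset.sum_congr rfl fun x _ => ?_
    rw [tsum_mul_left, tsum_mul_left]
    rfl
  have h3 : autoCorr K ν f 0 = ∑ x, (ν x).toReal * g x ^ 2 := by
    rw [autoCorr_eq]
    refine Finset.sum_congr rfl fun x _ => ?_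
    rw [meanOf_lawAfter_zero, sq]
  have h4 : ∑ x, (ν x).toReal * stepVar K h x =
      2 * ∑ x, (ν x).toReal * (g x * h x) - ∑ x, (ν x).toReal * g x ^ 2 := by
    simp only [stepVar, mul_sub, Finset.sum_sub_distrib]
    rw [hν.sum_stepMean, ← Finset.sum_sub_distrib, Finset.mul_sum, ← Finset.sum_sub_distrib]
    refine Finset.sum_congr rfl fun x _ => ?_
    rw [h1]; ring
  rw [h4, h2, ← h3, hs.tsum_eq_zero_add]
  ring

end Corrector

/-- Passage to the limit in `γ(0) + 2 ∑ γ(t)` under a uniform geometric bound. -/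
theorem tendsto_asymptoticVariance {ι : Type*} {F : Filter ι} [F.NeBot] {G : ι → ℕ → ℝ}
    {γ : ℕ → ℝ} {c α : ℝ} (hα : α ∈ Set.Ioo (0 : ℝ) 1) (hb : ∀ᶠ e in F, ∀ t, |G e t| ≤ c * α ^ t)
    (hγ : ∀ t, Tendsto (fun e => G e t) F (𝓝 (γ t))) :
    Tendsto (fun m : ℕ => γ 0 + 2 * ∑ t ∈ Finset.Icc 1 m, γ t) atTop
        (𝓝 (γ 0 + 2 * ∑' t : ℕ, γ (t + 1))) ∧
      Tendsto (fun e => G e 0 + 2 * ∑' t : ℕ, G e (t + 1)) F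
        (𝓝 (γ 0 + 2 * ∑' t : ℕ, γ (t + 1))) := by
  have hgeo : Summable fun t : ℕ => c * α ^ (t + 1) :=
    (summable_nat_add_iff 1).2 ((summable_geometric_of_lt_one hα.1.le hα.2).mul_left c)
  have hγb : ∀ t, |γ t| ≤ c * α ^ t := fun t =>
    le_of_tendsto (hγ t).abs (hb.mono fun e he => he t)
  have hs : Summable fun t : ℕ => γ (t + 1) :=
    Summable.of_norm_bounded hgeo fun t => hγb (t + 1)
  refine ⟨((hs.hasSum.tendsto_sum_nat.const_mul 2).const_add (γ 0)).congr fun m => ?_,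
    (hγ 0).add ((tendsto_tsum_of_dominated_convergence hgeo (fun t => hγ (t + 1))
      (hb.mono fun e he t => he (t + 1))).const_mul 2)⟩
  rw [Finset.range_eq_Ico, Finset.sum_Ico_add' (fun t => γ t) 0 m 1]
  congr 2

/-! ### Vectors of independent chains -/

section Vector

variable {α β : Type*}

theorem lawAfter_map {K : α → PMF α} {K' : β → PMF β} {φ : α → β}
    (h : ∀ z, (K z).map φ = K' (φ z)) (μ : PMF α) (n : ℕ) :
    (lawAfter K μ n).map φ = lawAfter K' (μ.map φ) n := by
  induction n with
  | zero => rfl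
  | succ n ih =>
    simp only [lawAfter]
    rw [← ih, PMF.map_bind, PMF.bind_map]
    congr 1
    funext z
    exact h z

theorem IsInvariantLaw.map {K : α → PMF α} {K' : β → PMF β} {φ : α → β}
    (h : ∀ z, (K z).map φ = K' (φ z)) {π : PMF α} (hπ : IsInvariantLaw K π) :
    IsInvariantLaw K' (π.map φ) := by
  have := lawAfter_map h π 1
  simp only [lawAfter] at this
  rw [hπ] at this
  exact this.symm

variable {ι Ω : Type*} [Fintype ι] [DecidableEq ι] [Fintype Ω] (P : ι → Ω → PMF Ω)

theorem vectorKernel_toReal (x y : ι → Ω) :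
    (vectorKernel P x y).toReal = ∏ p, (P p (x p) (y p)).toReal := by
  simp [vectorKernel, ENNReal.toReal_prod]

/-- Independence of the components: the mean of a product is the product of the means. -/
theorem sum_vectorKernel_prod (x : ι → Ω) (F : ι → Ω → ℝ) :
    ∑ y, (vectorKernel P x y).toReal * ∏ p, F p (y p) = ∏ p, stepMean (P p) (F p) (x p) := by
  simp only [stepMean, vectorKernel_toReal, ← Finset.prod_mul_distrib]
  rw [Finset.prod_univ_sum, Fintype.piFinset_univ]

theorem stepMean_one (K : Ω → PMF Ω) (x : Ω) : stepMean K (fun _ => 1) x = 1 := by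
  simp [stepMean, PMF.sum_toReal]

theorem sum_vectorKernel_eval (x : ι → Ω) (p : ι) (F : Ω → ℝ) :
    ∑ y, (vectorKernel P x y).toReal * F (y p) = stepMean (P p) F (x p) := by
  have h := sum_vectorKernel_prod P x fun r => if r = p then F else fun _ => 1
  rw [Finset.prod_eq_single p (fun r _ hr => by simp [hr, stepMean_one]) (by simp)] at h
  simp only [if_true] at h
  rw [← h]
  refine Finset.sum_congr rfl fun y _ => ?_
  rw [Finset.prod_eq_single p (fun r _ hr => by simp [hr]) (by simp)]
  simp

theorem sum_vectorKernel_eval_mul (x : ι → Ω) {p q : ι} (hpq : p ≠ q) (F G : Ω → ℝ) :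
    ∑ y, (vectorKernel P x y).toReal * (F (y p) * G (y q)) =
      stepMean (P p) F (x p) * stepMean (P q) G (x q) := by
  have h := sum_vectorKernel_prod P x
    fun r => if r = p then F else if r = q then G else fun _ => 1
  rw [Finset.prod_eq_mul p q hpq (fun r _ hr => by simp [hr.1, hr.2, stepMean_one]) (by simp)
    (by simp)] at h
  simp only [if_true, if_neg hpq.symm] at h
  rw [← h]
  refine Finset.sum_congr rfl fun y _ => ?_
  rw [Finset.prod_eq_mul p q hpq (fun r _ hr => by simp [hr.1, hr.2]) (by simp) (by simp)]
  simp [hpq.symm]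

theorem vectorKernel_map_eval (x : ι → Ω) (p : ι) :
    (vectorKernel P x).map (fun y => y p) = P p (x p) := by
  classical
  ext b
  rw [← ENNReal.toReal_eq_toReal_iff' (PMF.apply_ne_top _ _) (PMF.apply_ne_top _ _)]
  have h := sum_vectorKernel_eval P x p fun a => if b = a then 1 else 0
  simp only [stepMean, mul_ite, mul_one, mul_zero, Finset.sum_ite_eq, Finset.mem_univ,
    if_true] at h
  rw [← h, PMF.map_apply, tsum_fintype, ENNReal.toReal_sum fun y _ => by
    split_ifs
    · exact PMF.apply_ne_top _ _
    · simp]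
  refine Finset.sum_congr rfl fun y _ => ?_
  split_ifs <;> rfl

variable {P}

theorem lawAfter_component_ne_zero {x y : ι → Ω} {n : ℕ}
    (h : lawAfter (vectorKernel P) (PMF.pure x) n y ≠ 0) (p : ι) :
    lawAfter (P p) (PMF.pure (x p)) n (y p) ≠ 0 := by
  have h1 := lawAfter_map (K' := P p) (fun z => vectorKernel_map_eval P z p) (PMF.pure x) n
  rw [PMF.pure_map] at h1
  rw [← h1, ← PMF.mem_support_iff, PMF.mem_support_map_iff]
  exact ⟨y, h, rfl⟩

theorem IrreducibleOn.component (h : IrreducibleOn (vectorKernel P) Set.univ) (p : ι) :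
    IrreducibleOn (P p) Set.univ := by
  obtain ⟨x, -⟩ := h.1
  refine ⟨⟨x p, trivial⟩, fun _ _ _ _ => trivial, fun a _ b _ => ?_⟩
  obtain ⟨n, hn⟩ := h.2.2 (fun _ => a) trivial (fun _ => b) trivial
  exact ⟨n, lawAfter_component_ne_zero hn p⟩

theorem AperiodicOn.component (h : AperiodicOn (vectorKernel P) Set.univ) (p : ι) :
    AperiodicOn (P p) Set.univ := fun a _ d hd =>
  h (fun _ => a) trivial d fun n hn h1 => hd n hn (lawAfter_component_ne_zero h1 p)

end Vector

/-! ### The cone of port weights and its polar part -/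

section Cone

variable {N : ℕ}

/-- The cone of nonnegative matrices of the form `aᵢ + bⱼ`, encoded by the vanishing of all
`2 × 2` alternating sums. -/
def portCone (N : ℕ) : Set (Fin N × Fin N → ℝ) :=
  {k | (∀ p, 0 ≤ k p) ∧ ∀ i j i' j', k (i, j) + k (i', j') = k (i, j') + k (i', j)}

theorem zero_mem_portCone : (0 : Fin N × Fin N → ℝ) ∈ portCone N := by
  simp [portCone]

theorem add_smul_mem_portCone {k k' : Fin N × Fin N → ℝ} (hk : k ∈ portCone N)
    (hk' : k' ∈ portCone N) {t : ℝ} (ht : 0 ≤ t) : (fun p => k p + t * k' p) ∈ portCone N := by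
  refine ⟨fun p => add_nonneg (hk.1 p) (mul_nonneg ht (hk'.1 p)), fun i j i' j' => ?_⟩
  linear_combination hk.2 i j i' j' + t * hk'.2 i j i' j'

theorem rowIndicator_mem_portCone (i : Fin N) :
    (fun p : Fin N × Fin N => if p.1 = i then (1 : ℝ) else 0) ∈ portCone N := by
  refine ⟨fun p => by positivity, fun a j a' j' => by simp⟩

theorem colIndicator_mem_portCone (j : Fin N) :
    (fun p : Fin N × Fin N => if p.2 = j then (1 : ℝ) else 0) ∈ portCone N := by
  refine ⟨fun p => by positivity, fun a b a' b' => by simp [add_comm]⟩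

theorem exists_portCone_closest (w : Fin N × Fin N → ℝ) :
    ∃ k ∈ portCone N, ∀ k' ∈ portCone N, ∑ p, (w p - k p) ^ 2 ≤ ∑ p, (w p - k' p) ^ 2 := by
  set C : Set (EuclideanSpace ℝ (Fin N × Fin N)) := {x | (x : Fin N × Fin N → ℝ) ∈ portCone N}
  have hcl : IsClosed C := by
    have : C = (⋂ p, {x : EuclideanSpace ℝ (Fin N × Fin N) | 0 ≤ x p}) ∩
        ⋂ i, ⋂ j, ⋂ i', ⋂ j',
          {x : EuclideanSpace ℝ (Fin N × Fin N) |
            x (i, j) + x (i', j') = x (i, j') + x (i', j)} := by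
      ext x; simp [C, portCone]
    rw [this]
    refine (isClosed_iInter fun p => isClosed_le (by fun_prop) (by fun_prop)).inter ?_
    exact isClosed_iInter fun i => isClosed_iInter fun j => isClosed_iInter fun i' =>
      isClosed_iInter fun j' => isClosed_eq (by fun_prop) (by fun_prop)
  have hne : C.Nonempty := ⟨0, zero_mem_portCone⟩
  obtain ⟨k, hk, hd⟩ := hcl.exists_infDist_eq_dist hne (WithLp.toLp 2 w)
  refine ⟨k, hk, fun k' hk' => ?_⟩
  have h1 : dist (WithLp.toLp 2 w) k ≤ dist (WithLp.toLp 2 w) (WithLp.toLp 2 k') := by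
    rw [← hd]
    exact Metric.infDist_le_dist_of_mem (by exact hk')
  rw [EuclideanSpace.dist_eq, EuclideanSpace.dist_eq] at h1
  have h2 := (Real.sqrt_le_sqrt_iff (by positivity)).1 h1
  simpa [Real.dist_eq, sq_abs] using h2

/-- The Euclidean projection of `w` onto the cone of port weights. -/
noncomputable def conePart (w : Fin N × Fin N → ℝ) : Fin N × Fin N → ℝ :=
  (exists_portCone_closest w).choose

/-- The component `w - conePart w` of `w` in the polar cone. -/
noncomputable def polarPart (w : Fin N × Fin N → ℝ) (p : Fin N × Fin N) : ℝ := w p - conePart w p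

/-- The squared Euclidean distance of `w` to the cone of port weights. -/
noncomputable def coneDistSq (w : Fin N × Fin N → ℝ) : ℝ := ∑ p, polarPart w p ^ 2

theorem conePart_mem (w : Fin N × Fin N → ℝ) : conePart w ∈ portCone N :=
  (exists_portCone_closest w).choose_spec.1

theorem coneDistSq_le (w : Fin N × Fin N → ℝ) {k : Fin N × Fin N → ℝ} (hk : k ∈ portCone N) :
    coneDistSq w ≤ ∑ p, (w p - k p) ^ 2 :=
  (exists_portCone_closest w).choose_spec.2 k hk

theorem coneDistSq_nonneg (w : Fin N × Fin N → ℝ) : 0 ≤ coneDistSq w :=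
  Finset.sum_nonneg fun _ _ => sq_nonneg _

theorem abs_polarPart_le (w : Fin N × Fin N → ℝ) (p : Fin N × Fin N) :
    |polarPart w p| ≤ √(coneDistSq w) := by
  refine Real.abs_le_sqrt ?_
  exact Finset.single_le_sum (f := fun p => polarPart w p ^ 2) (fun _ _ => sq_nonneg _)
    (Finset.mem_univ p)

/-- The first-order condition for a minimum, with the factor `t` not yet divided out. -/
theorem nonpos_of_small_multiples {b c : ℝ} (h : ∀ t, 0 < t → t ≤ 1 → t * b ≤ t ^ 2 * c) :
    b ≤ 0 := by
  have h1 : Tendsto (fun t : ℝ => t * c) (𝓝[>] 0) (𝓝 (0 * c)) :=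
    (tendsto_nhdsWithin_of_tendsto_nhds tendsto_id).mul_const c
  rw [zero_mul] at h1
  refine ge_of_tendsto h1 ?_
  filter_upwards [Ioc_mem_nhdsGT (zero_lt_one' ℝ)] with t ht
  have := h t ht.1 ht.2
  rw [sq, mul_assoc] at this
  exact le_of_mul_le_mul_left this ht.1

theorem sum_polarPart_mul_le (w : Fin N × Fin N → ℝ) {k : Fin N × Fin N → ℝ}
    (hk : k ∈ portCone N) : ∑ p, polarPart w p * k p ≤ 0 := by
  have h : 2 * ∑ p, polarPart w p * k p ≤ 0 := by
    refine nonpos_of_small_multiples (c := ∑ p, k p ^ 2) fun t ht _ => ?_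
    have h1 := coneDistSq_le w (add_smul_mem_portCone (conePart_mem w) hk ht.le)
    have h2 : ∑ p, (w p - (conePart w p + t * k p)) ^ 2 =
        coneDistSq w - t * (2 * ∑ p, polarPart w p * k p) + t ^ 2 * ∑ p, k p ^ 2 := by
      simp only [coneDistSq, Finset.mul_sum, ← Finset.sum_sub_distrib, ← Finset.sum_add_distrib]
      refine Finset.sum_congr rfl fun p _ => ?_
      simp only [polarPart]; ring
    linarith
  linarith

theorem sum_polarPart_mul_conePart (w : Fin N × Fin N → ℝ) :
    ∑ p, polarPart w p * conePart w p = 0 := by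
  refine le_antisymm (sum_polarPart_mul_le w (conePart_mem w)) ?_
  have h : -(2 * ∑ p, polarPart w p * conePart w p) ≤ 0 := by
    refine nonpos_of_small_multiples (c := ∑ p, conePart w p ^ 2) fun t ht ht1 => ?_
    have hmem : (fun p => (0 : Fin N × Fin N → ℝ) p + (1 - t) * conePart w p) ∈ portCone N :=
      add_smul_mem_portCone zero_mem_portCone (conePart_mem w) (by linarith)
    have h1 := coneDistSq_le w hmem
    have h2 : ∑ p, (w p - ((0 : Fin N × Fin N → ℝ) p + (1 - t) * conePart w p)) ^ 2 =
        coneDistSq w + t * (2 * ∑ p, polarPart w p * conePart w p) +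
          t ^ 2 * ∑ p, conePart w p ^ 2 := by
      simp only [coneDistSq, Finset.mul_sum, ← Finset.sum_add_distrib]
      refine Finset.sum_congr rfl fun p _ => ?_
      simp only [polarPart, Pi.zero_apply]; ring
    linarith
  linarith

theorem sum_mul_polarPart (w : Fin N × Fin N → ℝ) :
    ∑ p, w p * polarPart w p = coneDistSq w := by
  have h := sum_polarPart_mul_conePart w
  rw [← add_zero (coneDistSq w), ← h, coneDistSq, ← Finset.sum_add_distrib]
  refine Finset.sum_congr rfl fun p _ => ?_
  simp only [polarPart]; ring

theorem sum_polarPart_row_le (w : Fin N × Fin N → ℝ) (i : Fin N) :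
    ∑ j, polarPart w (i, j) ≤ 0 := by
  have h := sum_polarPart_mul_le w (rowIndicator_mem_portCone i)
  rw [Fintype.sum_prod_type, Finset.sum_eq_single i (fun a _ ha => by simp [ha]) (by simp)] at h
  simpa using h

theorem sum_polarPart_col_le (w : Fin N × Fin N → ℝ) (j : Fin N) :
    ∑ i, polarPart w (i, j) ≤ 0 := by
  have h := sum_polarPart_mul_le w (colIndicator_mem_portCone j)
  rw [Fintype.sum_prod_type_right, Finset.sum_eq_single j (fun a _ ha => by simp [ha]) (by simp)]
    at h
  simpa using h

theorem sum_ports_le {g : Fin N × Fin N → ℝ} {B : ℝ} (h : ∀ p, g p ≤ B) :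
    ∑ p, g p ≤ (N : ℝ) ^ 2 * B := by
  refine (Finset.sum_le_card_nsmul _ _ B fun p _ => h p).trans (le_of_eq ?_)
  simp [sq]

theorem abs_sum_polarPart_mul_le {w g : Fin N × Fin N → ℝ} {B : ℝ} (hg : ∀ p, |g p| ≤ B) :
    |∑ p, polarPart w p * g p| ≤ (N : ℝ) ^ 2 * (√(coneDistSq w) * B) := by
  refine (Finset.abs_sum_le_sum_abs _ _).trans (sum_ports_le fun p => ?_)
  rw [abs_mul]
  exact mul_le_mul (abs_polarPart_le w p) (hg p) (abs_nonneg _) (Real.sqrt_nonneg _)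

/-- Members of the cone are recovered from their row and column sums. -/
theorem portCone_eq_sums {k : Fin N × Fin N → ℝ} (hk : k ∈ portCone N) (i j : Fin N) :
    (N : ℝ) ^ 2 * k (i, j) = N * ∑ j', k (i, j') + N * ∑ i', k (i', j) - ∑ p, k p := by
  have h : ∑ i', ∑ j', (k (i, j) + k (i', j')) = ∑ i', ∑ j', (k (i, j') + k (i', j)) :=
    Finset.sum_congr rfl fun i' _ => Finset.sum_congr rfl fun j' _ => hk.2 i j i' j'
  simp only [Finset.sum_add_distrib, Finset.sum_const, Finset.card_univ, Fintype.card_fin,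
    nsmul_eq_mul, ← Finset.mul_sum] at h
  rw [Fintype.sum_prod_type]
  linear_combination h

/-- The cone is orthogonal to the matrices whose row and column sums vanish. -/
theorem sum_portCone_mul_eq_zero {k m : Fin N × Fin N → ℝ} (hk : k ∈ portCone N)
    (hr : ∀ i, ∑ j, m (i, j) = 0) (hc : ∀ j, ∑ i, m (i, j) = 0) : ∑ p, k p * m p = 0 := by
  rcases Nat.eq_zero_or_pos N with rfl | hN
  · simp
  have hN' : ((N : ℝ) ^ 2) ≠ 0 := by positivity
  refine (mul_eq_zero.1 (?_ : (N : ℝ) ^ 2 * ∑ p, k p * m p = 0)).resolve_left hN'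
  have h0 : ∑ p, m p = 0 := by rw [Fintype.sum_prod_type]; simp [hr]
  calc (N : ℝ) ^ 2 * ∑ p, k p * m p
      = ∑ p : Fin N × Fin N, (N * ∑ j', k (p.1, j')) * m p +
          ∑ p : Fin N × Fin N, (N * ∑ i', k (i', p.2)) * m p - (∑ p, k p) * ∑ p, m p := by
        rw [Finset.mul_sum, Finset.mul_sum, ← Finset.sum_add_distrib, ← Finset.sum_sub_distrib]
        refine Finset.sum_congr rfl fun p _ => ?_
        linear_combination m p * portCone_eq_sums hk p.1 p.2
    _ = 0 := by
        rw [h0, Fintype.sum_prod_type, Fintype.sum_prod_type_right]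
        simp only [← Finset.mul_sum, hr, hc]
        simp

end Cone

/-! ### MaxWeight maximizes over all substochastic matrices -/

section MaxWeight

variable {N : ℕ} {q : Fin N × Fin N → ℕ} {s : Fin N × Fin N → Fin 2}

theorem sum_row_of_mem_maxWeight (hs : s ∈ maxWeightSchedules q) (i : Fin N) :
    ∑ j, ((s (i, j) : ℕ) : ℝ) = 1 := by
  simp only [maxWeightSchedules, perfectMatchings, Finset.mem_filter, Finset.mem_univ,
    true_and] at hs
  exact_mod_cast hs.1.1 i

theorem sum_col_of_mem_maxWeight (hs : s ∈ maxWeightSchedules q) (j : Fin N) :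
    ∑ i, ((s (i, j) : ℕ) : ℝ) = 1 := by
  simp only [maxWeightSchedules, perfectMatchings, Finset.mem_filter, Finset.mem_univ,
    true_and] at hs
  exact_mod_cast hs.1.2 j

/-- A permutation matrix is a feasible schedule. -/
theorem sum_mul_permMatrix_le (hs : s ∈ maxWeightSchedules q) (τ : Equiv.Perm (Fin N)) :
    ∑ p : Fin N × Fin N, (q p : ℝ) * Equiv.Perm.permMatrix ℝ τ p.1 p.2 ≤
      ∑ p, (q p : ℝ) * ((s p : ℕ) : ℝ) := by
  set t : Fin N × Fin N → Fin 2 := fun p => if τ p.1 = p.2 then 1 else 0 with ht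
  have hval : ∀ p, (t p : ℕ) = if τ p.1 = p.2 then 1 else 0 := fun p => by
    simp only [ht]; split_ifs <;> rfl
  have hfeas : t ∈ feasibleSchedules N := by
    simp only [feasibleSchedules, Finset.mem_filter, Finset.mem_univ, true_and, hval]
    refine ⟨fun i => by simp, fun j => ?_⟩
    rw [Finset.sum_eq_single (τ.symm j)]
    · simp
    · intro b _ hb
      rw [if_neg]
      rintro h
      exact hb (by simp [← h])
    · simp
  have h := (Finset.mem_filter.1 hs).2 t hfeas
  simp only [weight] at h
  have h' : ∑ p, (q p : ℝ) * ((t p : ℕ) : ℝ) ≤ ∑ p, (q p : ℝ) * ((s p : ℕ) : ℝ) := by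
    exact_mod_cast h
  refine le_trans (le_of_eq (Finset.sum_congr rfl fun p _ => ?_)) h'
  rw [hval]
  simp [Equiv.Perm.permMatrix, PEquiv.toMatrix_apply, eq_comm]

theorem sum_mul_doublyStochastic_le (hs : s ∈ maxWeightSchedules q) {r : Fin N × Fin N → ℝ}
    (h0 : ∀ p, 0 ≤ r p) (hr : ∀ i, ∑ j, r (i, j) = 1) (hc : ∀ j, ∑ i, r (i, j) = 1) :
    ∑ p, (q p : ℝ) * r p ≤ ∑ p, (q p : ℝ) * ((s p : ℕ) : ℝ) := by
  have hM : (Matrix.of fun i j => r (i, j)) ∈ doublyStochastic ℝ (Fin N) :=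
    mem_doublyStochastic_iff_sum.2 ⟨fun i j => h0 _, hr, hc⟩
  obtain ⟨c, hc0, hc1, hcM⟩ := exists_eq_sum_perm_of_mem_doublyStochastic hM
  have hrp : ∀ p : Fin N × Fin N, r p = ∑ τ, c τ * Equiv.Perm.permMatrix ℝ τ p.1 p.2 := by
    intro p
    have := congrFun (congrFun hcM p.1) p.2
    rw [Matrix.sum_apply] at this
    simpa using this.symm
  calc ∑ p, (q p : ℝ) * r p
      = ∑ τ, c τ * ∑ p : Fin N × Fin N, (q p : ℝ) * Equiv.Perm.permMatrix ℝ τ p.1 p.2 := by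
        simp only [hrp, Finset.mul_sum]
        rw [Finset.sum_comm]
        refine Finset.sum_congr rfl fun τ _ => Finset.sum_congr rfl fun p _ => by ring
    _ ≤ ∑ τ, c τ * ∑ p, (q p : ℝ) * ((s p : ℕ) : ℝ) :=
        Finset.sum_le_sum fun τ _ => mul_le_mul_of_nonneg_left (sum_mul_permMatrix_le hs τ) (hc0 τ)
    _ = _ := by rw [← Finset.sum_mul, hc1, one_mul]

/-- A substochastic matrix is dominated by a doubly stochastic one, obtained by adding the product
of the row and column deficits divided by the total deficit. -/
theorem sum_mul_substochastic_le (hs : s ∈ maxWeightSchedules q) {r : Fin N × Fin N → ℝ}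
    (h0 : ∀ p, 0 ≤ r p) (hr : ∀ i, ∑ j, r (i, j) ≤ 1) (hc : ∀ j, ∑ i, r (i, j) ≤ 1) :
    ∑ p, (q p : ℝ) * r p ≤ ∑ p, (q p : ℝ) * ((s p : ℕ) : ℝ) := by
  set R : Fin N → ℝ := fun i => 1 - ∑ j, r (i, j) with hR
  set C : Fin N → ℝ := fun j => 1 - ∑ i, r (i, j) with hC
  have hR0 : ∀ i, 0 ≤ R i := fun i => sub_nonneg.2 (hr i)
  have hC0 : ∀ j, 0 ≤ C j := fun j => sub_nonneg.2 (hc j)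
  have hRC : ∑ i, R i = ∑ j, C j := by
    simp only [hR, hC, Finset.sum_sub_distrib]
    rw [Finset.sum_comm]
  set T := ∑ i, R i with hT
  have hT0 : 0 ≤ T := Finset.sum_nonneg fun i _ => hR0 i
  have hRz : T = 0 → ∀ i, R i = 0 := fun h i =>
    (Finset.sum_eq_zero_iff_of_nonneg fun i _ => hR0 i).1 h i (Finset.mem_univ i)
  have hCz : T = 0 → ∀ j, C j = 0 := fun h j =>
    (Finset.sum_eq_zero_iff_of_nonneg fun i _ => hC0 i).1 (hRC ▸ h) j (Finset.mem_univ j)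
  -- when `T = 0` all deficits vanish and the quotient has the junk value `0`
  have key := sum_mul_doublyStochastic_le hs (r := fun p => r p + R p.1 * C p.2 / T)
    (fun p => add_nonneg (h0 p) (div_nonneg (mul_nonneg (hR0 _) (hC0 _)) hT0))
    (fun i => by
      simp only [Finset.sum_add_distrib, ← Finset.sum_div, ← Finset.mul_sum, ← hRC]
      by_cases h : T = 0
      · have := hRz h i; simp only [h, div_zero]; simp only [hR] at this; linarith
      · rw [mul_div_cancel_right₀ _ h]; simp [hR])
    (fun j => by
      simp only [Finset.sum_add_distrib, ← Finset.sum_div, ← Finset.sum_mul]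
      by_cases h : T = 0
      · have := hCz h j; simp only [h, div_zero]; simp only [hC] at this; linarith
      · rw [mul_div_cancel_left₀ _ h]; simp [hC])
  refine le_trans (Finset.sum_le_sum fun p _ => ?_) key
  exact mul_le_mul_of_nonneg_left
    (le_add_of_nonneg_right (div_nonneg (mul_nonneg (hR0 _) (hC0 _)) hT0)) (Nat.cast_nonneg _)

/-- Moving from a positive point `v` of the saturated face in the direction of a polar vector stays
in the capacity region, which makes MaxWeight push the queues towards the cone. -/
theorem sum_mul_add_polarPart_le (hs : s ∈ maxWeightSchedules q) {v : Fin N × Fin N → ℝ}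
    (hv : v ∈ saturatedFace N) {vmin : ℝ} (hvm : ∀ p, vmin ≤ v p) (w : Fin N × Fin N → ℝ) {c : ℝ}
    (hc0 : 0 ≤ c) (hc : c * √(coneDistSq w) ≤ vmin) :
    ∑ p, (q p : ℝ) * (v p + c * polarPart w p) ≤ ∑ p, (q p : ℝ) * ((s p : ℕ) : ℝ) := by
  refine sum_mul_substochastic_le hs (fun p => ?_) (fun i => ?_) fun j => ?_
  · have h1 : -(c * √(coneDistSq w)) ≤ c * polarPart w p := by
      rw [← mul_neg]
      exact mul_le_mul_of_nonneg_left (abs_le.1 (abs_polarPart_le w p)).1 hc0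
    linarith [hvm p]
  · rw [Finset.sum_add_distrib, ← Finset.mul_sum, hv.2.1 i]
    linarith [mul_nonpos_of_nonneg_of_nonpos hc0 (sum_polarPart_row_le w i)]
  · rw [Finset.sum_add_distrib, ← Finset.mul_sum, hv.2.2 j]
    linarith [mul_nonpos_of_nonneg_of_nonpos hc0 (sum_polarPart_col_le w j)]

end MaxWeight

/-! ### One time slot of the switch -/

section Slot

variable {N : ℕ} {Ω : Type*} [Fintype Ω]

/-- The state that follows `z` under the schedule `s` when the modulating chains move to `x`. -/
def nextState (f : Ω → ℕ) (z : SwitchState N Ω) (s : Fin N × Fin N → Fin 2)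
    (x : Fin N × Fin N → Ω) : SwitchState N Ω :=
  (fun p => z.1 p + f (z.2 p) - (s p : ℕ), x)

/-- The conditional mean, given the current state `z`, of a function of the schedule and of the next
states of the modulating chains. -/
noncomputable def slotMean (P : Fin N × Fin N → Ω → PMF Ω) (z : SwitchState N Ω)
    (φ : (Fin N × Fin N → Fin 2) → (Fin N × Fin N → Ω) → ℝ) : ℝ :=
  ((maxWeightSchedules z.1).card : ℝ)⁻¹ *
    ∑ s ∈ maxWeightSchedules z.1, ∑ x, (vectorKernel P z.2 x).toReal * φ s x

variable (f : Ω → ℕ) (P : Fin N × Fin N → Ω → PMF Ω) (z : SwitchState N Ω)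
  (φ ψ : (Fin N × Fin N → Fin 2) → (Fin N × Fin N → Ω) → ℝ)

theorem slotMean_add : slotMean P z (fun s x => φ s x + ψ s x) =
    slotMean P z φ + slotMean P z ψ := by
  simp only [slotMean, mul_add, Finset.sum_add_distrib]

theorem slotMean_const_mul (c : ℝ) : slotMean P z (fun s x => c * φ s x) = c * slotMean P z φ := by
  simp only [slotMean, Finset.mul_sum]
  exact Finset.sum_congr rfl fun s _ => Finset.sum_congr rfl fun x _ => by ring

/-- The means of functions of the next modulating states do not involve the schedule. -/
theorem slotMean_of_state (g : (Fin N × Fin N → Ω) → ℝ) :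
    slotMean P z (fun _ x => g x) = ∑ x, (vectorKernel P z.2 x).toReal * g x := by
  have : ((maxWeightSchedules z.1).card : ℝ) ≠ 0 := by
    exact_mod_cast (Finset.card_pos.2 (maxWeightSchedules_nonempty z.1)).ne'
  rw [slotMean, Finset.sum_const, nsmul_eq_mul, inv_mul_cancel_left₀ this]

theorem slotMean_const (c : ℝ) : slotMean P z (fun _ _ => c) = c := by
  rw [slotMean_of_state P z fun _ => c, ← Finset.sum_mul, PMF.sum_toReal, one_mul]

theorem slotMean_sub : slotMean P z (fun s x => φ s x - ψ s x) =
    slotMean P z φ - slotMean P z ψ := by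
  simp only [slotMean, mul_sub, Finset.sum_sub_distrib]

theorem slotMean_finset_sum {ι : Type*} (t : Finset ι)
    (g : ι → (Fin N × Fin N → Fin 2) → (Fin N × Fin N → Ω) → ℝ) :
    slotMean P z (fun s x => ∑ i ∈ t, g i s x) = ∑ i ∈ t, slotMean P z (g i) := by
  classical
  induction t using Finset.induction_on with
  | empty => simp only [Finset.sum_empty, slotMean_const]
  | insert a t ha ih => simp only [Finset.sum_insert ha]; rw [slotMean_add, ih]

variable {φ ψ} in
theorem slotMean_mono (h : ∀ s ∈ maxWeightSchedules z.1, ∀ x, φ s x ≤ ψ s x) :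
    slotMean P z φ ≤ slotMean P z ψ := by
  refine mul_le_mul_of_nonneg_left ?_ (by positivity)
  exact Finset.sum_le_sum fun s hs => Finset.sum_le_sum fun x _ =>
    mul_le_mul_of_nonneg_left (h s hs x) ENNReal.toReal_nonneg

variable {φ ψ} in
theorem slotMean_congr (h : ∀ s ∈ maxWeightSchedules z.1, ∀ x, φ s x = ψ s x) :
    slotMean P z φ = slotMean P z ψ :=
  le_antisymm (slotMean_mono P z fun s hs x => (h s hs x).le)
    (slotMean_mono P z fun s hs x => (h s hs x).ge)

variable {φ ψ} in
theorem abs_slotMean_le (h : ∀ s ∈ maxWeightSchedules z.1, ∀ x, |φ s x| ≤ ψ s x) :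
    |slotMean P z φ| ≤ slotMean P z ψ := by
  refine abs_le.2 ⟨?_, slotMean_mono P z fun s hs x => (abs_le.1 (h s hs x)).2⟩
  have h1 : slotMean P z (fun s x => (-1) * ψ s x) ≤ slotMean P z φ :=
    slotMean_mono P z fun s hs x => by linarith [(abs_le.1 (h s hs x)).1]
  rw [slotMean_const_mul] at h1
  linarith

open Classical in
theorem switchKernel_toReal (y : SwitchState N Ω) :
    (switchKernel f P z y).toReal =
      slotMean P z fun s x => if y = nextState f z s x then 1 else 0 := by
  rw [switchKernel, toReal_bind_apply_fintype, slotMean, Finset.mul_sum,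
    ← Finset.sum_filter_add_sum_filter_not Finset.univ (fun s => s ∈ maxWeightSchedules z.1)]
  rw [Finset.sum_eq_zero (s := Finset.filter (fun s => s ∉ maxWeightSchedules z.1) Finset.univ),
    add_zero]
  · refine Finset.sum_congr (by simp) fun s hs => ?_
    rw [PMF.uniformOfFinset_apply_of_mem _ hs, PMF.map_apply, tsum_fintype, ENNReal.toReal_sum]
    · simp only [ENNReal.toReal_inv, ENNReal.toReal_natCast, mul_ite, mul_one, mul_zero]
      congr 1
      refine Finset.sum_congr rfl fun x _ => ?_
      by_cases hy : y = nextState f z s x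
      · rw [if_pos hy]; exact congrArg ENNReal.toReal (if_pos hy)
      · rw [if_neg hy]
        exact (congrArg ENNReal.toReal (if_neg hy)).trans ENNReal.toReal_zero
    · intro x _
      split_ifs
      · exact PMF.apply_ne_top _ _
      · simp
  · intro s hs
    rw [PMF.uniformOfFinset_apply_of_notMem _ (Finset.mem_filter.1 hs).2]
    simp

theorem hasSum_switchKernel (F : SwitchState N Ω → ℝ) :
    HasSum (fun y => (switchKernel f P z y).toReal * F y)
      (slotMean P z fun s x => F (nextState f z s x)) := by
  classical
  have h : HasSum (fun y => ((maxWeightSchedules z.1).card : ℝ)⁻¹ *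
      ∑ s ∈ maxWeightSchedules z.1, ∑ x, (vectorKernel P z.2 x).toReal *
        (if y = nextState f z s x then F (nextState f z s x) else 0))
      (slotMean P z fun s x => F (nextState f z s x)) :=
    (hasSum_sum fun s _ => hasSum_sum fun x _ => (hasSum_ite_eq _ _).mul_left _).mul_left _
  refine h.congr_fun fun y => ?_
  rw [switchKernel_toReal, slotMean, mul_assoc]
  simp only [Finset.sum_mul, mul_assoc]
  congr 1
  refine Finset.sum_congr rfl fun s _ => Finset.sum_congr rfl fun x _ => ?_
  split_ifs with hy
  · rw [hy, one_mul]
  · rw [zero_mul]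

theorem pmfMean_switchKernel (F : SwitchState N Ω → ℝ) :
    pmfMean (switchKernel f P z) F = slotMean P z fun s x => F (nextState f z s x) :=
  (hasSum_switchKernel f P z F).tsum_eq

theorem tsum_switchKernel_ofReal {F : SwitchState N Ω → ℝ} (hF : ∀ y, 0 ≤ F y) :
    ∑' y, switchKernel f P z y * ENNReal.ofReal (F y) =
      ENNReal.ofReal (slotMean P z fun s x => F (nextState f z s x)) := by
  rw [← (hasSum_switchKernel f P z F).tsum_eq, ENNReal.ofReal_tsum_of_nonneg
    (fun y => mul_nonneg ENNReal.toReal_nonneg (hF y)) (hasSum_switchKernel f P z F).summable]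
  refine tsum_congr fun y => ?_
  rw [ENNReal.ofReal_mul ENNReal.toReal_nonneg, ENNReal.ofReal_toReal (PMF.apply_ne_top _ _)]

variable {f P z} in
theorem exists_of_switchKernel_ne_zero {y : SwitchState N Ω} (h : switchKernel f P z y ≠ 0) :
    ∃ s ∈ maxWeightSchedules z.1, ∃ x, y = nextState f z s x := by
  rw [switchKernel, ← PMF.mem_support_iff, PMF.mem_support_bind_iff] at h
  obtain ⟨s, hs, hy⟩ := h
  rw [PMF.mem_support_map_iff] at hy
  obtain ⟨x, -, rfl⟩ := hy
  rw [PMF.support_uniformOfFinset] at hs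
  exact ⟨s, hs, x, rfl⟩

/-- Each modulating chain is Markov on its own, whatever the queues do. -/
theorem switchKernel_map_eval (p : Fin N × Fin N) :
    (switchKernel f P z).map (fun y => y.2 p) = P p (z.2 p) := by
  rw [switchKernel, PMF.map_bind]
  have : ∀ s : Fin N × Fin N → Fin 2, ((vectorKernel P z.2).map fun x' =>
      ((fun p => z.1 p + f (z.2 p) - (s p : ℕ), x') : SwitchState N Ω)).map (fun y => y.2 p) =
      P p (z.2 p) := fun s => by
    rw [PMF.map_comp]
    exact vectorKernel_map_eval P z.2 p
  simp only [this, PMF.bind_const]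

/-- A drift inequality between real functions of the state, as one between mean values under the
switch kernel. -/
theorem switch_drift {f : Ω → ℕ} {P : Fin N × Fin N → Ω → PMF Ω} {V g : SwitchState N Ω → ℝ} {b : ℝ}
    (hV : ∀ z, 0 ≤ V z) (hg : ∀ z, 0 ≤ g z)
    (h : ∀ z, slotMean P z (fun s x => V (nextState f z s x)) + g z ≤ V z + b)
    (z : SwitchState N Ω) :
    ∑' y, switchKernel f P z y * ENNReal.ofReal (V y) + ENNReal.ofReal (g z) ≤
      ENNReal.ofReal (V z) + ENNReal.ofReal b := by
  rw [tsum_switchKernel_ofReal f P z hV, ← ENNReal.ofReal_add _ (hg z)]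
  · exact (ENNReal.ofReal_le_ofReal (h z)).trans ENNReal.ofReal_add_le
  · rw [← pmfMean_switchKernel]
    exact pmfMean_nonneg _ hV

end Slot

/-! ### The corrected queue lengths -/

/-- The unused service at `p`: it is `1` if `p` is scheduled and there is nothing to serve, and `0`
otherwise. -/
def idle {N : ℕ} {Ω : Type*} (f : Ω → ℕ) (z : SwitchState N Ω) (s : Fin N × Fin N → Fin 2)
    (p : Fin N × Fin N) : ℝ :=
  (((s p : ℕ) - (z.1 p + f (z.2 p)) : ℕ) : ℝ)

theorem slot_le_one {N : ℕ} (s : Fin N × Fin N → Fin 2) (p : Fin N × Fin N) :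
    ((s p : ℕ) : ℝ) ≤ 1 := by
  have : (s p : ℕ) ≤ 1 := by have := (s p).2; omega
  exact_mod_cast this

section Idle

variable {N : ℕ} {Ω : Type*} (f : Ω → ℕ) (z : SwitchState N Ω) (s : Fin N × Fin N → Fin 2)
  (p : Fin N × Fin N)

theorem idle_nonneg : 0 ≤ idle f z s p := Nat.cast_nonneg _

theorem idle_le_slot : idle f z s p ≤ ((s p : ℕ) : ℝ) := by
  rw [idle, Nat.cast_le]; exact Nat.sub_le _ _

theorem idle_le_one : idle f z s p ≤ 1 := (idle_le_slot f z s p).trans (slot_le_one s p)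

theorem idle_mul_queue : (z.1 p : ℝ) * idle f z s p = 0 := by
  have h : (s p : ℕ) < 2 := (s p).2
  rw [idle, mul_eq_zero, Nat.cast_eq_zero, Nat.cast_eq_zero]
  omega

theorem idle_mul_nextQueue (x : Fin N × Fin N → Ω) :
    ((nextState f z s x).1 p : ℝ) * idle f z s p = 0 := by
  rw [idle, mul_eq_zero, Nat.cast_eq_zero, Nat.cast_eq_zero]
  simp only [nextState]
  omega

theorem nextQueue_eq (x : Fin N × Fin N → Ω) :
    ((nextState f z s x).1 p : ℝ) = z.1 p + f (z.2 p) - ((s p : ℕ) : ℝ) + idle f z s p := by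
  have : (nextState f z s x).1 p + (s p : ℕ) =
      z.1 p + f (z.2 p) + ((s p : ℕ) - (z.1 p + f (z.2 p))) := by
    simp only [nextState]
    omega
  have h2 : (((nextState f z s x).1 p + (s p : ℕ) : ℕ) : ℝ) =
      ((z.1 p + f (z.2 p) + ((s p : ℕ) - (z.1 p + f (z.2 p))) : ℕ) : ℝ) := by rw [this]
  rw [Nat.cast_add, Nat.cast_add, Nat.cast_add] at h2
  rw [idle]
  linarith

end Idle

section Corrected

variable {N : ℕ} {Ω : Type*} [Fintype Ω]

/-- The functions `h p` are correctors, bounded by `H`, of the arrival processes with rates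
`(1 - ε) v`, where `v` lies on the saturated face. -/
structure IsCorrector (f : Ω → ℕ) (P : Fin N × Fin N → Ω → PMF Ω) (v : Fin N × Fin N → ℝ)
    (ε H : ℝ) (h : Fin N × Fin N → Ω → ℝ) : Prop where
  face : v ∈ saturatedFace N
  eps : ε ∈ Set.Ioo (0 : ℝ) 1
  bound : ∀ p x, |h p x| ≤ H
  poisson : ∀ p x, h p x - stepMean (P p) (h p) x = f x - (1 - ε) * v p

/-- The queue lengths corrected by functions of the modulating states. -/
def corrQueue (h : Fin N × Fin N → Ω → ℝ) (z : SwitchState N Ω) (p : Fin N × Fin N) : ℝ :=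
  z.1 p + h p (z.2 p)

/-- The martingale increments of the correctors. -/
noncomputable def noise (P : Fin N × Fin N → Ω → PMF Ω) (h : Fin N × Fin N → Ω → ℝ)
    (x x' : Fin N × Fin N → Ω) (p : Fin N × Fin N) : ℝ :=
  h p (x' p) - stepMean (P p) (h p) (x p)

theorem face_le_one {v : Fin N × Fin N → ℝ} (hv : v ∈ saturatedFace N) (p : Fin N × Fin N) :
    v p ≤ 1 := by
  rw [← hv.2.1 p.1]
  exact Finset.single_le_sum (f := fun j => v (p.1, j)) (fun j _ => hv.1 _) (Finset.mem_univ p.2)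

section Noise

variable (P : Fin N × Fin N → Ω → PMF Ω) (h : Fin N × Fin N → Ω → ℝ) (z : SwitchState N Ω)
  (c : Fin N × Fin N → ℝ)

theorem stepMean_sub_const (K : Ω → PMF Ω) (F : Ω → ℝ) (a : ℝ) (x : Ω) :
    stepMean K (fun y => F y - a) x = stepMean K F x - a := by
  simp only [stepMean, mul_sub, Finset.sum_sub_distrib, ← Finset.sum_mul, PMF.sum_toReal, one_mul]

theorem stepMean_sub_sq (K : Ω → PMF Ω) (F : Ω → ℝ) (x : Ω) :
    stepMean K (fun y => (F y - stepMean K F x) ^ 2) x = stepVar K F x := by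
  have hB : ∀ y, |F y| ≤ ∑ y, |F y| := fun y =>
    Finset.single_le_sum (f := fun y => |F y|) (fun _ _ => abs_nonneg _) (Finset.mem_univ y)
  rw [stepVar]
  simp only [stepMean_eq_pmfMean]
  rw [pmfMean_sq_eq (K x) hB]
  ring

theorem slotMean_noise : slotMean P z (fun _ x => ∑ p, c p * noise P h z.2 x p) = 0 := by
  rw [slotMean_of_state P z fun x => ∑ p, c p * noise P h z.2 x p]
  simp only [Finset.mul_sum]
  rw [Finset.sum_comm]
  refine Finset.sum_eq_zero fun p _ => ?_
  have := sum_vectorKernel_eval P z.2 p fun y => h p y - stepMean (P p) (h p) (z.2 p)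
  rw [stepMean_sub_const, sub_self] at this
  rw [← mul_zero (c p), ← this, Finset.mul_sum]
  exact Finset.sum_congr rfl fun x _ => by simp only [noise]; ring

/-- The noise is uncorrelated between different queues. -/
theorem slotMean_noise_sq :
    slotMean P z (fun _ x => (∑ p, c p * noise P h z.2 x p) ^ 2) =
      ∑ p, c p ^ 2 * stepVar (P p) (h p) (z.2 p) := by
  rw [slotMean_of_state P z fun x => (∑ p, c p * noise P h z.2 x p) ^ 2]
  have hcov : ∀ p q, ∑ x, (vectorKernel P z.2 x).toReal *
      (noise P h z.2 x p * noise P h z.2 x q) =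
        if q = p then stepVar (P p) (h p) (z.2 p) else 0 := by
    intro p q
    split_ifs with hpq
    · subst hpq
      rw [← stepMean_sub_sq, ← sum_vectorKernel_eval]
      exact Finset.sum_congr rfl fun x _ => by simp only [noise]; ring
    · have := sum_vectorKernel_eval_mul P z.2 (Ne.symm hpq)
        (fun y => h p y - stepMean (P p) (h p) (z.2 p))
        (fun y => h q y - stepMean (P q) (h q) (z.2 q))
      rw [stepMean_sub_const, sub_self, zero_mul] at this
      exact this
  calc ∑ x, (vectorKernel P z.2 x).toReal * (∑ p, c p * noise P h z.2 x p) ^ 2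
      = ∑ p, ∑ q, c p * c q * ∑ x, (vectorKernel P z.2 x).toReal *
          (noise P h z.2 x p * noise P h z.2 x q) := by
        have hsq : ∀ x, (∑ p, c p * noise P h z.2 x p) ^ 2 =
            ∑ p, ∑ q, c p * noise P h z.2 x p * (c q * noise P h z.2 x q) := fun x => by
          rw [sq, Finset.sum_mul_sum]
        simp only [hsq, Finset.mul_sum]
        rw [Finset.sum_comm]
        refine Finset.sum_congr rfl fun p _ => ?_
        rw [Finset.sum_comm]
        exact Finset.sum_congr rfl fun q _ => Finset.sum_congr rfl fun x _ => by ring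
    _ = _ := by
        refine Finset.sum_congr rfl fun p _ => ?_
        simp only [hcov, mul_ite, mul_zero, Finset.sum_ite_eq', Finset.mem_univ, if_true]
        ring

end Noise

namespace IsCorrector

variable {f : Ω → ℕ} {P : Fin N × Fin N → Ω → PMF Ω} {v : Fin N × Fin N → ℝ} {ε H : ℝ}
  {h : Fin N × Fin N → Ω → ℝ}

theorem rate_mem (hc : IsCorrector f P v ε H h) (p : Fin N × Fin N) :
    0 ≤ (1 - ε) * v p ∧ (1 - ε) * v p ≤ 1 := by
  have h1 := hc.face.1 p
  have h2 := face_le_one hc.face p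
  have h3 := hc.eps
  constructor
  · exact mul_nonneg (by linarith [h3.2]) h1
  · nlinarith [h3.1, h3.2]

/-- The corrected queue lengths evolve as if the arrivals were constant, up to martingale noise. -/
theorem corrQueue_next (hc : IsCorrector f P v ε H h) (z : SwitchState N Ω)
    (s : Fin N × Fin N → Fin 2) (x : Fin N × Fin N → Ω) (p : Fin N × Fin N) :
    corrQueue h (nextState f z s x) p = corrQueue h z p +
      ((1 - ε) * v p - ((s p : ℕ) : ℝ) + idle f z s p) + noise P h z.2 x p := by
  have h1 := hc.poisson p (z.2 p)
  rw [corrQueue, nextQueue_eq, corrQueue, noise]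
  have h2 : (nextState f z s x).2 p = x p := rfl
  rw [h2]
  linarith

theorem abs_drift_le (hc : IsCorrector f P v ε H h) (z : SwitchState N Ω)
    (s : Fin N × Fin N → Fin 2) (p : Fin N × Fin N) :
    |(1 - ε) * v p - ((s p : ℕ) : ℝ) + idle f z s p| ≤ 1 := by
  have h1 := hc.rate_mem p
  have h2 := idle_nonneg f z s p
  have h3 := idle_le_slot f z s p
  have h4 := slot_le_one s p
  rw [abs_le]
  constructor <;> linarith

theorem abs_noise_le (hc : IsCorrector f P v ε H h) (x x' : Fin N × Fin N → Ω)
    (p : Fin N × Fin N) : |noise P h x x' p| ≤ 2 * H := by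
  have h1 := hc.bound p (x' p)
  have h2 := abs_stepMean_le (P p) (hc.bound p) (x p)
  rw [noise]
  linarith [abs_sub (h p (x' p)) (stepMean (P p) (h p) (x p))]

theorem abs_increment_le (hc : IsCorrector f P v ε H h) (z : SwitchState N Ω)
    (s : Fin N × Fin N → Fin 2) (x : Fin N × Fin N → Ω) (p : Fin N × Fin N) :
    |((1 - ε) * v p - ((s p : ℕ) : ℝ) + idle f z s p) + noise P h z.2 x p| ≤ 1 + 2 * H :=
  (abs_add_le _ _).trans (add_le_add (hc.abs_drift_le z s p) (hc.abs_noise_le z.2 x p))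

/-- Unused service occurs only at empty queues, where the corrected queue length is bounded. -/
theorem corrQueue_mul_idle_le (hc : IsCorrector f P v ε H h) (z : SwitchState N Ω)
    (s : Fin N × Fin N → Fin 2) (p : Fin N × Fin N) : corrQueue h z p * idle f z s p ≤ H := by
  have h1 := idle_mul_queue f z s p
  have h2 := abs_le.1 (hc.bound p (z.2 p))
  have h3 := idle_nonneg f z s p
  have h4 := idle_le_one f z s p
  have h5 : 0 ≤ H := (abs_nonneg _).trans (hc.bound p (z.2 p))
  rw [corrQueue, add_mul, h1, zero_add]
  nlinarith

/-- The drift of the squared length of the corrected queue vector: MaxWeight stabilizes the switch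
at every load `1 - ε < 1`. -/
theorem drift_sq (hc : IsCorrector f P v ε H h) {vmin : ℝ} (hvm : ∀ p, vmin ≤ v p)
    (z : SwitchState N Ω) :
    slotMean P z (fun s x => ∑ p, corrQueue h (nextState f z s x) p ^ 2) +
        2 * ε * vmin * ∑ p, (z.1 p : ℝ) ≤
      ∑ p, corrQueue h z p ^ 2 + (N : ℝ) ^ 2 * (2 * H + (1 + 2 * H) ^ 2) := by
  have hpt : ∀ s ∈ maxWeightSchedules z.1, ∀ x,
      ∑ p, corrQueue h (nextState f z s x) p ^ 2 ≤
        (∑ p, corrQueue h z p ^ 2 - 2 * ε * vmin * ∑ p, (z.1 p : ℝ) +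
          (N : ℝ) ^ 2 * (2 * H + (1 + 2 * H) ^ 2)) +
        ∑ p, (2 * corrQueue h z p) * noise P h z.2 x p := by
    intro s hs x
    have h1 := sum_mul_doublyStochastic_le hs hc.face.1 hc.face.2.1 hc.face.2.2
    have h2 : ∀ p, corrQueue h (nextState f z s x) p ^ 2 ≤ corrQueue h z p ^ 2 +
        2 * ((z.1 p : ℝ) * v p - (z.1 p : ℝ) * ((s p : ℕ) : ℝ)) - 2 * ε * vmin * z.1 p +
        (2 * H + (1 + 2 * H) ^ 2) + (2 * corrQueue h z p) * noise P h z.2 x p := by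
      intro p
      rw [hc.corrQueue_next, add_assoc]
      set δ := ((1 - ε) * v p - ((s p : ℕ) : ℝ) + idle f z s p) + noise P h z.2 x p with hδ
      have h3 : δ ^ 2 ≤ (1 + 2 * H) ^ 2 :=
        sq_le_sq' (abs_le.1 (hc.abs_increment_le z s x p)).1
          (abs_le.1 (hc.abs_increment_le z s x p)).2
      have h4 : h p (z.2 p) * ((1 - ε) * v p - ((s p : ℕ) : ℝ) + idle f z s p) ≤ H := by
        refine (le_abs_self _).trans ?_
        rw [abs_mul, ← mul_one H]
        exact mul_le_mul (hc.bound _ _) (hc.abs_drift_le z s p) (abs_nonneg _)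
          ((abs_nonneg _).trans (hc.bound p (z.2 p)))
      have h5 := idle_mul_queue f z s p
      have h6 : ε * vmin * z.1 p ≤ ε * ((z.1 p : ℝ) * v p) := by
        have := mul_le_mul_of_nonneg_left (hvm p)
          (mul_nonneg hc.eps.1.le (Nat.cast_nonneg (α := ℝ) (z.1 p)))
        linarith
      have h7 : (corrQueue h z p + δ) ^ 2 = corrQueue h z p ^ 2 +
          2 * ((z.1 p : ℝ) * v p - (z.1 p : ℝ) * ((s p : ℕ) : ℝ)) -
          2 * (ε * ((z.1 p : ℝ) * v p)) + 2 * ((z.1 p : ℝ) * idle f z s p) +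
          2 * (h p (z.2 p) * ((1 - ε) * v p - ((s p : ℕ) : ℝ) + idle f z s p)) + δ ^ 2 +
          (2 * corrQueue h z p) * noise P h z.2 x p := by
        simp only [hδ, corrQueue]; ring
      rw [h7, h5]
      linarith
    refine (Finset.sum_le_sum fun p _ => h2 p).trans ?_
    have h8 : ∑ p : Fin N × Fin N, (2 * H + (1 + 2 * H) ^ 2) =
        (N : ℝ) ^ 2 * (2 * H + (1 + 2 * H) ^ 2) := by
      rw [Finset.sum_const, Finset.card_univ, Fintype.card_prod, Fintype.card_fin, nsmul_eq_mul,
        Nat.cast_mul, sq (N : ℝ)]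
    simp only [Finset.sum_add_distrib, Finset.sum_sub_distrib, ← Finset.mul_sum] at h8 ⊢
    linarith
  have h1 := slotMean_mono P z hpt
  rw [slotMean_add, slotMean_const, slotMean_noise] at h1
  linarith

end IsCorrector

end Corrected

/-! ### State space collapse -/

/-- The cubic term wins: for large `d` the drift of the fourth power of a distance `d` is negative
even after `d ^ 2` has been added. -/
theorem exists_cubic_drift_bound {m : ℝ} (hm : 0 < m) (b₁ a b : ℝ) :
    ∃ B, 0 ≤ B ∧ ∀ d, 0 ≤ d →
      2 * d ^ 2 * (-m * d + b₁) + (a * d + b) ^ 2 + d ^ 2 ≤ B := by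
  set A := 2 * |b₁| + 2 * a ^ 2 + 1 with hA
  have hA0 : 0 ≤ A := by positivity
  refine ⟨A * (A / (2 * m)) ^ 2 + 2 * b ^ 2, by positivity, fun d hd => ?_⟩
  have h1 : (a * d + b) ^ 2 ≤ 2 * a ^ 2 * d ^ 2 + 2 * b ^ 2 := by nlinarith [sq_nonneg (a * d - b)]
  have h2 : d ^ 2 * b₁ ≤ d ^ 2 * |b₁| := mul_le_mul_of_nonneg_left (le_abs_self _) (sq_nonneg _)
  have h3 : A * d ^ 2 - 2 * m * d * d ^ 2 ≤ A * (A / (2 * m)) ^ 2 := by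
    rcases le_total (2 * m * d) A with h | h
    · have h4 : d ≤ A / (2 * m) := by rw [le_div_iff₀ (by positivity)]; linarith
      have h5 : d ^ 2 ≤ (A / (2 * m)) ^ 2 := pow_le_pow_left₀ hd h4 2
      have h6 : 0 ≤ 2 * m * d * d ^ 2 := by positivity
      nlinarith [mul_le_mul_of_nonneg_left h5 hA0]
    · have h4 : A * d ^ 2 ≤ 2 * m * d * d ^ 2 := mul_le_mul_of_nonneg_right h (sq_nonneg d)
      have h5 : 0 ≤ A * (A / (2 * m)) ^ 2 := by positivity
      linarith
  simp only [hA] at h3 ⊢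
  nlinarith

namespace IsCorrector

variable {N : ℕ} {Ω : Type*} [Fintype Ω] {f : Ω → ℕ} {P : Fin N × Fin N → Ω → PMF Ω}
  {v : Fin N × Fin N → ℝ} {ε H : ℝ} {h : Fin N × Fin N → Ω → ℝ}

/-- In heavy traffic the mean increment of the queues has a negative component, bounded away from
`0`, in the direction away from the cone. Unused service does no harm here, because the members of
the cone are nonnegative. -/
theorem sum_polarPart_mul_drift_le (hc : IsCorrector f P v ε H h) {vmin : ℝ} (hv0 : 0 ≤ vmin)
    (hv1 : vmin ≤ 1) (hvm : ∀ p, vmin ≤ v p) (hε : ε * (N : ℝ) ^ 2 ≤ vmin / 2)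
    (z : SwitchState N Ω) {s : Fin N × Fin N → Fin 2} (hs : s ∈ maxWeightSchedules z.1) :
    ∑ p, polarPart (corrQueue h z) p * ((1 - ε) * v p - ((s p : ℕ) : ℝ) + idle f z s p) ≤
      -(vmin / 2) * √(coneDistSq (corrQueue h z)) + 3 * ((N : ℝ) ^ 2 * H) := by
  set w := corrQueue h z with hw
  set d := √(coneDistSq w) with hd
  have hd0 : 0 ≤ d := Real.sqrt_nonneg _
  have hdd : d * d = coneDistSq w := Real.mul_self_sqrt (coneDistSq_nonneg w)
  have hNH : 0 ≤ (N : ℝ) ^ 2 * H := by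
    simpa using sum_ports_le (g := fun _ : Fin N × Fin N => (0 : ℝ)) fun p =>
      (abs_nonneg _).trans (hc.bound p (z.2 p))
  have hA : ∑ p, polarPart w p * idle f z s p ≤ (N : ℝ) ^ 2 * H := by
    refine sum_ports_le fun p => le_trans ?_ (hc.corrQueue_mul_idle_le z s p)
    refine mul_le_mul_of_nonneg_right ?_ (idle_nonneg f z s p)
    have := (conePart_mem w).1 p
    rw [polarPart]; linarith
  have hB : ∑ p, polarPart w p * (v p - ((s p : ℕ) : ℝ)) =
      ∑ p, w p * (v p - ((s p : ℕ) : ℝ)) := by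
    have h1 := sum_portCone_mul_eq_zero (conePart_mem w) (m := fun p => v p - ((s p : ℕ) : ℝ))
      (fun i => by rw [Finset.sum_sub_distrib, hc.face.2.1, sum_row_of_mem_maxWeight hs, sub_self])
      (fun j => by rw [Finset.sum_sub_distrib, hc.face.2.2, sum_col_of_mem_maxWeight hs, sub_self])
    simp only [polarPart, sub_mul, Finset.sum_sub_distrib, h1, sub_zero]
  have hC : ∑ p, w p * (v p - ((s p : ℕ) : ℝ)) ≤
      ∑ p, (z.1 p : ℝ) * (v p - ((s p : ℕ) : ℝ)) + (N : ℝ) ^ 2 * H := by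
    have h1 : ∑ p, h p (z.2 p) * (v p - ((s p : ℕ) : ℝ)) ≤ (N : ℝ) ^ 2 * H := by
      refine sum_ports_le fun p => (le_abs_self _).trans ?_
      rw [abs_mul, ← mul_one H]
      refine mul_le_mul (hc.bound _ _) ?_ (abs_nonneg _)
        ((abs_nonneg _).trans (hc.bound p (z.2 p)))
      have h2 := hc.face.1 p
      have h3 := face_le_one hc.face p
      have h4 := slot_le_one s p
      have h5 : (0 : ℝ) ≤ ((s p : ℕ) : ℝ) := Nat.cast_nonneg _
      rw [abs_le]; constructor <;> linarith
    simp only [hw, corrQueue, add_mul, Finset.sum_add_distrib]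
    linarith
  have hcd : vmin / d * d ≤ vmin := by
    rcases eq_or_ne d 0 with h0 | h0
    · simp [h0, hv0]
    · rw [div_mul_cancel₀ _ h0]
  have hc0 : 0 ≤ vmin / d := div_nonneg hv0 hd0
  have hD := sum_mul_add_polarPart_le hs hc.face hvm w hc0 hcd
  have hE : ∑ p, (z.1 p : ℝ) * polarPart w p = d * d - ∑ p, polarPart w p * h p (z.2 p) := by
    rw [hdd, ← sum_mul_polarPart, ← Finset.sum_sub_distrib]
    refine Finset.sum_congr rfl fun p _ => ?_
    simp only [hw, corrQueue]; ring
  have hE' := (abs_le.1 (abs_sum_polarPart_mul_le (w := w) fun p => hc.bound p (z.2 p))).2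
  have hF : vmin * d - (N : ℝ) ^ 2 * H ≤ vmin / d * ∑ p, (z.1 p : ℝ) * polarPart w p := by
    rw [hE]
    rcases eq_or_ne d 0 with h0 | h0
    · simp [h0, hNH]
    · have h1 : vmin / d * (d * d - (N : ℝ) ^ 2 * (d * H)) =
          vmin * d - vmin * ((N : ℝ) ^ 2 * H) := by
        field_simp
      have h2 := mul_le_mul_of_nonneg_left
        (sub_le_sub_left hE' (d * d)) hc0
      rw [h1] at h2
      nlinarith
  have hG : -(∑ p, polarPart w p * v p) * ε ≤ vmin / 2 * d := by
    have h1 := (abs_le.1 (abs_sum_polarPart_mul_le (w := w) (g := v) (B := 1) fun p => by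
      rw [abs_of_nonneg (hc.face.1 p)]; exact face_le_one hc.face p)).1
    rw [mul_one] at h1
    have h2 := mul_le_mul_of_nonneg_right (neg_le.1 h1) hc.eps.1.le
    have h3 := mul_le_mul_of_nonneg_right hε hd0
    linarith
  have hsplit : ∑ p, polarPart w p * ((1 - ε) * v p - ((s p : ℕ) : ℝ) + idle f z s p) =
      ∑ p, polarPart w p * (v p - ((s p : ℕ) : ℝ)) + -(∑ p, polarPart w p * v p) * ε +
        ∑ p, polarPart w p * idle f z s p := by
    rw [← Finset.sum_neg_distrib, Finset.sum_mul, ← Finset.sum_add_distrib,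
      ← Finset.sum_add_distrib]
    exact Finset.sum_congr rfl fun p _ => by ring
  have hD' : ∑ p, (z.1 p : ℝ) * (v p - ((s p : ℕ) : ℝ)) ≤
      -(vmin / d * ∑ p, (z.1 p : ℝ) * polarPart w p) := by
    have : ∑ p, (z.1 p : ℝ) * (v p + vmin / d * polarPart w p) =
        ∑ p, (z.1 p : ℝ) * v p + vmin / d * ∑ p, (z.1 p : ℝ) * polarPart w p := by
      rw [Finset.mul_sum, ← Finset.sum_add_distrib]
      exact Finset.sum_congr rfl fun p _ => by ring
    simp only [mul_sub, Finset.sum_sub_distrib]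
    linarith
  rw [hsplit]
  linarith

/-- The drift of the fourth power of the distance to the cone. It bounds the second moment of the
distance, uniformly in heavy traffic. -/
theorem drift_coneDistSq_sq (hc : IsCorrector f P v ε H h) {vmin B : ℝ} (hv0 : 0 ≤ vmin)
    (hv1 : vmin ≤ 1) (hvm : ∀ p, vmin ≤ v p) (hε : ε * (N : ℝ) ^ 2 ≤ vmin / 2)
    (hB : ∀ d, 0 ≤ d → 2 * d ^ 2 * (-vmin * d +
        (6 * ((N : ℝ) ^ 2 * H) + (N : ℝ) ^ 2 * (1 + 2 * H) ^ 2)) +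
      (2 * (N : ℝ) ^ 2 * (1 + 2 * H) * d + (N : ℝ) ^ 2 * (1 + 2 * H) ^ 2) ^ 2 + d ^ 2 ≤ B)
    (z : SwitchState N Ω) :
    slotMean P z (fun s x => coneDistSq (corrQueue h (nextState f z s x)) ^ 2) +
        coneDistSq (corrQueue h z) ≤ coneDistSq (corrQueue h z) ^ 2 + B := by
  set w := corrQueue h z with hw
  set W := coneDistSq w with hW
  set d := √W with hd
  have hd0 : 0 ≤ d := Real.sqrt_nonneg _
  have hW0 : 0 ≤ W := coneDistSq_nonneg w
  have hdd : d ^ 2 = W := Real.sq_sqrt hW0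
  set D := 1 + 2 * H with hDdef
  have hpt : ∀ s ∈ maxWeightSchedules z.1, ∀ x,
      coneDistSq (corrQueue h (nextState f z s x)) ^ 2 ≤
        (W ^ 2 - W + B) + ∑ p, (4 * W * polarPart w p) * noise P h z.2 x p := by
    intro s hs x
    set δ : Fin N × Fin N → ℝ := fun p =>
      ((1 - ε) * v p - ((s p : ℕ) : ℝ) + idle f z s p) + noise P h z.2 x p with hδ
    have hδD : ∀ p, |δ p| ≤ D := fun p => hc.abs_increment_le z s x p
    set G := 2 * ∑ p, polarPart w p * δ p + ∑ p, δ p ^ 2 with hG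
    have h1 : coneDistSq (corrQueue h (nextState f z s x)) ≤ W + G := by
      refine (coneDistSq_le _ (conePart_mem w)).trans (le_of_eq ?_)
      rw [hG, hW, coneDistSq, Finset.mul_sum, ← Finset.sum_add_distrib, ← Finset.sum_add_distrib]
      refine Finset.sum_congr rfl fun p _ => ?_
      rw [hc.corrQueue_next, polarPart]
      simp only [hδ]; ring
    have h2 : ∑ p, δ p ^ 2 ≤ (N : ℝ) ^ 2 * D ^ 2 := sum_ports_le fun p =>
      sq_le_sq' (abs_le.1 (hδD p)).1 (abs_le.1 (hδD p)).2
    have h3 := abs_le.1 (abs_sum_polarPart_mul_le (w := w) hδD)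
    have h4 : 0 ≤ ∑ p, δ p ^ 2 := Finset.sum_nonneg fun p _ => sq_nonneg _
    have h5 : G ^ 2 ≤ (2 * (N : ℝ) ^ 2 * D * d + (N : ℝ) ^ 2 * D ^ 2) ^ 2 := by
      refine sq_le_sq' ?_ ?_ <;> rw [hG] <;> linarith [h3.1, h3.2]
    have h6 := hc.sum_polarPart_mul_drift_le hv0 hv1 hvm hε z hs
    have h7 : ∑ p, polarPart w p * δ p =
        ∑ p, polarPart w p * ((1 - ε) * v p - ((s p : ℕ) : ℝ) + idle f z s p) +
          ∑ p, polarPart w p * noise P h z.2 x p := by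
      rw [← Finset.sum_add_distrib]
      exact Finset.sum_congr rfl fun p _ => by simp only [hδ]; ring
    have h8 : G ≤ -vmin * d + (6 * ((N : ℝ) ^ 2 * H) + (N : ℝ) ^ 2 * D ^ 2) +
        2 * ∑ p, polarPart w p * noise P h z.2 x p := by
      rw [hG, h7]; linarith
    have h9 : ∑ p, (4 * W * polarPart w p) * noise P h z.2 x p =
        2 * W * (2 * ∑ p, polarPart w p * noise P h z.2 x p) := by
      simp only [Finset.mul_sum]
      exact Finset.sum_congr rfl fun p _ => by ring
    have h10 := pow_le_pow_left₀ (coneDistSq_nonneg _) h1 2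
    have h11 := mul_le_mul_of_nonneg_left h8 (mul_nonneg zero_le_two hW0)
    have h12 := hB d hd0
    rw [hdd] at h12
    have h13 : (W + G) ^ 2 = W ^ 2 + 2 * W * G + G ^ 2 := by ring
    rw [h9]
    linarith
  have h1 := slotMean_mono P z hpt
  rw [slotMean_add, slotMean_const, slotMean_noise] at h1
  linarith

end IsCorrector

/-! ### The quadratic form of the port sums -/

section PortForm

variable {N : ℕ}

/-- `N` times the squared length of the orthogonal projection of `w` onto the span of the cone of
port weights. -/
noncomputable def portForm (w : Fin N × Fin N → ℝ) : ℝ :=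
  ∑ i, (∑ j, w (i, j)) ^ 2 + ∑ j, (∑ i, w (i, j)) ^ 2 - (∑ p, w p) ^ 2 / N

/-- `N` times the orthogonal projection of `w` onto the span of the cone of port weights. -/
noncomputable def portProj (w : Fin N × Fin N → ℝ) (p : Fin N × Fin N) : ℝ :=
  ∑ j, w (p.1, j) + ∑ i, w (i, p.2) - (∑ q, w q) / N

theorem sum_portProj_mul (w u : Fin N × Fin N → ℝ) :
    ∑ p, portProj w p * u p = ∑ i, (∑ j, w (i, j)) * ∑ j, u (i, j) +
      ∑ j, (∑ i, w (i, j)) * ∑ i, u (i, j) - (∑ p, w p) * (∑ p, u p) / N := by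
  have h1 : ∑ p : Fin N × Fin N, (∑ j, w (p.1, j)) * u p =
      ∑ i, (∑ j, w (i, j)) * ∑ j, u (i, j) := by
    rw [Fintype.sum_prod_type]; simp only [Finset.mul_sum]
  have h2 : ∑ p : Fin N × Fin N, (∑ i, w (i, p.2)) * u p =
      ∑ j, (∑ i, w (i, j)) * ∑ i, u (i, j) := by
    rw [Fintype.sum_prod_type_right]; simp only [Finset.mul_sum]
  rw [← h1, ← h2, mul_div_right_comm, Finset.mul_sum, ← Finset.sum_add_distrib,
    ← Finset.sum_sub_distrib]
  exact Finset.sum_congr rfl fun p _ => by rw [portProj]; ring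

theorem portForm_eq (w : Fin N × Fin N → ℝ) : portForm w = ∑ p, portProj w p * w p := by
  rw [sum_portProj_mul, portForm]; simp only [sq]

theorem portForm_add (w u : Fin N × Fin N → ℝ) :
    portForm (fun p => w p + u p) = portForm w + 2 * ∑ p, portProj w p * u p + portForm u := by
  simp only [sum_portProj_mul, portForm, Finset.sum_add_distrib, add_sq, mul_assoc,
    ← Finset.mul_sum]
  ring

theorem portProj_add (w u : Fin N × Fin N → ℝ) (p : Fin N × Fin N) :
    portProj (fun p => w p + u p) p = portProj w p + portProj u p := by
  simp only [portProj, Finset.sum_add_distrib]; ring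

theorem abs_portProj_le {w : Fin N × Fin N → ℝ} {B : ℝ} (hw : ∀ p, |w p| ≤ B)
    (p : Fin N × Fin N) : |portProj w p| ≤ 3 * N * B := by
  have hN : (0 : ℝ) < N := by exact_mod_cast (Nat.zero_le _).trans_lt p.1.2
  have h1 : |∑ j, w (p.1, j)| ≤ N * B := by
    refine (Finset.abs_sum_le_sum_abs _ _).trans ?_
    refine (Finset.sum_le_card_nsmul _ _ B fun j _ => hw _).trans (by simp)
  have h2 : |∑ i, w (i, p.2)| ≤ N * B := by
    refine (Finset.abs_sum_le_sum_abs _ _).trans ?_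
    refine (Finset.sum_le_card_nsmul _ _ B fun j _ => hw _).trans (by simp)
  have h3 : |(∑ q, w q) / N| ≤ N * B := by
    rw [abs_div, abs_of_pos hN, div_le_iff₀ hN]
    refine (Finset.abs_sum_le_sum_abs _ _).trans ((sum_ports_le fun q => hw q).trans ?_)
    exact le_of_eq (by ring)
  rw [abs_le] at *
  rw [portProj]
  constructor <;> linarith [h1.1, h1.2, h2.1, h2.2, h3.1, h3.2]

theorem portProj_of_mem_portCone {k : Fin N × Fin N → ℝ} (hk : k ∈ portCone N)
    (p : Fin N × Fin N) : portProj k p = N * k p := by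
  have hN : (N : ℝ) ≠ 0 := by exact_mod_cast ((Nat.zero_le _).trans_lt p.1.2).ne'
  have h := portCone_eq_sums hk p.1 p.2
  rw [portProj]
  field_simp
  linear_combination -h

/-- Near the cone, the projection onto its span is close to the identity. Since `portProj` and
`N * ·` agree on the cone, only the polar part contributes. -/
theorem abs_portProj_sub_le (w : Fin N × Fin N → ℝ) (p : Fin N × Fin N) :
    |portProj w p - N * w p| ≤ 4 * N * √(coneDistSq w) := by
  have h1 : portProj w p = N * conePart w p + portProj (polarPart w) p := by
    rw [← portProj_of_mem_portCone (conePart_mem w), ← portProj_add]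
    congr 1
    funext p
    simp [polarPart]
  have h2 : portProj w p - N * w p = portProj (polarPart w) p - N * polarPart w p := by
    rw [h1, polarPart]; ring
  rw [h2]
  have h3 := abs_portProj_le (abs_polarPart_le w) p
  have h4 : |(N : ℝ) * polarPart w p| ≤ N * √(coneDistSq w) := by
    rw [abs_mul, Nat.abs_cast]
    exact mul_le_mul_of_nonneg_left (abs_polarPart_le w p) (Nat.cast_nonneg _)
  linarith [abs_sub (portProj (polarPart w) p) (N * polarPart w p)]

theorem abs_portForm_le {u : Fin N × Fin N → ℝ} (h0 : ∀ p, 0 ≤ u p) (h1 : ∀ p, u p ≤ 1) :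
    |portForm u| ≤ 3 * N * ∑ p, u p := by
  rw [portForm_eq, Finset.mul_sum]
  refine (Finset.abs_sum_le_sum_abs _ _).trans (Finset.sum_le_sum fun p _ => ?_)
  have := abs_portProj_le (B := 1) (fun p => by rw [abs_of_nonneg (h0 p)]; exact h1 p) p
  rw [abs_mul, abs_of_nonneg (h0 p), mul_one] at *
  exact mul_le_mul_of_nonneg_right this (h0 p)

/-- The increments of the quadratic form grow at most linearly, so that they are integrable as soon
as the queue lengths are. -/
theorem abs_portForm_increment_le {w δ : Fin N × Fin N → ℝ} {D : ℝ} (hδ : ∀ p, |δ p| ≤ D) :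
    |portForm (fun p => w p + δ p) - portForm w| ≤
      (N : ℝ) ^ 2 * (6 * N * (∑ p, |w p|) * D + 3 * N * D * D) := by
  have h1 : portForm (fun p => w p + δ p) - portForm w =
      ∑ p, (2 * portProj w p + portProj δ p) * δ p := by
    rw [portForm_add, portForm_eq δ]
    simp only [add_mul, Finset.sum_add_distrib, mul_assoc, ← Finset.mul_sum]
    ring
  rw [h1]
  refine (Finset.abs_sum_le_sum_abs _ _).trans (sum_ports_le fun p => ?_)
  have h2 := abs_portProj_le (w := w) (fun q =>
    Finset.single_le_sum (f := fun q => |w q|) (fun _ _ => abs_nonneg _) (Finset.mem_univ q)) p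
  have h3 := abs_portProj_le hδ p
  have h4 : |2 * portProj w p + portProj δ p| ≤ 6 * N * (∑ p, |w p|) + 3 * N * D := by
    refine (abs_add_le _ _).trans ?_
    rw [abs_mul, abs_two]
    linarith
  rw [abs_mul]
  have h5 := mul_le_mul h4 (hδ p) (abs_nonneg _) ((abs_nonneg _).trans h4)
  linarith

end PortForm

/-! ### Exact drifts -/

/-- The contribution of unused service to the drift of the quadratic form of the port sums. -/
noncomputable def idleTerm {N : ℕ} {Ω : Type*} (f : Ω → ℕ)
    (h : Fin N × Fin N → Ω → ℝ) (z : SwitchState N Ω)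
    (s : Fin N × Fin N → Fin 2) (x : Fin N × Fin N → Ω) : ℝ :=
  2 * ∑ p, portProj (corrQueue h (nextState f z s x)) p * idle f z s p - portForm (idle f z s)

namespace IsCorrector

variable {N : ℕ} {Ω : Type*} [Fintype Ω] {f : Ω → ℕ} {P : Fin N × Fin N → Ω → PMF Ω}
  {v : Fin N × Fin N → ℝ} {ε H : ℝ} {h : Fin N × Fin N → Ω → ℝ}

/-- The drift of the total corrected queue length: the capacity exceeds the load by `N ε`. -/
theorem drift_total (hc : IsCorrector f P v ε H h) (z : SwitchState N Ω) :
    slotMean P z (fun s x => ∑ p, corrQueue h (nextState f z s x) p - ∑ p, corrQueue h z p) =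
      -(N * ε) + slotMean P z (fun s _ => ∑ p, idle f z s p) := by
  have hpt : ∀ s ∈ maxWeightSchedules z.1, ∀ x,
      ∑ p, corrQueue h (nextState f z s x) p - ∑ p, corrQueue h z p =
        (-(N * ε) + ∑ p, 1 * noise P h z.2 x p) + ∑ p, idle f z s p := by
    intro s hs x
    have h1 : ∑ p, ((s p : ℕ) : ℝ) = N := by
      rw [Fintype.sum_prod_type]; simp [sum_row_of_mem_maxWeight hs]
    have h2 : ∑ p, v p = N := by
      rw [Fintype.sum_prod_type]; simp [hc.face.2.1]
    simp only [hc.corrQueue_next, one_mul, Finset.sum_add_distrib, Finset.sum_sub_distrib,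
      ← Finset.mul_sum, h1, h2]
    ring
  rw [slotMean_congr P z hpt, slotMean_add, slotMean_add, slotMean_const, slotMean_noise, add_zero]

/-- Each queue enters one row sum, one column sum and the total, whence the factor
`1 + 1 - 1 / N`. -/
theorem slotMean_portForm_noise (z : SwitchState N Ω) :
    slotMean P z (fun _ x => portForm (noise P h z.2 x)) =
      (2 - 1 / (N : ℝ)) * ∑ p, stepVar (P p) (h p) (z.2 p) := by
  have hrow : ∀ i x, ∑ j, noise P h z.2 x (i, j) =
      ∑ p : Fin N × Fin N, (if p.1 = i then 1 else 0) * noise P h z.2 x p := by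
    intro i x
    symm
    rw [Fintype.sum_prod_type, Finset.sum_eq_single i (fun a _ ha => by simp [ha]) (by simp)]
    simp
  have hcol : ∀ j x, ∑ i, noise P h z.2 x (i, j) =
      ∑ p : Fin N × Fin N, (if p.2 = j then 1 else 0) * noise P h z.2 x p := by
    intro j x
    symm
    rw [Fintype.sum_prod_type_right, Finset.sum_eq_single j (fun a _ ha => by simp [ha]) (by simp)]
    simp
  have htot : ∀ x, ∑ p, noise P h z.2 x p = ∑ p, 1 * noise P h z.2 x p := by simp
  simp only [portForm, hrow, hcol, htot, div_eq_inv_mul]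
  rw [slotMean_sub, slotMean_add, slotMean_finset_sum, slotMean_finset_sum, slotMean_const_mul,
    slotMean_noise_sq]
  simp only [slotMean_noise_sq]
  have h1 : ∑ i, ∑ p : Fin N × Fin N, (if p.1 = i then (1 : ℝ) else 0) ^ 2 *
      stepVar (P p) (h p) (z.2 p) = ∑ p, stepVar (P p) (h p) (z.2 p) := by
    rw [Finset.sum_comm]; simp
  have h2 : ∑ j, ∑ p : Fin N × Fin N, (if p.2 = j then (1 : ℝ) else 0) ^ 2 *
      stepVar (P p) (h p) (z.2 p) = ∑ p, stepVar (P p) (h p) (z.2 p) := by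
    rw [Finset.sum_comm]; simp
  rw [h1, h2]
  simp only [one_pow, one_mul]
  ring

/-- The drift of the quadratic form of the port sums. The service given to a port is always `1`, so
the choice of the schedule enters through the unused service only. -/
theorem drift_portForm (hc : IsCorrector f P v ε H h) (hN : 1 ≤ N) (z : SwitchState N Ω) :
    slotMean P z (fun s x =>
        portForm (corrQueue h (nextState f z s x)) - portForm (corrQueue h z)) =
      -(2 * ε) * ∑ p, corrQueue h z p + N * ε ^ 2 +
        (2 - 1 / (N : ℝ)) * ∑ p, stepVar (P p) (h p) (z.2 p) +
        slotMean P z (idleTerm f h z) := by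
  have hN' : (N : ℝ) ≠ 0 := by positivity
  set w := corrQueue h z with hw
  have hpt : ∀ s ∈ maxWeightSchedules z.1, ∀ x,
      portForm (corrQueue h (nextState f z s x)) - portForm w =
        (-(2 * ε) * ∑ p, w p + N * ε ^ 2 +
          ∑ p, (2 * (portProj w p - ε)) * noise P h z.2 x p + portForm (noise P h z.2 x)) +
        idleTerm f h z s x := by
    intro s hs x
    set m : Fin N × Fin N → ℝ := fun p => (1 - ε) * v p - ((s p : ℕ) : ℝ) with hm
    set ξ := noise P h z.2 x with hξ
    set u := idle f z s with hu
    have hrow : ∀ i, ∑ j, m (i, j) = -ε := fun i => by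
      simp only [hm, Finset.sum_sub_distrib, ← Finset.mul_sum, hc.face.2.1,
        sum_row_of_mem_maxWeight hs]; ring
    have hcol : ∀ j, ∑ i, m (i, j) = -ε := fun j => by
      simp only [hm, Finset.sum_sub_distrib, ← Finset.mul_sum, hc.face.2.2,
        sum_col_of_mem_maxWeight hs]; ring
    have htot : ∑ p, m p = -(N * ε) := by
      rw [Fintype.sum_prod_type]; simp [hrow]
    have hmp : ∀ p, portProj m p = -ε := fun p => by
      rw [portProj, hrow, hcol, htot]; field_simp; ring
    have hwm : ∑ p, portProj w p * m p = -ε * ∑ p, w p := by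
      rw [sum_portProj_mul]
      simp only [hrow, hcol, htot, ← Finset.sum_mul]
      rw [← Fintype.sum_prod_type, ← Fintype.sum_prod_type_right]
      field_simp; ring
    have hmm : portForm m = N * ε ^ 2 := by
      rw [portForm_eq]; simp only [hmp, ← Finset.mul_sum, htot]; ring
    have hnext : corrQueue h (nextState f z s x) = fun p => ((w p + m p) + ξ p) + u p := by
      funext p
      rw [hc.corrQueue_next]
      simp only [hm]
      ring
    have h1 : ∑ p, portProj (fun p => w p + m p) p * ξ p = ∑ p, (portProj w p - ε) * ξ p :=
      Finset.sum_congr rfl fun p _ => by rw [portProj_add, hmp]; ring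
    have h2 : ∑ p, (2 * (portProj w p - ε)) * ξ p = 2 * ∑ p, (portProj w p - ε) * ξ p := by
      rw [Finset.mul_sum]; exact Finset.sum_congr rfl fun p _ => by ring
    have h3 : ∑ p, portProj (fun p => ((w p + m p) + ξ p) + u p) p * u p =
        ∑ p, portProj (fun p => (w p + m p) + ξ p) p * u p + portForm u := by
      rw [portForm_eq, ← Finset.sum_add_distrib]
      exact Finset.sum_congr rfl fun p _ => by rw [portProj_add]; ring
    rw [idleTerm, hnext, ← hu, h3, portForm_add, portForm_add (fun p => w p + m p), portForm_add w,
      h1, h2, hwm, hmm]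
    ring
  rw [slotMean_congr P z hpt, slotMean_add]
  congr 1
  rw [slotMean_add, slotMean_add, slotMean_const, slotMean_noise, slotMean_portForm_noise, add_zero]

/-- Unused service at `p` forces the queue at `p` to be empty. Near the cone the projection of the
queue vector is then small at `p`, too. -/
theorem abs_idleTerm_le (hc : IsCorrector f P v ε H h) {θ : ℝ} (hθ : 0 < θ)
    (z : SwitchState N Ω) (s : Fin N × Fin N → Fin 2) (x : Fin N × Fin N → Ω) :
    |idleTerm f h z s x| ≤ (2 * N * H + 3 * N + 4 * N ^ 3 / θ) * ∑ p, idle f z s p +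
      4 * N * θ * coneDistSq (corrQueue h (nextState f z s x)) := by
  set w := corrQueue h (nextState f z s x) with hw
  set d := √(coneDistSq w) with hd
  set U := ∑ p, idle f z s p with hU
  have hU0 : 0 ≤ U := Finset.sum_nonneg fun p _ => idle_nonneg f z s p
  have hU1 : U ≤ (N : ℝ) ^ 2 := by
    simpa using sum_ports_le fun p => idle_le_one f z s p
  have hdd : d ^ 2 = coneDistSq w := Real.sq_sqrt (coneDistSq_nonneg w)
  have h1 : |∑ p, portProj w p * idle f z s p| ≤ (N * H + 4 * N * d) * U := by
    rw [hU, Finset.mul_sum]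
    refine (Finset.abs_sum_le_sum_abs _ _).trans (Finset.sum_le_sum fun p _ => ?_)
    have hi := idle_nonneg f z s p
    have h2 : N * w p * idle f z s p = N * (h p (x p) * idle f z s p) := by
      have h3 : w p * idle f z s p = h p (x p) * idle f z s p := by
        have h4 : w p = ((nextState f z s x).1 p : ℝ) + h p (x p) := rfl
        rw [h4, add_mul, idle_mul_nextQueue, zero_add]
      rw [mul_assoc, h3]
    have h3 : portProj w p * idle f z s p =
        N * (h p (x p) * idle f z s p) + (portProj w p - N * w p) * idle f z s p := by
      rw [← h2]; ring
    have h4 : |(N : ℝ) * (h p (x p) * idle f z s p)| ≤ N * H * idle f z s p := by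
      rw [abs_mul, abs_mul, Nat.abs_cast, abs_of_nonneg hi, mul_assoc]
      gcongr
      exact hc.bound p (x p)
    have h5 : |(portProj w p - N * w p) * idle f z s p| ≤ 4 * N * d * idle f z s p := by
      rw [abs_mul, abs_of_nonneg hi]
      exact mul_le_mul_of_nonneg_right (abs_portProj_sub_le w p) hi
    rw [h3]
    linarith [abs_add_le ((N : ℝ) * (h p (x p) * idle f z s p))
      ((portProj w p - N * w p) * idle f z s p)]
  have h2 : |portForm (idle f z s)| ≤ 3 * N * U :=
    abs_portForm_le (idle_nonneg f z s) (idle_le_one f z s)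
  -- the arithmetic-geometric mean inequality, with weight `θ`
  have h3 : d * U ≤ θ / 2 * d ^ 2 + N ^ 2 / (2 * θ) * U := by
    have h4 : 0 ≤ (θ * d - U) ^ 2 / (2 * θ) := by positivity
    have h5 : (θ * d - U) ^ 2 / (2 * θ) = θ / 2 * d ^ 2 - d * U + U * U / (2 * θ) := by
      field_simp; ring
    have h6 : U * U / (2 * θ) ≤ N ^ 2 * U / (2 * θ) := by gcongr
    have h7 : (N : ℝ) ^ 2 * U / (2 * θ) = N ^ 2 / (2 * θ) * U := by ring
    linarith
  have h4 : (N : ℝ) * (d * U) ≤ N * (θ / 2 * d ^ 2 + N ^ 2 / (2 * θ) * U) :=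
    mul_le_mul_of_nonneg_left h3 (Nat.cast_nonneg _)
  have h5 : (8 : ℝ) * (N * (N ^ 2 / (2 * θ) * U)) = 4 * N ^ 3 / θ * U := by
    field_simp; ring
  have h6 := abs_sub (2 * ∑ p, portProj w p * idle f z s p) (portForm (idle f z s))
  rw [abs_mul, abs_two] at h6
  rw [idleTerm, ← hdd]
  linarith

end IsCorrector

/-! ### Steady state of the switch -/

theorem toReal_meanTotalQueue {N : ℕ} {Ω : Type*} [Fintype Ω] (π : PMF (SwitchState N Ω)) :
    (meanTotalQueue π).toReal = pmfMean π fun z => ∑ p, (z.1 p : ℝ) := by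
  rw [meanTotalQueue, ENNReal.tsum_toReal_eq fun z =>
    ENNReal.mul_ne_top (π.apply_ne_top z) (ENNReal.natCast_ne_top _)]
  refine tsum_congr fun z => ?_
  rw [ENNReal.toReal_mul, ENNReal.toReal_natCast, Nat.cast_sum]

theorem summable_totalQueue {N : ℕ} {Ω : Type*} [Fintype Ω] {π : PMF (SwitchState N Ω)}
    (h : meanTotalQueue π ≠ ⊤) : Summable fun z => (π z).toReal * ∑ p, (z.1 p : ℝ) := by
  refine (ENNReal.summable_toReal h).congr fun z => ?_
  rw [ENNReal.toReal_mul, ENNReal.toReal_natCast, Nat.cast_sum]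

namespace IsCorrector

variable {N : ℕ} {Ω : Type*} [Fintype Ω] {f : Ω → ℕ} {P : Fin N × Fin N → Ω → PMF Ω}
  {v : Fin N × Fin N → ℝ} {ε H : ℝ} {h : Fin N × Fin N → Ω → ℝ}

/-- The switch has a steady state with a finite mean total queue length. -/
theorem exists_steadyState (hc : IsCorrector f P v ε H h) {vmin : ℝ} (hv0 : 0 < vmin)
    (hvm : ∀ p, vmin ≤ v p) {S : Set (SwitchState N Ω)} (hirr : IrreducibleOn (switchKernel f P) S)
    (hap : AperiodicOn (switchKernel f P) S) :
    ∃ π, IsSteadyState (switchKernel f P) S π ∧ meanTotalQueue π ≠ ⊤ := by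
  have ha : 0 < 2 * ε * vmin := mul_pos (mul_pos two_pos hc.eps.1) hv0
  set b := (2 * ε * vmin)⁻¹ * ((N : ℝ) ^ 2 * (2 * H + (1 + 2 * H) ^ 2))
  have hdrift := switch_drift (f := f) (P := P)
    (V := fun z => (2 * ε * vmin)⁻¹ * ∑ p, corrQueue h z p ^ 2)
    (g := fun z => ((∑ p, z.1 p : ℕ) : ℝ)) (b := b)
    (fun z => mul_nonneg (inv_nonneg.2 ha.le) (Finset.sum_nonneg fun p _ => sq_nonneg _))
    (fun z => Nat.cast_nonneg _) fun z => by
      have h1 := mul_le_mul_of_nonneg_left (hc.drift_sq hvm z) (inv_nonneg.2 ha.le)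
      rw [mul_add, inv_mul_cancel_left₀ ha.ne', mul_add] at h1
      rw [slotMean_const_mul, Nat.cast_sum]
      exact h1
  simp only [ENNReal.ofReal_natCast] at hdrift
  have hfin : ∀ M : ℕ, {z : SwitchState N Ω | ∑ p, z.1 p ≤ M}.Finite := fun M => by
    refine (((Set.finite_Iic fun _ : Fin N × Fin N => M)).prod
      (Set.finite_univ (α := Fin N × Fin N → Ω))).subset fun z hz => ⟨fun p => ?_, trivial⟩
    exact (Finset.single_le_sum (f := fun p => z.1 p) (fun _ _ => Nat.zero_le _)
      (Finset.mem_univ p)).trans hz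
  obtain ⟨π, hπ⟩ := exists_steadyState_of_drift hirr hap hdrift ENNReal.ofReal_ne_top
    (fun _ => ENNReal.ofReal_ne_top) hfin
  obtain ⟨a, ha⟩ := hirr.1
  exact ⟨π, hπ, ne_top_of_le_ne_top ENNReal.ofReal_ne_top
    (tsum_mul_le_of_drift hdrift ENNReal.ofReal_ne_top (fun z => ENNReal.natCast_ne_top _)
      (a := a) ENNReal.ofReal_ne_top (hπ.2.2 a ha))⟩

/-- State space collapse: in steady state, the second moment of the distance to the cone is bounded
uniformly in heavy traffic. -/
theorem tsum_coneDistSq_le (hc : IsCorrector f P v ε H h) {vmin B : ℝ} (hv0 : 0 ≤ vmin)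
    (hv1 : vmin ≤ 1) (hvm : ∀ p, vmin ≤ v p) (hε : ε * (N : ℝ) ^ 2 ≤ vmin / 2)
    (hB : ∀ d, 0 ≤ d → 2 * d ^ 2 * (-vmin * d +
        (6 * ((N : ℝ) ^ 2 * H) + (N : ℝ) ^ 2 * (1 + 2 * H) ^ 2)) +
      (2 * (N : ℝ) ^ 2 * (1 + 2 * H) * d + (N : ℝ) ^ 2 * (1 + 2 * H) ^ 2) ^ 2 + d ^ 2 ≤ B)
    {S : Set (SwitchState N Ω)} (hS : S.Nonempty) {π : PMF (SwitchState N Ω)}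
    (hπ : IsSteadyState (switchKernel f P) S π) :
    ∑' z, π z * ENNReal.ofReal (coneDistSq (corrQueue h z)) ≤ ENNReal.ofReal B := by
  obtain ⟨a, ha⟩ := hS
  exact tsum_mul_le_of_drift
    (switch_drift (V := fun z => coneDistSq (corrQueue h z) ^ 2) (fun z => sq_nonneg _)
      (fun z => coneDistSq_nonneg _) fun z => hc.drift_coneDistSq_sq hv0 hv1 hvm hε hB z)
    ENNReal.ofReal_ne_top (fun z => ENNReal.ofReal_ne_top) (a := a) ENNReal.ofReal_ne_top
    (hπ.2.2 a ha)

section Stationary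

variable {π : PMF (SwitchState N Ω)}

theorem abs_sum_corrQueue_sub_le (hc : IsCorrector f P v ε H h) (z : SwitchState N Ω) :
    |∑ p, corrQueue h z p - ∑ p, (z.1 p : ℝ)| ≤ (N : ℝ) ^ 2 * H := by
  rw [← Finset.sum_sub_distrib]
  refine (Finset.abs_sum_le_sum_abs _ _).trans (sum_ports_le fun p => ?_)
  rw [corrQueue, add_sub_cancel_left]
  exact hc.bound p _

theorem abs_slotMean_idle_le (z : SwitchState N Ω) :
    |slotMean P z (fun s _ => ∑ p, idle f z s p)| ≤ (N : ℝ) ^ 2 := by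
  refine (abs_slotMean_le P z (ψ := fun _ _ => (N : ℝ) ^ 2) fun s _ x => ?_).trans
    (slotMean_const P z _).le
  rw [abs_of_nonneg (Finset.sum_nonneg fun p _ => idle_nonneg f z s p)]
  simpa using sum_ports_le fun p => idle_le_one f z s p

/-- In steady state the mean unused service equals the excess capacity. -/
theorem pmfMean_idle (hc : IsCorrector f P v ε H h) (hπ : IsInvariantLaw (switchKernel f P) π) :
    pmfMean π (fun z => slotMean P z (fun s _ => ∑ p, idle f z s p)) = N * ε := by
  have h1 := pmfMean_drift_eq_zero hπ (F := fun z => ∑ p, corrQueue h z p)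
    (D := fun _ => (N : ℝ) ^ 2 * (1 + 2 * H)) (fun z y hy => by
      obtain ⟨s, -, x, rfl⟩ := exists_of_switchKernel_ne_zero hy
      rw [← Finset.sum_sub_distrib]
      refine (Finset.abs_sum_le_sum_abs _ _).trans (sum_ports_le fun p => ?_)
      rw [hc.corrQueue_next, add_assoc, add_sub_cancel_left]
      exact hc.abs_increment_le z s x p) (π.summable_toReal.mul_right _)
  have h2 : ∀ z, pmfMean (switchKernel f P z)
      (fun y => ∑ p, corrQueue h y p - ∑ p, corrQueue h z p) =
      -(N * ε) + slotMean P z (fun s _ => ∑ p, idle f z s p) := fun z => by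
    rw [pmfMean_switchKernel, hc.drift_total]
  simp only [h2] at h1
  rw [pmfMean_add (π.summable_toReal.mul_right _)
    (π.summable_mul_of_bounded abs_slotMean_idle_le), pmfMean_const] at h1
  linarith

theorem pmfMean_stepVar (hc : IsCorrector f P v ε H h) {ν : Fin N × Fin N → PMF Ω}
    (hν : ∀ p, π.map (fun z => z.2 p) = ν p) :
    (Summable fun z => (π z).toReal * ∑ p, stepVar (P p) (h p) (z.2 p)) ∧
      pmfMean π (fun z => ∑ p, stepVar (P p) (h p) (z.2 p)) =
        ∑ p, ∑ x, (ν p x).toReal * stepVar (P p) (h p) x := by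
  have hb : ∀ p x, |stepVar (P p) (h p) x| ≤ H ^ 2 := fun p x => by
    rw [abs_of_nonneg (stepVar_nonneg _ _ _), stepVar]
    have h1 := (le_abs_self _).trans (abs_stepMean_le (P p) (F := fun y => h p y ^ 2) (B := H ^ 2)
      (fun y => by rw [abs_pow]; exact pow_le_pow_left₀ (abs_nonneg _) (hc.bound p y) 2) x)
    linarith [sq_nonneg (stepMean (P p) (h p) x)]
  have hs : ∀ p, Summable fun z => (π z).toReal * stepVar (P p) (h p) (z.2 p) := fun p =>
    π.summable_mul_of_bounded fun z => hb p (z.2 p)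
  refine ⟨?_, ?_⟩
  · simp only [Finset.mul_sum]
    exact summable_sum fun p _ => hs p
  · rw [pmfMean_finset_sum _ fun p _ => hs p]
    refine Finset.sum_congr rfl fun p _ => ?_
    rw [← pmfMean_map (fun z : SwitchState N Ω => z.2 p) (hb p), hν p, pmfMean, tsum_fintype]

/-- The steady-state identity for the quadratic form of the port sums: the mean total queue length
at load `1 - ε`, up to an error that vanishes in heavy traffic. -/
theorem abs_stationary_sub_le (hc : IsCorrector f P v ε H h) (hN : 1 ≤ N)
    (hπ : IsInvariantLaw (switchKernel f P) π) {ν : Fin N × Fin N → PMF Ω}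
    (hν : ∀ p, π.map (fun z => z.2 p) = ν p) (hq : meanTotalQueue π ≠ ⊤) {M : ℝ} (hM0 : 0 ≤ M)
    (hM : ∑' z, π z * ENNReal.ofReal (coneDistSq (corrQueue h z)) ≤ ENNReal.ofReal M)
    {θ : ℝ} (hθ : 0 < θ) :
    |2 * (ε * (meanTotalQueue π).toReal) -
        (2 - 1 / (N : ℝ)) * ∑ p, ∑ x, (ν p x).toReal * stepVar (P p) (h p) x| ≤
      2 * ε * ((N : ℝ) ^ 2 * H) + N * ε ^ 2 +
        ((2 * N * H + 3 * N + 4 * N ^ 3 / θ) * (N * ε) + 4 * N * θ * M) := by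
  set Q : SwitchState N Ω → ℝ := fun z => ∑ p, (z.1 p : ℝ) with hQ
  set T : SwitchState N Ω → ℝ := fun z => ∑ p, corrQueue h z p with hT
  set Var : SwitchState N Ω → ℝ := fun z => ∑ p, stepVar (P p) (h p) (z.2 p) with hVar
  set r : SwitchState N Ω → ℝ := fun z => slotMean P z (idleTerm f h z) with hr
  set U : SwitchState N Ω → ℝ := fun z => slotMean P z (fun s _ => ∑ p, idle f z s p) with hU
  set W : SwitchState N Ω → ℝ := fun z =>
    slotMean P z (fun s x => coneDistSq (corrQueue h (nextState f z s x))) with hW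
  set c₁ := 2 * N * H + 3 * N + 4 * N ^ 3 / θ with hc₁
  have hQs : Summable fun z => (π z).toReal * Q z := summable_totalQueue hq
  have hTQ : ∀ z, |T z - Q z| ≤ (N : ℝ) ^ 2 * H := hc.abs_sum_corrQueue_sub_le
  have hTQs := π.summable_mul_of_bounded hTQ
  have hTs : Summable fun z => (π z).toReal * T z :=
    (hTQs.add hQs).congr fun z => by ring
  have hET : |pmfMean π T - pmfMean π Q| ≤ (N : ℝ) ^ 2 * H := by
    have h1 := pmfMean_add hTQs hQs
    simp only [sub_add_cancel] at h1
    have h2 : pmfMean π T - pmfMean π Q = pmfMean π fun z => T z - Q z := by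
      rw [show pmfMean π T = pmfMean π fun z => T z from rfl, h1]; ring
    rw [h2]
    exact abs_pmfMean_le π hTQ
  obtain ⟨hVs, hEV⟩ := hc.pmfMean_stepVar hν
  have hUs : Summable fun z => (π z).toReal * U z :=
    π.summable_mul_of_bounded abs_slotMean_idle_le
  have hEU : pmfMean π U = N * ε := hc.pmfMean_idle hπ
  -- by invariance, the distance to the cone has the same mean one time slot later
  have hWM : (Summable fun z => (π z).toReal * W z) ∧ pmfMean π W ≤ M := by
    refine summable_of_tsum_ofReal_le (fun z => ?_) hM0 (le_trans (le_of_eq ?_) hM)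
    · simp only [hW]
      rw [← pmfMean_switchKernel f P z fun y => coneDistSq (corrQueue h y)]
      exact pmfMean_nonneg _ fun y => coneDistSq_nonneg _
    · have h1 := tsum_bind_mul π (switchKernel f P)
        fun y => ENNReal.ofReal (coneDistSq (corrQueue h y))
      rw [hπ] at h1
      rw [h1]
      refine tsum_congr fun z => ?_
      rw [tsum_switchKernel_ofReal f P z fun y => coneDistSq_nonneg _]
  have hrb : ∀ z, |r z| ≤ c₁ * U z + 4 * N * θ * W z := by
    intro z
    have h1 := abs_slotMean_le P z fun s _ x => hc.abs_idleTerm_le hθ z s x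
    rwa [slotMean_add, slotMean_const_mul, slotMean_const_mul] at h1
  have hbs : Summable fun z => (π z).toReal * (c₁ * U z + 4 * N * θ * W z) :=
    ((hUs.mul_left c₁).add (hWM.1.mul_left (4 * N * θ))).congr fun z => by ring
  have hrs := summable_mul_of_abs_le hbs hrb
  have hEr : |pmfMean π r| ≤ c₁ * (N * ε) + 4 * N * θ * M := by
    refine (abs_pmfMean_le_pmfMean hbs hrb).trans ?_
    rw [pmfMean_add ((hUs.mul_left c₁).congr fun z => by ring)
      ((hWM.1.mul_left (4 * N * θ)).congr fun z => by ring), pmfMean_const_mul,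
      pmfMean_const_mul, hEU]
    have := mul_le_mul_of_nonneg_left hWM.2 (a := 4 * N * θ) (by positivity)
    linarith
  -- the exact balance of the quadratic form
  have hbal : 0 = -(2 * ε) * pmfMean π T + N * ε ^ 2 +
      (2 - 1 / (N : ℝ)) * pmfMean π Var + pmfMean π r := by
    have h1 := pmfMean_drift_eq_zero hπ (F := fun z => portForm (corrQueue h z))
      (D := fun z => (N : ℝ) ^ 2 * (6 * N * (Q z + (N : ℝ) ^ 2 * H) * (1 + 2 * H) +
        3 * N * (1 + 2 * H) * (1 + 2 * H))) (fun z y hy => by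
        obtain ⟨s, -, x, rfl⟩ := exists_of_switchKernel_ne_zero hy
        have hnext : corrQueue h (nextState f z s x) = fun p => corrQueue h z p +
            (((1 - ε) * v p - ((s p : ℕ) : ℝ) + idle f z s p) + noise P h z.2 x p) := by
          funext p; rw [hc.corrQueue_next, add_assoc]
        rw [hnext]
        refine (abs_portForm_increment_le fun p => hc.abs_increment_le z s x p).trans ?_
        have hD : 0 ≤ 1 + 2 * H := (abs_nonneg _).trans
          (hc.abs_increment_le z s x (⟨0, hN⟩, ⟨0, hN⟩))
        have hw : ∑ p, |corrQueue h z p| ≤ Q z + (N : ℝ) ^ 2 * H := by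
          have h2 : ∑ p, |corrQueue h z p| ≤ ∑ p, ((z.1 p : ℝ) + |h p (z.2 p)|) :=
            Finset.sum_le_sum fun p _ => (abs_add_le _ _).trans (by rw [Nat.abs_cast])
          have h3 : ∑ p, |h p (z.2 p)| ≤ (N : ℝ) ^ 2 * H := sum_ports_le fun p => hc.bound p _
          rw [Finset.sum_add_distrib] at h2
          linarith
        gcongr)
      (((hQs.mul_left ((N : ℝ) ^ 2 * (6 * N * (1 + 2 * H)))).add (π.summable_toReal.mul_right
        ((N : ℝ) ^ 2 * (6 * N * ((N : ℝ) ^ 2 * H) * (1 + 2 * H) +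
          3 * N * (1 + 2 * H) * (1 + 2 * H))))).congr fun z => by ring)
    have h2 : ∀ z, pmfMean (switchKernel f P z)
        (fun y => portForm (corrQueue h y) - portForm (corrQueue h z)) =
        ((-(2 * ε) * T z + N * ε ^ 2) + (2 - 1 / (N : ℝ)) * Var z) + r z := fun z => by
      rw [pmfMean_switchKernel, hc.drift_portForm hN]
    simp only [h2] at h1
    have hTs' : Summable fun z => (π z).toReal * (-(2 * ε) * T z) :=
      (hTs.mul_left (-(2 * ε))).congr fun z => by ring
    have hCs : Summable fun z => (π z).toReal * ((N : ℝ) * ε ^ 2) := π.summable_toReal.mul_right _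
    have hVs' : Summable fun z => (π z).toReal * ((2 - 1 / (N : ℝ)) * Var z) :=
      (hVs.mul_left (2 - 1 / (N : ℝ))).congr fun z => by ring
    have hTC : Summable fun z => (π z).toReal * (-(2 * ε) * T z + N * ε ^ 2) :=
      (hTs'.add hCs).congr fun z => by ring
    have hTCV : Summable fun z => (π z).toReal *
        ((-(2 * ε) * T z + N * ε ^ 2) + (2 - 1 / (N : ℝ)) * Var z) :=
      (hTC.add hVs').congr fun z => by ring
    rw [pmfMean_add hTCV hrs, pmfMean_add hTC hVs', pmfMean_add hTs' hCs, pmfMean_const,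
      pmfMean_const_mul (-(2 * ε)), pmfMean_const_mul (2 - 1 / (N : ℝ))] at h1
    exact h1.symm
  rw [toReal_meanTotalQueue, ← hEV]
  have h1 : 2 * (ε * pmfMean π Q) - (2 - 1 / (N : ℝ)) * pmfMean π Var =
      -(2 * ε) * (pmfMean π T - pmfMean π Q) + N * ε ^ 2 + pmfMean π r := by
    linear_combination hbal
  have h2 : |-(2 * ε) * (pmfMean π T - pmfMean π Q)| ≤ 2 * ε * ((N : ℝ) ^ 2 * H) := by
    rw [abs_mul, abs_neg, abs_of_nonneg (by linarith [hc.eps.1] : (0 : ℝ) ≤ 2 * ε)]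
    exact mul_le_mul_of_nonneg_left hET (by linarith [hc.eps.1])
  have h3 : |(N : ℝ) * ε ^ 2| = N * ε ^ 2 := abs_of_nonneg (by positivity)
  rw [h1]
  refine (abs_add_le _ _).trans (add_le_add ((abs_add_le _ _).trans ?_) hEr)
  rw [h3]
  linarith

end Stationary

end IsCorrector

/-! ### The heavy-traffic limit -/

theorem mainTheorem1 (N : ℕ) (hN : 1 ≤ N) {Ω : Type*} [Fintype Ω]
    -- the number of arrivals in a state of the modulating chain
    (f : Ω → ℕ)
    -- the transition kernels and stationary distributions of the modulating chains
    (P : ℝ → Fin N × Fin N → Ω → PMF Ω) (ν : ℝ → Fin N × Fin N → PMF Ω)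
    (hXirr : ∀ ε ∈ Set.Ioo (0 : ℝ) 1, IrreducibleOn (vectorKernel (P ε)) Set.univ)
    (hXaper : ∀ ε ∈ Set.Ioo (0 : ℝ) 1, AperiodicOn (vectorKernel (P ε)) Set.univ)
    (hν : ∀ ε ∈ Set.Ioo (0 : ℝ) 1, ∀ p, IsInvariantLaw (P ε p) (ν ε p))
    -- the arrival rates are `(1 - ε) v` with `v` on the face and positive
    (v : Fin N × Fin N → ℝ) (hv : v ∈ saturatedFace N) (hvpos : ∀ p, 0 < v p)
    (hrate : ∀ ε ∈ Set.Ioo (0 : ℝ) 1, ∀ p, meanOf (ν ε p) f = (1 - ε) * v p)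
    -- geometric mixing of the arrivals, with constants that are uniform in `ε`
    (α C : ℝ) (hα : α ∈ Set.Ioo (0 : ℝ) 1)
    (hmix : ∀ ε ∈ Set.Ioo (0 : ℝ) 1, ∀ p, ∀ m : ℕ, 1 ≤ m → ∀ x : Ω,
      |meanOf (lawAfter (P ε p) (PMF.pure x) m) f - meanOf (ν ε p) f|
        ≤ 2 * (Finset.univ.sup f : ℕ) * C * α ^ m)
    -- convergence of the autocorrelations
    (γ : Fin N × Fin N → ℕ → ℝ)
    (hγ : ∀ p, ∀ t : ℕ,
      Tendsto (fun ε : ℝ => autoCorr (P ε p) (ν ε p) f t) (𝓝[>] 0) (𝓝 (γ p t)))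
    -- the chain of queue lengths and modulating states is irreducible and aperiodic
    (S : ℝ → Set (SwitchState N Ω))
    (hQirr : ∀ ε ∈ Set.Ioo (0 : ℝ) 1, IrreducibleOn (switchKernel f (P ε)) (S ε))
    (hQaper : ∀ ε ∈ Set.Ioo (0 : ℝ) 1, AperiodicOn (switchKernel f (P ε)) (S ε)) :
    ∃ (σ : EuclideanSpace ℝ (Fin N × Fin N)) (π : ℝ → PMF (SwitchState N Ω)),
      (∀ p, Tendsto (fun m : ℕ => γ p 0 + 2 * ∑ t ∈ Finset.Icc 1 m, γ p t) atTop
        (𝓝 (σ p ^ 2))) ∧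
      (∀ ε ∈ Set.Ioo (0 : ℝ) 1, IsSteadyState (switchKernel f (P ε)) (S ε) (π ε) ∧
        meanTotalQueue (π ε) ≠ ⊤) ∧
      Tendsto (fun ε : ℝ => ε * (meanTotalQueue (π ε)).toReal) (𝓝[>] 0)
        (𝓝 ((1 - 1 / (2 * (N : ℝ))) * ‖σ‖ ^ 2)) := by
  have hex0 : Nonempty Ω := by
    obtain ⟨x, -⟩ := (hXirr (1 / 2) ⟨by norm_num, by norm_num⟩).1
    exact ⟨x (⟨0, hN⟩, ⟨0, hN⟩)⟩
  have hL0 : (0 : ℝ) ≤ (Finset.univ.sup f : ℕ) := Nat.cast_nonneg _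
  have hfL : ∀ x, (f x : ℝ) ≤ (Finset.univ.sup f : ℕ) := fun x =>
    Nat.cast_le.2 (Finset.le_sup (Finset.mem_univ x))
  set L : ℝ := ((Finset.univ.sup f : ℕ) : ℝ) with hL
  have hvle : ∀ p, v p ≤ 1 := face_le_one hv
  -- one geometric bound for all times, including `0`
  set c : ℝ := L + 1 + |2 * L * C| with hc
  have hmix' : ∀ ε ∈ Set.Ioo (0 : ℝ) 1, ∀ p, ∀ t x,
      |meanOf (lawAfter (P ε p) (PMF.pure x) t) f - meanOf (ν ε p) f| ≤ c * α ^ t := by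
    intro ε hε p t x
    rcases Nat.eq_zero_or_pos t with rfl | ht
    · rw [meanOf_lawAfter_zero, hrate ε hε p, pow_zero, mul_one]
      have h1 : 0 ≤ (1 - ε) * v p := mul_nonneg (by linarith [hε.2]) (hvpos p).le
      have h2 : (1 - ε) * v p ≤ 1 := by nlinarith [hε.1, hε.2, hvle p, hvpos p]
      have h3 := hfL x
      have h4 : (0 : ℝ) ≤ f x := Nat.cast_nonneg _
      have h5 := abs_nonneg (2 * L * C)
      rw [abs_le]; constructor <;> linarith
    · refine (hmix ε hε p t ht x).trans (mul_le_mul_of_nonneg_right ?_ (pow_nonneg hα.1.le t))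
      linarith [le_abs_self (2 * L * C)]
  set H : ℝ := c / (1 - α) with hH
  set h : ℝ → Fin N × Fin N → Ω → ℝ := fun ε p => corrector (P ε p) f (meanOf (ν ε p) f) with hh
  have hcor : ∀ ε ∈ Set.Ioo (0 : ℝ) 1, IsCorrector f (P ε) v ε H (h ε) := fun ε hε =>
    { face := hv
      eps := hε
      bound := fun p x => abs_corrector_le hα (hmix' ε hε p) x
      poisson := fun p x => by
        rw [← hrate ε hε p]; exact corrector_sub_stepMean hα (hmix' ε hε p) x }
  obtain ⟨p₀, -, hp₀⟩ := Finset.exists_min_image Finset.univ v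
    ⟨((⟨0, hN⟩, ⟨0, hN⟩) : Fin N × Fin N), Finset.mem_univ _⟩
  have hvm : ∀ p, v p₀ ≤ v p := fun p => hp₀ p (Finset.mem_univ p)
  -- the steady states
  have hsteady : ∀ ε, ∃ π : PMF (SwitchState N Ω), ε ∈ Set.Ioo (0 : ℝ) 1 →
      IsSteadyState (switchKernel f (P ε)) (S ε) π ∧ meanTotalQueue π ≠ ⊤ := by
    intro ε
    by_cases hε : ε ∈ Set.Ioo (0 : ℝ) 1
    · obtain ⟨π, hπ⟩ := (hcor ε hε).exists_steadyState (hvpos p₀) hvm (hQirr ε hε) (hQaper ε hε)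
      exact ⟨π, fun _ => hπ⟩
    · exact ⟨PMF.pure (fun _ => 0, fun _ => hex0.some), fun hε' => absurd hε' hε⟩
  choose π hπ using hsteady
  have hmarg : ∀ ε ∈ Set.Ioo (0 : ℝ) 1, ∀ p, (π ε).map (fun z => z.2 p) = ν ε p := by
    intro ε hε p
    exact invariantLaw_unique ((hXirr ε hε).component p) ((hXaper ε hε).component p)
      (IsInvariantLaw.map (K' := P ε p) (fun z => switchKernel_map_eval f (P ε) z p)
        (hπ ε hε).1.2.1)
      (hν ε hε p) (Set.subset_univ _) (Set.subset_univ _)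
  -- the asymptotic variances
  set σε : ℝ → Fin N × Fin N → ℝ := fun ε p =>
    ∑ x, (ν ε p x).toReal * stepVar (P ε p) (h ε p) x with hσε
  set σ2 : Fin N × Fin N → ℝ := fun p => γ p 0 + 2 * ∑' t : ℕ, γ p (t + 1) with hσ2
  have hIoo : ∀ᶠ ε : ℝ in 𝓝[>] 0, ε ∈ Set.Ioo (0 : ℝ) 1 := Ioo_mem_nhdsGT zero_lt_one
  have hvar : ∀ p, Tendsto (fun m : ℕ => γ p 0 + 2 * ∑ t ∈ Finset.Icc 1 m, γ p t) atTop
      (𝓝 (σ2 p)) ∧ Tendsto (fun ε => σε ε p) (𝓝[>] 0) (𝓝 (σ2 p)) := by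
    intro p
    obtain ⟨h1, h2⟩ := tendsto_asymptoticVariance (F := 𝓝[>] (0 : ℝ))
      (G := fun ε t => autoCorr (P ε p) (ν ε p) f t) (c := c * c) hα
      (hIoo.mono fun ε hε t => by rw [mul_assoc]; exact abs_autoCorr_le (hmix' ε hε p) t) (hγ p)
    refine ⟨h1, h2.congr' ?_⟩
    filter_upwards [hIoo] with ε hε
    exact (sum_stepVar_corrector hα (hν ε hε p) (hmix' ε hε p)).symm
  have hσ2nn : ∀ p, 0 ≤ σ2 p := fun p => ge_of_tendsto' (hvar p).2 fun ε =>
    Finset.sum_nonneg fun x _ => mul_nonneg ENNReal.toReal_nonneg (stepVar_nonneg _ _ _)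
  -- state space collapse with constants that do not depend on `ε`
  obtain ⟨M, hM0, hM⟩ := exists_cubic_drift_bound (hvpos p₀)
    (6 * ((N : ℝ) ^ 2 * H) + (N : ℝ) ^ 2 * (1 + 2 * H) ^ 2) (2 * (N : ℝ) ^ 2 * (1 + 2 * H))
    ((N : ℝ) ^ 2 * (1 + 2 * H) ^ 2)
  have hsmall : ∀ᶠ ε : ℝ in 𝓝[>] 0, ε * (N : ℝ) ^ 2 ≤ v p₀ / 2 := by
    have h1 : Tendsto (fun ε : ℝ => ε * (N : ℝ) ^ 2) (𝓝[>] 0) (𝓝 (0 * (N : ℝ) ^ 2)) :=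
      (tendsto_nhdsWithin_of_tendsto_nhds tendsto_id).mul_const _
    rw [zero_mul] at h1
    exact h1.eventually_le_const (half_pos (hvpos p₀))
  set R : ℝ → ℝ := fun ε => 2 * ε * ((N : ℝ) ^ 2 * H) + N * ε ^ 2 +
    ((2 * N * H + 3 * N) * (N * ε) + (4 * N ^ 4 + 4 * N * M) * √ε) with hR
  have hRlim : Tendsto R (𝓝[>] 0) (𝓝 0) := by
    have h1 : Continuous R := by fun_prop
    have h2 := h1.tendsto 0
    have h3 : R 0 = 0 := by simp [hR]
    rw [h3] at h2
    exact tendsto_nhdsWithin_of_tendsto_nhds h2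
  have hbound : ∀ᶠ ε : ℝ in 𝓝[>] 0, |2 * (ε * (meanTotalQueue (π ε)).toReal) -
      (2 - 1 / (N : ℝ)) * ∑ p, σε ε p| ≤ R ε := by
    filter_upwards [hIoo, hsmall] with ε hε hs
    -- the weight `√ε` balances the unused service, of order `ε`, against the distance to the cone
    have h1 := (hcor ε hε).abs_stationary_sub_le hN (hπ ε hε).1.2.1 (hmarg ε hε) (hπ ε hε).2 hM0
      ((hcor ε hε).tsum_coneDistSq_le (hvpos p₀).le (hvle p₀) hvm hs hM (hQirr ε hε).1
        (hπ ε hε).1) (Real.sqrt_pos.2 hε.1)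
    refine h1.trans (le_of_eq ?_)
    have h2 : 4 * (N : ℝ) ^ 3 / √ε * (N * ε) = 4 * N ^ 4 * √ε := by
      rw [div_mul_eq_mul_div, div_eq_iff (Real.sqrt_pos.2 hε.1).ne', mul_assoc (4 * (N : ℝ) ^ 4),
        Real.mul_self_sqrt hε.1.le]
      ring
    simp only [hR]
    linear_combination h2
  have hlim0 : Tendsto (fun ε => 2 * (ε * (meanTotalQueue (π ε)).toReal) -
      (2 - 1 / (N : ℝ)) * ∑ p, σε ε p) (𝓝[>] 0) (𝓝 0) :=
    squeeze_zero_norm' (hbound.mono fun ε hε => hε) hRlim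
  have hlimσ : Tendsto (fun ε => (2 - 1 / (N : ℝ)) * ∑ p, σε ε p) (𝓝[>] 0)
      (𝓝 ((2 - 1 / (N : ℝ)) * ∑ p, σ2 p)) :=
    (tendsto_finsetSum _ fun p _ => (hvar p).2).const_mul _
  refine ⟨WithLp.toLp 2 fun p => √(σ2 p), π, fun p => ?_, hπ, ?_⟩
  · have h1 : (WithLp.toLp 2 fun p => √(σ2 p) : EuclideanSpace ℝ (Fin N × Fin N)) p ^ 2 = σ2 p :=
      Real.sq_sqrt (hσ2nn p)
    rw [h1]
    exact (hvar p).1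
  · have hnorm : ‖(WithLp.toLp 2 fun p => √(σ2 p) : EuclideanSpace ℝ (Fin N × Fin N))‖ ^ 2 =
        ∑ p, σ2 p := by
      rw [EuclideanSpace.real_norm_sq_eq]
      exact Finset.sum_congr rfl fun p _ => Real.sq_sqrt (hσ2nn p)
    have h1 := (hlim0.add hlimσ).const_mul (1 / 2)
    have h2 : 1 / 2 * (0 + (2 - 1 / (N : ℝ)) * ∑ p, σ2 p) =
        (1 - 1 / (2 * (N : ℝ))) * ∑ p, σ2 p := by
      have hN' : (N : ℝ) ≠ 0 := by positivity
      field_simp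
      ring
    rw [h2] at h1
    rw [hnorm]
    exact h1.congr fun ε => by ring
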